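/- **Setting.** There are $n$ players. Player $i$ has a finite state set $S_i$, a finite action set $A_i$ and transition probabilities $P_i(s_i'\mid s_i,a_i)$; the joint transition law is $\prod_i P_i(s_i'\mid s_i,a_i)$. Rewards $r_i(s,a)\in[0,1]$ depend on the joint state $s$ and joint action $a$ and are otherwise arbitrary. A stationary policy $\pi_i$ gives for each $s_i$ a probability vector $\pi_i(\cdot\mid s_i)$ on $A_i$, and induces on $S_i$ the Markov chain $P^{\pi_i}(s_i'\mid s_i)=\sum_{a_i}P_i(s_i'\mid s_i,a_i)\pi_i(a_i\mid s_i)$. Assume that for some $\tau>0$, for every $i$ and every stationary policy $\pi_i$, this chain is ergodic (irreducible and aperiodic) and $\|(v-v')P^{\pi_i}\|_1\le e^{-1/\tau}\|v-v'\|_1$ for all probability vectors $v,v'$ on $S_i$. The occupation polytope $\mathcal P_i$ is the set of $\rho_i\in\mathbb R_+^{S_i\times A_i}$ with $\sum_{s_i,a_i}\big(P_i(s_i'\mid s_i,a_i)-\mathbb I_{\{s_i=s_i'\}}\big)\rho_i(s_i,a_i)=0$ for all $s_i'$ and $\sum_{s_i,a_i}\rho_i(s_i,a_i)=1$. For $\delta_i>0$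 let $\mathcal P_i^{\delta_i}=\{\rho_i\in\mathcal P_i:\rho_i\ge\delta_i\text{ coordinatewise}\}$, and $\mathcal P^\delta=\prod_i\mathcal P_i^{\delta_i}$. Let $V_i(\rho)=\sum_{s,a}\prod_j\rho_j(s_j,a_j)\,r_i(s,a)$ and $$\Psi(\theta,\rho)=\sum_{i=1}^n\big[V_i(\theta_i,\rho_{-i})-V_i(\rho_i,\rho_{-i})\big].$$ **Algorithm.** Inputs: initial points $\rho_i^0\in\mathcal P_i^{\delta_i}$, dual scores $Y_i^0=0$, step sizes $\eta^k\ge0$ ($k=0,1,2,\dots$) common to all players, an integer $d\ge0$, and regularizers $h_i:\mathcal P_i^{\delta_i}\to\mathbb R$ such that the maximum of $\langle\cdot,y\rangle-h_i$ over $\mathcal P_i^{\delta_i}$ is attained for every $y$ (for example, $h_i$ continuous). The initial state is arbitrary, possibly random. Play proceeds in batches $k=0,1,2,\dots$; batch $k$ starts at time $\tau^k$, with $\tau^0=0$. In batch $k$ each player $i$ uses, independently of the others given the past, the policy $\pi_i^k(a_i\mid s_i)=\rho_i^k(s_i,a_i)/\sum_{a_i'}\rho_i^k(s_i,a_i')$.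 The batch ends at the first time $\tau^{k+1}$ at which all players have visited all of their own states during $[\tau^k+d,\tau^{k+1}]$. The actions at time $\tau^{k+1}$ still follow $\pi^k$; if $k\geq1$, a batch contains at least one time step after $\tau^k$. With $\mathrm e_{(s_i,a_i)}$ the standard basis vectors, put $$R_i^k=\sum_{t}\frac{r_i(s^t,a^t)}{\pi_i^k(a_i^t\mid s_i^t)}\,\mathrm e_{(s_i^t,a_i^t)},$$ where the sum is over those $t\in[\tau^k+d,\tau^{k+1}]$ at which player $i$ visits the state $s_i^t$ for the first time since $\tau^k+d$. Then $$Y_i^{k+1}=Y_i^k+\eta^kR_i^k,\qquad \rho_i^{k+1}=\operatorname*{argmax}_{\rho_i\in\mathcal P_i^{\delta_i}}\{\langle\rho_i,Y_i^{k+1}\rangle-h_i(\rho_i)\}.$$ **Theorem.** Assume that every $h_i$ is $K$-strongly convex on $\mathcal P_i^{\delta_i}$ with respect to the Euclidean norm for some $K>0$, that $\sum_{\ell\ge1}\eta^\ell=\infty$ and $\sum_{\ell\ge1}(\eta^\ell)^2<\infty$, and let $w^k=\sum_{\ell=1}^k\eta^\ell$. Let $\epsilon>0$ and suppose that all players follow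 the algorithm with $d\ge\tau\ln\big(\frac{6n}{\epsilon}\sum_{i=1}^n|A_i||S_i|\big)$. Then, almost surely, every batch ends after finitely many steps, and $$\limsup_{k\to\infty}\ \max_{\theta\in\mathcal P^\delta}\ \sum_{\ell=1}^k\frac{\eta^\ell}{w^k}\,\Psi(\theta,\rho^\ell)<\frac{\epsilon}{2}.$$ In particular, almost surely, the maximum is smaller than $\epsilon/2$ for all sufficiently large $k$. -/

import Mathlib

open scoped BigOperators

noncomputable section

namespace ChainGame

/-- An `n`-player stochastic game with independent chains: player `i` has states `S i`, actions
`A i` and transition probabilities `P i s a s' = P_i(s' | s, a)`; the players are coupled only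
through the rewards `r i s a ∈ [0, 1]`, which depend on the joint state and the joint action. -/
structure Game (n : ℕ) (S A : Fin n → Type*) [∀ i, Fintype (S i)] where
  P : ∀ i, S i → A i → S i → ℝ
  P_mem : ∀ i s a, P i s a ∈ stdSimplex ℝ (S i)
  r : Fin n → (∀ j, S j) → (∀ j, A j) → ℝ
  r_mem : ∀ i s a, r i s a ∈ Set.Icc (0 : ℝ) 1

/-- Vectors indexed by the state-action pairs of one player, with the Euclidean norm. -/
abbrev Occ {n : ℕ} (S A : Fin n → Type*) (i : Fin n) := EuclideanSpace ℝ (S i × A i)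

/-- Profiles `(ρ_1, …, ρ_n)` of such vectors, one for each player. -/
abbrev Profile {n : ℕ} (S A : Fin n → Type*) := ∀ i, Occ S A i

variable {n : ℕ} {S A : Fin n → Type*} [∀ i, Fintype (S i)] [∀ i, Fintype (A i)]
  [∀ i, DecidableEq (S i)] [∀ i, DecidableEq (A i)]

/-- A stationary policy of player `i`: for every state a probability vector over the actions. -/
def IsStationaryPolicy {i : Fin n} (p : S i → A i → ℝ) : Prop :=
  ∀ s, p s ∈ stdSimplex ℝ (A i)

/-- The transition matrix of the Markov chain on `S i` induced by a stationary policy `p`. -/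
def inducedChain (G : Game n S A) (i : Fin n) (p : S i → A i → ℝ) : Matrix (S i) (S i) ℝ :=
  Matrix.of fun s s' => ∑ a, G.P i s a s' * p s a

/-- Every chain induced by a stationary policy is ergodic (irreducible and aperiodic, that is, its
transition matrix is primitive) and contracts the `ℓ¹`-distance of distributions by `e^{-1/τ}`. -/
def UniformlyErgodic (G : Game n S A) (τ : ℝ) : Prop :=
  ∀ (i : Fin n) (p : S i → A i → ℝ), IsStationaryPolicy p →
    (inducedChain G i p).IsPrimitive ∧
    ∀ v ∈ stdSimplex ℝ (S i), ∀ v' ∈ stdSimplex ℝ (S i),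
      ∑ s, |Matrix.vecMul (v - v') (inducedChain G i p) s| ≤
        Real.exp (-(1 / τ)) * ∑ s, |v s - v' s|

/-- The occupation polytope of player `i`. -/
def occPolytope (G : Game n S A) (i : Fin n) : Set (Occ S A i) :=
  {ρ | (∀ x, 0 ≤ ρ x) ∧
    (∀ s' : S i, ∑ s, ∑ a, (G.P i s a s' - if s = s' then 1 else 0) * ρ (s, a) = 0) ∧
    ∑ s, ∑ a, ρ (s, a) = 1}

/-- The shrunk occupation polytope: occupation measures with all coordinates at least `δ`. -/
def shrunkPolytope (G : Game n S A) (i : Fin n) (δ : ℝ) : Set (Occ S A i) :=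
  {ρ | ρ ∈ occPolytope G i ∧ ∀ x, δ ≤ ρ x}

/-- The product of the shrunk occupation polytopes. -/
def shrunkProduct (G : Game n S A) (δ : Fin n → ℝ) : Set (Profile S A) :=
  {θ | ∀ i, θ i ∈ shrunkPolytope G i (δ i)}

/-- The payoff of player `i` in the virtual game. -/
def payoff (G : Game n S A) (i : Fin n) (ρ : Profile S A) : ℝ :=
  ∑ s : (∀ j, S j), ∑ a : (∀ j, A j), (∏ j, ρ j (s j, a j)) * G.r i s a

/-- The Nikaido-Isoda function of the virtual game. -/
def nikaidoIsoda (G : Game n S A) (θ ρ : Profile S A) : ℝ :=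
  ∑ i, (payoff G i (Function.update ρ i (θ i)) - payoff G i ρ)

/-- The stationary policy that corresponds to an occupation measure. -/
def policyOf {i : Fin n} (ρ : Occ S A i) (s : S i) (a : A i) : ℝ :=
  ρ (s, a) / ∑ a', ρ (s, a')

/-- The input of the algorithm, for all players: thresholds `δ_i`, regularizers `h_i`, initial
occupation measures, the common step sizes `η^k` and the burn-in length `d`. -/
structure Input (S A : Fin n → Type*) where
  δ : Fin n → ℝ
  h : ∀ i, Occ S A i → ℝ
  ρ₀ : Profile S A
  η : ℕ → ℝ
  d : ℕ

/-- `x` attains the maximum of `⟨·, y⟩ - h` over `X`. -/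
def IsRegArgmax {E : Type*} [NormedAddCommGroup E] [InnerProductSpace ℝ E]
    (X : Set E) (h : E → ℝ) (y x : E) : Prop :=
  x ∈ X ∧ ∀ z ∈ X, inner ℝ z y - h z ≤ inner ℝ x y - h x

/-- The dual averaging oracle `argmax_{x ∈ X} {⟨x, y⟩ - h x}`. -/
def daOracle {E : Type*} [NormedAddCommGroup E] [InnerProductSpace ℝ E]
    (X : Set E) (h : E → ℝ) (y : E) : E :=
  Classical.epsilon (IsRegArgmax X h y)

/-- What the players remember when they choose their actions at some time: the index `k` of the
current batch, its starting time `τ^k`, the dual scores `Y^k` and the occupation measures `ρ^k`. -/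
structure AlgState (S A : Fin n → Type*) where
  batch : ℕ
  start : ℕ
  Y : Profile S A
  ρ : Profile S A

/-- Along the state path `s`, every player has visited all its states during `[b, t]`. -/
def AllVisited (s : ℕ → ∀ i, S i) (b t : ℕ) : Prop :=
  ∀ (i : Fin n) (x : S i), ∃ u ∈ Finset.Icc b t, s u i = x

/-- Time `t` is the first visit of player `i` to its current state in the sampling period that
starts at time `b` (the state is still in the list `S'_i` of states to be sampled). -/
def FirstVisit (s : ℕ → ∀ i, S i) (i : Fin n) (b t : ℕ) : Prop :=
  ∀ u ∈ Finset.Ico b t, s u i ≠ s t i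

open Classical in
/-- The gradient estimator of player `i` collected during the sampling period `[b, t]`, when the
player uses the policy of the occupation measure `ρ`: each first visit to a state adds
`r_i(s^u, a^u) / π_i(a_i^u | s_i^u)` in the coordinate `(s_i^u, a_i^u)`. -/
def estimator (G : Game n S A) (s : ℕ → ∀ i, S i) (a : ℕ → ∀ i, A i) (i : Fin n)
    (ρ : Occ S A i) (b t : ℕ) : Occ S A i :=
  ∑ u ∈ Finset.Icc b t,
    if FirstVisit s i b u then
      EuclideanSpace.single (s u i, a u i) (G.r i (s u) (a u) / policyOf ρ (s u i) (a u i))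
    else 0

open Classical in
/-- The state of the algorithm when the actions of time `t` are chosen, along the path `(s, a)`;
it depends only on the states and actions at times before `t`. Batch `k` starts at `τ^k`
(`τ^0 = 0`), its sampling period starts at `τ^k + d`, and it ends at the first time `t = τ^{k+1}` at
which all players have visited all their states in `[τ^k + d, t]`; the actions of time `τ^{k+1}`
still belong to batch `k`. Then `Y^{k+1} = Y^k + η^k R^k`, and `ρ^{k+1}` is the oracle's answer. -/
def algState (G : Game n S A) (I : Input S A) (s : ℕ → ∀ i, S i) (a : ℕ → ∀ i, A i) :
    ℕ → AlgState S A
  | 0 => { batch := 0, start := 0, Y := 0, ρ := I.ρ₀ }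
  | t + 1 =>
    let c := algState G I s a t
    if AllVisited s (c.start + I.d) t then
      let Y' : Profile S A := fun i =>
        c.Y i + I.η c.batch • estimator G s a i (c.ρ i) (c.start + I.d) t
      { batch := c.batch + 1
        start := t
        Y := Y'
        ρ := fun i => daOracle (shrunkPolytope G i (I.δ i)) (I.h i) (Y' i) }
    else c

/-- The occupation measures `ρ^k` used in batch `k` along the path `(s, a)`. -/
def iterate (G : Game n S A) (I : Input S A) (s : ℕ → ∀ i, S i) (a : ℕ → ∀ i, A i) (k : ℕ) :
    Profile S A :=
  (algState G I s a (sInf {t | (algState G I s a t).batch = k})).ρ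

/-- The random states `s t` and actions `a t` are those of the game when all players follow the
algorithm: given the history `s^0, a^0, …, a^{t-1}, s^t`, the players choose their actions
independently, each from the policy of its current occupation measure, and then move
independently according to their own transition probabilities. The law of `s^0` is arbitrary. -/
structure IsRun (G : Game n S A) (I : Input S A) {Ω : Type*} [MeasurableSpace Ω]
    (μ : MeasureTheory.Measure Ω) (s : ℕ → Ω → ∀ i, S i) (a : ℕ → Ω → ∀ i, A i) : Prop where
  measurable_state : ∀ t x, MeasurableSet {ω | s t ω = x}
  measurable_action : ∀ t x, MeasurableSet {ω | a t ω = x}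
  law : ∀ (t : ℕ) (σ : ℕ → ∀ i, S i) (α : ℕ → ∀ i, A i),
    μ.real {ω | (∀ u ≤ t + 1, s u ω = σ u) ∧ ∀ u ≤ t, a u ω = α u} =
      μ.real {ω | (∀ u ≤ t, s u ω = σ u) ∧ ∀ u < t, a u ω = α u} *
        ∏ i, (policyOf ((algState G I σ α t).ρ i) (σ t i) (α t i) *
          G.P i (σ t i) (α t i) (σ (t + 1) i))

/-- The step-size-weighted average `∑_{ℓ=1}^k (η^ℓ / w^k) Ψ(θ, ρ^ℓ)`, `w^k = ∑_{ℓ=1}^k η^ℓ`. -/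
def averagedGap (G : Game n S A) (η : ℕ → ℝ) (ρ : ℕ → Profile S A) (k : ℕ) (θ : Profile S A) :
    ℝ :=
  ∑ l ∈ Finset.Icc 1 k, η l / (∑ m ∈ Finset.Icc 1 k, η m) * nikaidoIsoda G θ (ρ l)

end ChainGame

end

/-! Fix a comparator θ. The payoff of player i is linear in its own occupation measure, so Ψ(θ, ρ)
is the sum over i of ⟨θ_i - ρ_i, g_i(ρ)⟩, where g_i is the partial payoff gradient
(`nikaidoIsoda_eq`). Replacing g_i by the estimate R_i splits the weighted sum of gaps into the
regret of dual averaging against R and the errors η^ℓ (ρ_i^ℓ - θ_i)(R_i^ℓ - g_i(ρ^ℓ)), coordinate by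
coordinate. The regret is bounded, because the estimates are bounded and the squared steps are
summable (`dualAveraging_regret`).

The mean of an error. The coordinate (x, b) is sampled when player i first reaches x after the
burn-in. That time depends on the chain of player i alone, so at that time the other players still
have the laws of their own chains, which are close to stationary. Importance weighting makes the
sampled coordinate an unbiased estimate of the reward of b in the joint state met there, and g_i(x,
b) is the same mean under the stationary marginals of the others. The bias is therefore at most (∑_j
|S_j|) e^{-d/τ} (`abs_hitValue_le`). The occupation measure of a new batch depends on the actions
that end the old one, so the conditioning includes these actions and only d - 1 steps under the new
policies remain before sampling. The lost factor e^{-1/τ} is recovered because every transition row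
is already within 2|S_j| e^{-1/τ} of stationarity (`sum_abs_transition_sub_stateMarginal_le`).

The fluctuation of the errors. At each time, `pendingError` is the conditional mean of the error
still to be sampled in the current batch. Sampled errors plus changes of the pending error minus
biases form a martingale M (`stepMean_nextError`). Batches have random lengths, so the squared
increments of M cannot be bounded uniformly and added up. The difference of M² and the squared
pending error is compensated instead: the compensator `squareJumps` changes only when a sample is
taken or a batch ends, hence is O(∑ η²) for each path (`squareJumps_le`). So M is bounded in L¹,
converges almost surely, and in particular is almost surely bounded (`ae_bounded_sum_sampleError`).

Batches end almost surely, because every policy used visits each state with probability at least δ_i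
/ 2 after a fixed number of steps (`ae_forall_exists_batch`).

For fixed θ the weighted sum of gaps is thus at most C + (ε/3) w^k. A finite net of comparators and
the Lipschitz dependence of Ψ on θ make this uniform in θ, and the room between ε/3 and ε/2 absorbs
the net error and C / w^k. -/

set_option linter.unusedSectionVars false

namespace ChainGame

/-! ### Finite-state path laws, one-step means and martingales. -/

section PathLaw

open MeasureTheory

variable {X Y : Type*} {β : Type*}

/-- A functional of state and action paths that depends only on the states up to time `t` and on
the actions before time `t`. -/
def DependsOnHistory (t : ℕ) (F : (ℕ → X) → (ℕ → Y) → β) : Prop :=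
  ∀ σ σ' α α', (∀ u ≤ t, σ u = σ' u) → (∀ u < t, α u = α' u) → F σ α = F σ' α'

lemma DependsOnHistory.mono {t t' : ℕ} (h : t ≤ t') {F : (ℕ → X) → (ℕ → Y) → β}
    (hF : DependsOnHistory t F) : DependsOnHistory t' F :=
  fun σ σ' α α' h1 h2 => hF σ σ' α α' (fun u hu => h1 u (hu.trans h)) fun u hu =>
    h2 u (hu.trans_le h)

lemma DependsOnHistory.comp {γ : Type*} {t : ℕ} {F : (ℕ → X) → (ℕ → Y) → β}
    (hF : DependsOnHistory t F) (g : β → γ) : DependsOnHistory t fun σ α => g (F σ α) :=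
  fun σ σ' α α' h1 h2 => congrArg g (hF σ σ' α α' h1 h2)

lemma DependsOnHistory.comp₂ {γ δ : Type*} {t : ℕ} {F : (ℕ → X) → (ℕ → Y) → β}
    {F' : (ℕ → X) → (ℕ → Y) → γ} (hF : DependsOnHistory t F) (hF' : DependsOnHistory t F')
    (g : β → γ → δ) : DependsOnHistory t fun σ α => g (F σ α) (F' σ α) :=
  fun σ σ' α α' h1 h2 => congrArg₂ g (hF σ σ' α α' h1 h2) (hF' σ σ' α α' h1 h2)

lemma dependsOnHistory_sum {t : ℕ} {F : ℕ → (ℕ → X) → (ℕ → Y) → ℝ} (J : Finset ℕ)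
    (hF : ∀ u ∈ J, DependsOnHistory t (F u)) :
    DependsOnHistory t fun σ α => ∑ u ∈ J, F u σ α :=
  fun σ σ' α α' h1 h2 => Finset.sum_congr rfl fun u hu => hF u hu σ σ' α α' h1 h2

/-- The path, changed at time `t + 1` (states) and at time `t` (actions). -/
def stepTo (F : (ℕ → X) → (ℕ → Y) → β) (t : ℕ) (σ : ℕ → X) (α : ℕ → Y) (b : Y) (y : X) : β :=
  F (Function.update σ (t + 1) y) (Function.update α t b)

/-- The history up to time `t` of a path. -/
def historyOf (t : ℕ) (σ : ℕ → X) (α : ℕ → Y) : (Fin (t + 1) → X) × (Fin t → Y) :=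
  (fun u => σ u, fun u => α u)

lemma historyOf_eq_iff {t : ℕ} {σ σ' : ℕ → X} {α α' : ℕ → Y} :
    historyOf t σ α = historyOf t σ' α' ↔ (∀ u ≤ t, σ u = σ' u) ∧ ∀ u < t, α u = α' u := by
  simp only [historyOf, Prod.mk.injEq, funext_iff, Fin.forall_iff, Nat.lt_succ_iff]

variable [Fintype X] [Fintype Y]

/-- The one-step conditional mean of a path functional, given the history up to time `t`, for the
transition weights `W`. -/
noncomputable def stepMean (W : ℕ → (ℕ → X) → (ℕ → Y) → Y → X → ℝ) (t : ℕ)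
    (F : (ℕ → X) → (ℕ → Y) → ℝ) (σ : ℕ → X) (α : ℕ → Y) : ℝ :=
  ∑ b, ∑ y, W t σ α b y * stepTo F t σ α b y

/-- The random states and actions evolve according to the transition weights `W`. -/
structure HasPathLaw (W : ℕ → (ℕ → X) → (ℕ → Y) → Y → X → ℝ) {Ω : Type*} [MeasurableSpace Ω]
    (μ : Measure Ω) (s : ℕ → Ω → X) (a : ℕ → Ω → Y) : Prop where
  measurable_state : ∀ t x, MeasurableSet {ω | s t ω = x}
  measurable_action : ∀ t x, MeasurableSet {ω | a t ω = x}
  weight : ∀ t, DependsOnHistory t (W t)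
  law : ∀ (t : ℕ) (σ : ℕ → X) (α : ℕ → Y),
    μ.real {ω | (∀ u ≤ t + 1, s u ω = σ u) ∧ ∀ u ≤ t, a u ω = α u} =
      μ.real {ω | (∀ u ≤ t, s u ω = σ u) ∧ ∀ u < t, a u ω = α u} * W t σ α (α t) (σ (t + 1))

variable {W : ℕ → (ℕ → X) → (ℕ → Y) → Y → X → ℝ} {Ω : Type*} [mΩ : MeasurableSpace Ω]
  {μ : Measure Ω} [IsProbabilityMeasure μ] {s : ℕ → Ω → X} {a : ℕ → Ω → Y}

lemma stepMean_dependsOnHistory (hW : ∀ t, DependsOnHistory t (W t)) {t : ℕ}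
    {F : (ℕ → X) → (ℕ → Y) → ℝ} (hF : DependsOnHistory (t + 1) F) :
    DependsOnHistory t (stepMean W t F) := by
  intro σ σ' α α' h1 h2
  unfold stepMean
  rw [hW t σ σ' α α' h1 h2]
  refine Finset.sum_congr rfl fun b _ => Finset.sum_congr rfl fun y _ => ?_
  congr 1
  apply hF
  · intro u hu
    rcases Nat.lt_succ_iff_lt_or_eq.mp (Nat.lt_succ_of_le hu) with h | rfl
    · rw [Function.update_of_ne (by omega), Function.update_of_ne (by omega), h1 u (by omega)]
    · simp
  · intro u hu
    rcases Nat.lt_succ_iff_lt_or_eq.mp hu with h | rfl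
    · rw [Function.update_of_ne (by omega), Function.update_of_ne (by omega), h2 u h]
    · simp

namespace HasPathLaw

lemma measurableSet_atom (h : HasPathLaw W μ s a) (t : ℕ) (σ : ℕ → X) (α : ℕ → Y) :
    MeasurableSet {ω | (∀ u ≤ t, s u ω = σ u) ∧ ∀ u < t, a u ω = α u} := by
  have : {ω | (∀ u ≤ t, s u ω = σ u) ∧ ∀ u < t, a u ω = α u} =
      (⋂ u, ⋂ (_ : u ≤ t), {ω | s u ω = σ u}) ∩ ⋂ u, ⋂ (_ : u < t), {ω | a u ω = α u} := by
    ext ω; simp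
  rw [this]
  exact (MeasurableSet.iInter fun u => MeasurableSet.iInter fun _ => h.measurable_state u _).inter
    (MeasurableSet.iInter fun u => MeasurableSet.iInter fun _ => h.measurable_action u _)

lemma measurable_history (h : HasPathLaw W μ s a) (t : ℕ) :
    @Measurable _ _ mΩ ⊤ fun ω => historyOf t (fun u => s u ω) (fun u => a u ω) := by
  let _ : MeasurableSpace ((Fin (t + 1) → X) × (Fin t → Y)) := ⊤
  refine measurable_to_countable fun ω₀ => ?_
  convert h.measurableSet_atom t (fun u => s u ω₀) (fun u => a u ω₀) using 1
  ext ω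
  exact historyOf_eq_iff

/-- The filtration generated by the histories. -/
def filtration (h : HasPathLaw W μ s a) : Filtration ℕ mΩ where
  seq t := MeasurableSpace.comap (fun ω => historyOf t (fun u => s u ω) (fun u => a u ω)) ⊤
  mono' := by
    intro t t' htt' B hB
    obtain ⟨B', -, rfl⟩ := hB
    refine ⟨(fun p : (Fin (t' + 1) → X) × (Fin t' → Y) =>
      ((fun u => p.1 ⟨u, by omega⟩, fun u => p.2 ⟨u, by omega⟩) :
        (Fin (t + 1) → X) × (Fin t → Y))) ⁻¹' B', trivial, rfl⟩
  le' t := by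
    rintro B ⟨B', -, rfl⟩
    exact h.measurable_history t trivial

lemma stronglyMeasurable_filtration (h : HasPathLaw W μ s a) {t : ℕ}
    {F : (ℕ → X) → (ℕ → Y) → ℝ} (hF : DependsOnHistory t F) :
    StronglyMeasurable[h.filtration t] fun ω => F (fun u => s u ω) (fun u => a u ω) := by
  classical
  let _ : MeasurableSpace ((Fin (t + 1) → X) × (Fin t → Y)) := ⊤
  have hfac : (fun ω => F (fun u => s u ω) (fun u => a u ω)).FactorsThrough
      fun ω => historyOf t (fun u => s u ω) (fun u => a u ω) := by
    intro ω ω' hω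
    rw [historyOf_eq_iff] at hω
    exact hF _ _ _ _ hω.1 hω.2
  rw [← hfac.extend_comp fun _ => 0]
  apply Measurable.stronglyMeasurable
  exact measurable_from_top.comp (comap_measurable _)

lemma integrable (h : HasPathLaw W μ s a) {t : ℕ} {F : (ℕ → X) → (ℕ → Y) → ℝ}
    (hF : DependsOnHistory t F) :
    Integrable (fun ω => F (fun u => s u ω) (fun u => a u ω)) μ := by
  classical
  let _ : MeasurableSpace ((Fin (t + 1) → X) × (Fin t → Y)) := ⊤
  have hfac : (fun ω => F (fun u => s u ω) (fun u => a u ω)).FactorsThrough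
      fun ω => historyOf t (fun u => s u ω) (fun u => a u ω) := by
    intro ω ω' hω
    rw [historyOf_eq_iff] at hω
    exact hF _ _ _ _ hω.1 hω.2
  rw [← hfac.extend_comp fun _ => 0]
  have hm := h.measurable_history t
  have : IsProbabilityMeasure
      (μ.map fun ω => historyOf t (fun u => s u ω) (fun u => a u ω)) :=
    Measure.isProbabilityMeasure_map hm.aemeasurable
  exact (Integrable.of_finite (f := Function.extend
    (fun ω => historyOf t (fun u => s u ω) (fun u => a u ω))
    (fun ω => F (fun u => s u ω) (fun u => a u ω)) fun _ => 0)).comp_measurable hm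

/-- This is the tower property. The finitely many histories up to time `t` partition the space; on
each atom the one-step mean is constant, and the law gives the mass of each continuation by one
action and one state. -/
lemma integral_stepMean (h : HasPathLaw W μ s a) {t : ℕ} {F : (ℕ → X) → (ℕ → Y) → ℝ}
    (hF : DependsOnHistory (t + 1) F) :
    ∫ ω, stepMean W t F (fun u => s u ω) (fun u => a u ω) ∂μ =
      ∫ ω, F (fun u => s u ω) (fun u => a u ω) ∂μ := by
  classical
  set hist := fun ω => historyOf t (fun u => s u ω) (fun u => a u ω) with hhist
  have hmeas : ∀ x, MeasurableSet (hist ⁻¹' {x}) := fun x => h.measurable_history t trivial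
  have hdisj : Pairwise (Function.onFun Disjoint fun x => hist ⁻¹' {x}) := by
    intro x y hxy
    exact Disjoint.preimage _ (by simpa using hxy)
  have huniv : (⋃ x, hist ⁻¹' {x}) = Set.univ := by
    ext ω; simp
  have key : ∀ g : Ω → ℝ, Integrable g μ → ∫ ω, g ω ∂μ = ∑ x, ∫ ω in hist ⁻¹' {x}, g ω ∂μ := by
    intro g hg
    rw [← integral_iUnion_fintype hmeas hdisj fun x => hg.integrableOn, huniv,
      Measure.restrict_univ]
  have hK : DependsOnHistory t (stepMean W t F) := stepMean_dependsOnHistory h.weight hF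
  rw [key _ (h.integrable hK), key _ (h.integrable hF)]
  refine Finset.sum_congr rfl fun x _ => ?_
  rcases (hist ⁻¹' {x}).eq_empty_or_nonempty with he | ⟨ω₀, hω₀⟩
  · simp [he]
  have hatom : hist ⁻¹' {x} = {ω | (∀ u ≤ t, s u ω = s u ω₀) ∧ ∀ u < t, a u ω = a u ω₀} := by
    ext ω
    have : hist ω₀ = x := hω₀
    rw [Set.mem_preimage, Set.mem_singleton_iff, ← this]
    exact historyOf_eq_iff
  rw [hatom]
  set B := {ω | (∀ u ≤ t, s u ω = s u ω₀) ∧ ∀ u < t, a u ω = a u ω₀} with hB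
  have hBm : MeasurableSet B := h.measurableSet_atom t _ _
  have h1 : ∫ ω in B, stepMean W t F (fun u => s u ω) (fun u => a u ω) ∂μ =
      μ.real B * stepMean W t F (fun u => s u ω₀) (fun u => a u ω₀) := by
    rw [setIntegral_congr_fun hBm
      (g := fun _ => stepMean W t F (fun u => s u ω₀) (fun u => a u ω₀))
      (fun ω hω => hK _ _ _ _ hω.1 hω.2), setIntegral_const, smul_eq_mul]
  have h2 : ∀ ω ∈ B, F (fun u => s u ω) (fun u => a u ω) =
      ∑ b, ∑ y, Set.indicator {ω | a t ω = b ∧ s (t + 1) ω = y}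
        (fun _ => stepTo F t (fun u => s u ω₀) (fun u => a u ω₀) b y) ω := by
    intro ω hω
    rw [Finset.sum_eq_single (a t ω), Finset.sum_eq_single (s (t + 1) ω)]
    · rw [Set.indicator_of_mem (show ω ∈ {ω' | a t ω' = a t ω ∧ s (t + 1) ω' = s (t + 1) ω} from
        ⟨rfl, rfl⟩)]
      apply hF
      · intro u hu
        rcases Nat.lt_succ_iff_lt_or_eq.mp (Nat.lt_succ_of_le hu) with h | rfl
        · rw [Function.update_of_ne (by omega)]
          exact hω.1 u (by omega)
        · simp
      · intro u hu
        rcases Nat.lt_succ_iff_lt_or_eq.mp hu with h | rfl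
        · rw [Function.update_of_ne (by omega)]
          exact hω.2 u h
        · simp
    · intro y _ hy
      exact Set.indicator_of_notMem (fun hc => hy hc.2.symm) _
    · simp
    · intro b _ hb
      exact Finset.sum_eq_zero fun y _ => Set.indicator_of_notMem (fun hc => hb hc.1.symm) _
    · simp
  have hmb : ∀ b y, MeasurableSet {ω | a t ω = b ∧ s (t + 1) ω = y} := fun b y =>
    (h.measurable_action t b).inter (h.measurable_state (t + 1) y)
  rw [h1, setIntegral_congr_fun hBm h2, integral_finsetSum]
  · unfold stepMean
    rw [Finset.mul_sum]
    refine Finset.sum_congr rfl fun b _ => ?_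
    rw [integral_finsetSum]
    · rw [Finset.mul_sum]
      refine Finset.sum_congr rfl fun y _ => ?_
      rw [setIntegral_indicator (hmb b y), setIntegral_const, smul_eq_mul, ← mul_assoc]
      congr 1
      -- The law is applied to the path that agrees with `ω₀` on the history and continues with the
      -- action `b` and the state `y`.
      have hl := h.law t (Function.update (fun u => s u ω₀) (t + 1) y)
        (Function.update (fun u => a u ω₀) t b)
      have e1 : {ω | (∀ u ≤ t, s u ω = Function.update (fun u => s u ω₀) (t + 1) y u) ∧
          ∀ u < t, a u ω = Function.update (fun u => a u ω₀) t b u} = B := by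
        ext ω
        refine and_congr (forall₂_congr fun u hu => ?_) (forall₂_congr fun u hu => ?_)
        · rw [Function.update_of_ne (by omega)]
        · rw [Function.update_of_ne (by omega)]
      have e2 : {ω | (∀ u ≤ t + 1, s u ω = Function.update (fun u => s u ω₀) (t + 1) y u) ∧
          ∀ u ≤ t, a u ω = Function.update (fun u => a u ω₀) t b u} =
          B ∩ {ω | a t ω = b ∧ s (t + 1) ω = y} := by
        ext ω
        simp only [hB, Set.mem_ofPred_eq, Set.mem_inter_iff]
        constructor
        · rintro ⟨p, q⟩
          refine ⟨⟨fun u hu => ?_, fun u hu => ?_⟩, ?_, ?_⟩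
          · rw [p u (by omega), Function.update_of_ne (by omega)]
          · rw [q u (by omega), Function.update_of_ne (by omega)]
          · rw [q t le_rfl, Function.update_self]
          · rw [p (t + 1) le_rfl, Function.update_self]
        · rintro ⟨⟨p, q⟩, p', q'⟩
          refine ⟨fun u hu => ?_, fun u hu => ?_⟩
          · rcases Nat.lt_succ_iff_lt_or_eq.mp (Nat.lt_succ_of_le hu) with h | rfl
            · rw [Function.update_of_ne (by omega), p u (by omega)]
            · rw [q', Function.update_self]
          · rcases Nat.lt_succ_iff_lt_or_eq.mp (Nat.lt_succ_of_le hu) with h | rfl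
            · rw [Function.update_of_ne (by omega), q u (by omega)]
            · rw [p', Function.update_self]
      rw [e1, e2, Function.update_self, Function.update_self] at hl
      rw [hl]
      congr 1
      refine congrFun (congrFun (h.weight t _ _ _ _ (fun u hu => ?_) fun u hu => ?_) b) y
      · rw [Function.update_of_ne (by omega)]
      · rw [Function.update_of_ne (by omega)]
    · intro y _
      exact (integrable_const _).indicator (hmb b y)
  · intro b _
    exact integrable_finsetSum _ fun y _ => (integrable_const _).indicator (hmb b y)

lemma stepMean_mul_left {t : ℕ} {c : (ℕ → X) → (ℕ → Y) → ℝ} (hc : DependsOnHistory t c)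
    (F : (ℕ → X) → (ℕ → Y) → ℝ) (σ : ℕ → X) (α : ℕ → Y) :
    stepMean W t (fun σ α => c σ α * F σ α) σ α = c σ α * stepMean W t F σ α := by
  unfold stepMean
  rw [Finset.mul_sum]
  refine Finset.sum_congr rfl fun b _ => ?_
  rw [Finset.mul_sum]
  refine Finset.sum_congr rfl fun y _ => ?_
  have : stepTo (fun σ α => c σ α * F σ α) t σ α b y = c σ α * stepTo F t σ α b y := by
    refine congrArg (· * _) (hc _ _ _ _ (fun u hu => ?_) fun u hu => ?_)
    · rw [Function.update_of_ne (by omega)]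
    · rw [Function.update_of_ne (by omega)]
  rw [this]; ring

/-- An event known at time `t` is a preimage under the history map. Its indicator is then a
functional of the history, which can be pulled out of the one-step mean before the tower property is
used. -/
lemma martingale (h : HasPathLaw W μ s a) {M : ℕ → (ℕ → X) → (ℕ → Y) → ℝ}
    (hM : ∀ t, DependsOnHistory t (M t)) (hstep : ∀ t σ α, stepMean W t (M (t + 1)) σ α = M t σ α) :
    Martingale (fun t ω => M t (fun u => s u ω) (fun u => a u ω)) h.filtration μ := by
  classical
  refine martingale_of_setIntegral_eq_succ (fun t => h.stronglyMeasurable_filtration (hM t))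
    (fun t => h.integrable (hM t)) ?_
  intro t B hB
  have hBm := h.filtration.le t B hB
  obtain ⟨B', -, rfl⟩ := hB
  set c : (ℕ → X) → (ℕ → Y) → ℝ := fun σ α => if historyOf t σ α ∈ B' then 1 else 0 with hc
  have hcd : DependsOnHistory t c := by
    intro σ σ' α α' h1 h2
    simp only [hc]
    rw [historyOf_eq_iff.mpr ⟨h1, h2⟩]
  have e : ∀ F : (ℕ → X) → (ℕ → Y) → ℝ,
      ∫ ω in (fun ω => historyOf t (fun u => s u ω) (fun u => a u ω)) ⁻¹' B',
        F (fun u => s u ω) (fun u => a u ω) ∂μ =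
      ∫ ω, c (fun u => s u ω) (fun u => a u ω) * F (fun u => s u ω) (fun u => a u ω) ∂μ := by
    intro F
    rw [← integral_indicator hBm]
    refine integral_congr_ae (Filter.Eventually.of_forall fun ω => ?_)
    by_cases hω : historyOf t (fun u => s u ω) (fun u => a u ω) ∈ B'
    · simp [Set.indicator, hc, hω]
    · simp [Set.indicator, hc, hω]
  rw [e (M t), e (M (t + 1)),
    ← h.integral_stepMean ((hcd.mono t.le_succ).comp₂ (hM (t + 1)) fun x y => x * y)]
  refine integral_congr_ae (Filter.Eventually.of_forall fun ω => ?_)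
  change _ = stepMean W t (fun σ α => c σ α * M (t + 1) σ α) _ _
  rw [stepMean_mul_left hcd, hstep]

/-- A martingale functional whose square is dominated, up to a constant, by another martingale
functional is almost surely bounded. -/
lemma ae_bounded (h : HasPathLaw W μ s a) {M L : ℕ → (ℕ → X) → (ℕ → Y) → ℝ} {C : ℝ}
    (hM : ∀ t, DependsOnHistory t (M t)) (hstep : ∀ t σ α, stepMean W t (M (t + 1)) σ α = M t σ α)
    (hL : ∀ t, DependsOnHistory t (L t)) (hLstep : ∀ t σ α, stepMean W t (L (t + 1)) σ α = L t σ α)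
    (hML : ∀ t σ α, M t σ α ^ 2 ≤ L t σ α + C) :
    ∀ᵐ ω ∂μ, ∃ D, ∀ t, |M t (fun u => s u ω) (fun u => a u ω)| ≤ D := by
  set g : ℕ → Ω → ℝ := fun t ω => M t (fun u => s u ω) (fun u => a u ω)
  have hmart := h.martingale hM hstep
  set E := ∫ ω, L 0 (fun u => s u ω) (fun u => a u ω) ∂μ with hE
  have hLint : ∀ t, ∫ ω, L t (fun u => s u ω) (fun u => a u ω) ∂μ = E := by
    intro t
    induction t with
    | zero => rfl
    | succ t ih =>
      rw [← ih, ← h.integral_stepMean (hL (t + 1))]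
      simp only [hLstep]
  -- Submartingale convergence needs only a bound in L¹, which follows from the second moment by |g|
  -- ≤ g² + 1.
  have hL1 : ∀ t, ∫ ω, |g t ω| ∂μ ≤ E + C + 1 := by
    intro t
    calc ∫ ω, |g t ω| ∂μ
        ≤ ∫ ω, (L t (fun u => s u ω) (fun u => a u ω) + (C + 1)) ∂μ := by
          refine integral_mono (h.integrable (hM t)).abs
            ((h.integrable (hL t)).add (integrable_const _)) fun ω => ?_
          have := hML t (fun u => s u ω) (fun u => a u ω)
          have h2 : |g t ω| ≤ g t ω ^ 2 + 1 := by
            rw [← sq_abs]; nlinarith [sq_nonneg (|g t ω| - 1), abs_nonneg (g t ω)]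
          simp only [g] at h2 ⊢
          linarith
      _ = E + C + 1 := by
          rw [integral_add (h.integrable (hL t)) (integrable_const _), hLint]
          simp [add_assoc]
  have hbdd : ∀ t, eLpNorm (g t) 1 μ ≤ ((E + C + 1).toNNReal : NNReal) := by
    intro t
    have hi : Integrable (g t) μ := h.integrable (hM t)
    rw [eLpNorm_one_eq_lintegral_enorm, ← ofReal_integral_norm_eq_lintegral_enorm hi]
    exact ENNReal.ofReal_le_ofReal (hL1 t)
  filter_upwards [hmart.submartingale.exists_ae_tendsto_of_bdd hbdd] with ω ⟨c, hc⟩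
  obtain ⟨D, hD⟩ := hc.abs.bddAbove_range
  exact ⟨D, fun t => hD ⟨t, rfl⟩⟩

end HasPathLaw

end PathLaw

end ChainGame

namespace ChainGame

/-! ### Independent chains: product laws, killed chains and hitting times. -/

section ProductChains

variable {ι : Type*} [Fintype ι] [DecidableEq ι] {S : ι → Type*} [∀ i, Fintype (S i)]
  [∀ i, DecidableEq (S i)]

/-- The mean of `ψ` under the product of the (signed) weights `l j`. -/
noncomputable def prodMean (l : ∀ j, S j → ℝ) (ψ : (∀ j, S j) → ℝ) : ℝ :=
  ∑ z, (∏ j, l j (z j)) * ψ z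

lemma sum_prod_eq (l : ∀ j, S j → ℝ) : ∑ z : (∀ j, S j), ∏ j, l j (z j) = ∏ j, ∑ x, l j x := by
  rw [Finset.prod_univ_sum, Fintype.piFinset_univ]

lemma prod_mem_stdSimplex {l : ∀ j, S j → ℝ} (hl : ∀ j, l j ∈ stdSimplex ℝ (S j)) :
    (fun z : ∀ j, S j => ∏ j, l j (z j)) ∈ stdSimplex ℝ (∀ j, S j) := by
  refine ⟨fun z => Finset.prod_nonneg fun j _ => (hl j).1 _, ?_⟩
  exact (sum_prod_eq l).trans (Finset.prod_eq_one fun j _ => (hl j).2)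

lemma abs_prodMean_le {l : ∀ j, S j → ℝ} (hl : ∀ j, l j ∈ stdSimplex ℝ (S j))
    {ψ : (∀ j, S j) → ℝ} {K : ℝ} (hψ : ∀ z, |ψ z| ≤ K) : |prodMean l ψ| ≤ K := by
  have h := prod_mem_stdSimplex hl
  calc |prodMean l ψ| ≤ ∑ z : (∀ j, S j), (∏ j, l j (z j)) * K := by
        refine (Finset.abs_sum_le_sum_abs _ _).trans (Finset.sum_le_sum fun z _ => ?_)
        rw [abs_mul, abs_of_nonneg (h.1 z)]
        exact mul_le_mul_of_nonneg_left (hψ z) (h.1 z)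
    _ = K := by rw [← Finset.sum_mul, h.2, one_mul]

lemma prodMean_single (s : ∀ j, S j) (ψ : (∀ j, S j) → ℝ) :
    prodMean (fun j => Pi.single (s j) 1) ψ = ψ s := by
  unfold prodMean
  rw [Finset.sum_eq_single s]
  · simp
  · intro z _ hz
    obtain ⟨j, hj⟩ := Function.ne_iff.mp hz
    rw [Finset.prod_eq_zero (Finset.mem_univ j) (Pi.single_eq_of_ne hj _), zero_mul]
  · simp

lemma prodMean_eq_zero {l : ∀ j, S j → ℝ} {i : ι} (h : l i = 0) (ψ : (∀ j, S j) → ℝ) :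
    prodMean l ψ = 0 :=
  Finset.sum_eq_zero fun z _ => by
    rw [Finset.prod_eq_zero (Finset.mem_univ i) (by rw [h]; rfl), zero_mul]

lemma prodMean_update_smul (l : ∀ j, S j → ℝ) (i : ι) (c : ℝ) (v : S i → ℝ)
    (ψ : (∀ j, S j) → ℝ) :
    prodMean (Function.update l i (c • v)) ψ = c * prodMean (Function.update l i v) ψ := by
  unfold prodMean
  rw [Finset.mul_sum]
  refine Finset.sum_congr rfl fun z _ => ?_
  have : ∀ w : S i → ℝ, ∏ j, Function.update l i w j (z j) =
      w (z i) * ∏ j ∈ Finset.univ.erase i, l j (z j) := by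
    intro w
    rw [← Finset.mul_prod_erase _ _ (Finset.mem_univ i), Function.update_self]
    congr 1
    refine Finset.prod_congr rfl fun j hj => ?_
    rw [Function.update_of_ne (Finset.ne_of_mem_erase hj)]
  rw [this, this, Pi.smul_apply, smul_eq_mul]
  ring

/-- Averaging over independent starting points averages the product laws. -/
lemma sum_prodMean_vecMul (l : ∀ j, S j → ℝ) (B : ∀ j, Matrix (S j) (S j) ℝ)
    (ψ : (∀ j, S j) → ℝ) :
    ∑ y : (∀ j, S j), (∏ j, l j (y j)) *
        prodMean (fun j => Matrix.vecMul (Pi.single (y j) 1) (B j)) ψ =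
      prodMean (fun j => Matrix.vecMul (l j) (B j)) ψ := by
  unfold prodMean
  simp_rw [Finset.mul_sum]
  rw [Finset.sum_comm]
  refine Finset.sum_congr rfl fun z _ => ?_
  simp_rw [← mul_assoc, ← Finset.sum_mul, ← Finset.prod_mul_distrib]
  rw [sum_prod_eq fun j (x : S j) => l j x * Matrix.vecMul (Pi.single x 1) (B j) (z j)]
  simp only [Matrix.single_one_vecMul]
  rfl

/-- Hybrid argument: the factors `l' j` are exchanged for `l j` one at a time. Each exchange costs
the ℓ¹-distance of that factor, since all the others have total mass one. -/
lemma sum_abs_prod_sub_le {l l' : ∀ j, S j → ℝ} (hl : ∀ j, l j ∈ stdSimplex ℝ (S j))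
    (hl' : ∀ j, l' j ∈ stdSimplex ℝ (S j)) :
    ∑ z : (∀ j, S j), |∏ j, l j (z j) - ∏ j, l' j (z j)| ≤ ∑ j, ∑ x, |l j x - l' j x| := by
  classical
  have key : ∀ T : Finset ι, ∑ z : (∀ j, S j),
      |∏ j, (if j ∈ T then l j else l' j) (z j) - ∏ j, l' j (z j)| ≤
        ∑ j ∈ T, ∑ x, |l j x - l' j x| := by
    intro T
    induction T using Finset.induction_on with
    | empty => simp
    | insert i T hi ih =>
      rw [Finset.sum_insert hi, add_comm]
      refine le_trans ?_ (add_le_add_left ih _)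
      -- The product of the `g j` is the absolute change made by exchanging factor `i`; the other
      -- hybrid factors sum to one.
      set g : ∀ j, S j → ℝ := fun j => if j = i then fun x => |l j x - l' j x| else
        if j ∈ T then l j else l' j with hg
      have e : ∑ z : (∀ j, S j), ∏ j, g j (z j) = ∑ x, |l i x - l' i x| := by
        rw [sum_prod_eq, Finset.prod_eq_single i]
        · simp [hg]
        · intro j _ hj
          simp only [hg, if_neg hj]
          split_ifs
          · exact (hl j).2
          · exact (hl' j).2
        · simp
      rw [← e, ← Finset.sum_add_distrib]
      refine Finset.sum_le_sum fun z _ => ?_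
      refine (abs_sub_le _ (∏ j, (if j ∈ T then l j else l' j) (z j)) _).trans ?_
      rw [add_comm]
      refine add_le_add_right (le_of_eq ?_) _
      rw [← Finset.mul_prod_erase _ _ (Finset.mem_univ i),
        ← Finset.mul_prod_erase Finset.univ (fun j => (if j ∈ T then l j else l' j) (z j))
          (Finset.mem_univ i),
        ← Finset.mul_prod_erase Finset.univ (fun j => g j (z j)) (Finset.mem_univ i)]
      have e1 : ∏ j ∈ Finset.univ.erase i, (if j ∈ insert i T then l j else l' j) (z j) =
          ∏ j ∈ Finset.univ.erase i, (if j ∈ T then l j else l' j) (z j) :=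
        Finset.prod_congr rfl fun j hj => by simp [Finset.ne_of_mem_erase hj]
      have e2 : ∏ j ∈ Finset.univ.erase i, g j (z j) =
          ∏ j ∈ Finset.univ.erase i, (if j ∈ T then l j else l' j) (z j) :=
        Finset.prod_congr rfl fun j hj => by simp [hg, Finset.ne_of_mem_erase hj]
      have e3 : 0 ≤ ∏ j ∈ Finset.univ.erase i, (if j ∈ T then l j else l' j) (z j) :=
        Finset.prod_nonneg fun j _ => by
          split_ifs
          · exact (hl j).1 _
          · exact (hl' j).1 _
      rw [e1, e2, ← sub_mul, abs_mul, abs_of_nonneg e3]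
      simp [hg, hi]
  simpa using key Finset.univ

/-- Two product laws give means of a `[0, 1]`-valued function that differ by at most half of the
sum of the `ℓ¹`-distances of the factors. -/
lemma abs_prodMean_sub_le {l l' : ∀ j, S j → ℝ} (hl : ∀ j, l j ∈ stdSimplex ℝ (S j))
    (hl' : ∀ j, l' j ∈ stdSimplex ℝ (S j)) {ψ : (∀ j, S j) → ℝ}
    (hψ : ∀ z, ψ z ∈ Set.Icc (0 : ℝ) 1) :
    |prodMean l ψ - prodMean l' ψ| ≤ (∑ j, ∑ x, |l j x - l' j x|) / 2 := by
  -- Both product laws have mass one, so `ψ` may be centred at 1/2. This is where the factor 1/2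
  -- comes from.
  have h : prodMean l ψ - prodMean l' ψ =
      ∑ z, (∏ j, l j (z j) - ∏ j, l' j (z j)) * (ψ z - 1 / 2) := by
    simp_rw [sub_mul, mul_sub, Finset.sum_sub_distrib, ← Finset.sum_mul]
    rw [(prod_mem_stdSimplex hl).2, (prod_mem_stdSimplex hl').2]
    unfold prodMean
    ring
  rw [h]
  calc |∑ z, (∏ j, l j (z j) - ∏ j, l' j (z j)) * (ψ z - 1 / 2)|
      ≤ ∑ z : (∀ j, S j), |∏ j, l j (z j) - ∏ j, l' j (z j)| * (1 / 2) := by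
        refine (Finset.abs_sum_le_sum_abs _ _).trans (Finset.sum_le_sum fun z _ => ?_)
        rw [abs_mul]
        refine mul_le_mul_of_nonneg_left ?_ (abs_nonneg _)
        have := hψ z
        rw [abs_le]; constructor <;> linarith [this.1, this.2]
    _ ≤ _ := by
        rw [← Finset.sum_mul]
        linarith [sum_abs_prod_sub_le hl hl']

lemma vecMul_mem_stdSimplex {X : Type*} [Fintype X] [DecidableEq X] {Q : Matrix X X ℝ}
    (hQ : Q ∈ Matrix.rowStochastic ℝ X) {v : X → ℝ} (hv : v ∈ stdSimplex ℝ X) :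
    Matrix.vecMul v Q ∈ stdSimplex ℝ X := by
  refine ⟨fun x => Finset.sum_nonneg fun y _ =>
    mul_nonneg (hv.1 y) (Matrix.nonneg_of_mem_rowStochastic hQ), ?_⟩
  simp only [Matrix.vecMul, dotProduct]
  rw [Finset.sum_comm]
  simp_rw [← Finset.mul_sum, Matrix.sum_row_of_mem_rowStochastic hQ, mul_one]
  exact hv.2

/-- The transition matrix `Q` killed at the state `x`. -/
def taboo {X : Type*} [DecidableEq X] (Q : Matrix X X ℝ) (x : X) : Matrix X X ℝ :=
  Matrix.of fun s s' => if s = x then 0 else Q s s'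

lemma single_vecMul_taboo {X : Type*} [Fintype X] [DecidableEq X] (Q : Matrix X X ℝ) (x : X) :
    Matrix.vecMul (Pi.single x 1) (taboo Q x) = 0 := by
  ext y
  simp [taboo, Matrix.row]

lemma vecMul_taboo {X : Type*} [Fintype X] [DecidableEq X] (Q : Matrix X X ℝ) {x : X}
    {v : X → ℝ} (hv : v x = 0) : Matrix.vecMul v (taboo Q x) = Matrix.vecMul v Q := by
  ext y
  simp only [taboo, Matrix.vecMul, dotProduct, Matrix.of_apply]
  refine Finset.sum_congr rfl fun z _ => ?_
  split_ifs with h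
  · rw [h, hv]; simp
  · rfl

lemma vecMul_taboo_pow_nonneg {X : Type*} [Fintype X] [DecidableEq X] {Q : Matrix X X ℝ}
    (hQ : Q ∈ Matrix.rowStochastic ℝ X) (x : X) {v : X → ℝ} (hv : ∀ y, 0 ≤ v y) (u : ℕ) (y : X) :
    0 ≤ Matrix.vecMul v (taboo Q x ^ u) y := by
  induction u generalizing v y with
  | zero => simpa using hv y
  | succ u ih =>
    rw [pow_succ', ← Matrix.vecMul_vecMul]
    refine ih (fun z => Finset.sum_nonneg fun w _ => mul_nonneg (hv w) ?_) y
    simp only [taboo, Matrix.of_apply]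
    split_ifs
    · exact le_rfl
    · exact Matrix.nonneg_of_mem_rowStochastic hQ

/-- The probability of hitting `x` before time `N` is at most one. -/
lemma sum_vecMul_taboo_pow_le {X : Type*} [Fintype X] [DecidableEq X] {Q : Matrix X X ℝ}
    (hQ : Q ∈ Matrix.rowStochastic ℝ X) (x : X) {v : X → ℝ} (hv : ∀ y, 0 ≤ v y) (N : ℕ) :
    ∑ u ∈ Finset.range N, Matrix.vecMul v (taboo Q x ^ u) x ≤ ∑ y, v y := by
  induction N generalizing v with
  | zero => simpa using Finset.sum_nonneg fun y _ => hv y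
  | succ N ih =>
    rw [Finset.sum_range_succ']
    simp_rw [pow_succ', ← Matrix.vecMul_vecMul]
    have h0 : ∀ y, 0 ≤ Matrix.vecMul v (taboo Q x) y := by
      simpa using vecMul_taboo_pow_nonneg hQ x hv 1
    -- One killed step loses exactly the mass at `x`, which pays for the term `u = 0`.
    have h1 : ∑ y, Matrix.vecMul v (taboo Q x) y = ∑ y, v y - v x := by
      simp only [Matrix.vecMul, dotProduct]
      rw [Finset.sum_comm]
      simp_rw [← Finset.mul_sum]
      rw [← Finset.add_sum_erase _ _ (Finset.mem_univ x),
        ← Finset.add_sum_erase Finset.univ v (Finset.mem_univ x), add_sub_cancel_left]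
      have : ∑ y, taboo Q x x y = 0 := by simp [taboo]
      rw [this, mul_zero, zero_add]
      refine Finset.sum_congr rfl fun y hy => ?_
      simp [taboo, Finset.ne_of_mem_erase hy, Matrix.sum_row_of_mem_rowStochastic hQ]
    have := ih h0
    rw [h1] at this
    simp only [pow_zero, Matrix.vecMul_one]
    linarith

/-! ### First hitting time of one chain, observed together with the others. -/

section Hitting

variable (P : ∀ j, Matrix (S j) (S j) ℝ) (i : ι) (x : S i) (ψ : (∀ j, S j) → ℝ)

/-- Transitions of the independent chains over `m + u` steps, where chain `i` has to hit `x` for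
the first time after its first `m` steps at the very end. -/
noncomputable def hitTransition (m u : ℕ) : ∀ j, Matrix (S j) (S j) ℝ :=
  Function.update (fun j => P j ^ (m + u)) i (P i ^ m * taboo (P i) x ^ u * Matrix.single x x 1)

/-- The mean of `ψ` at the first time after `m` steps at which chain `i` is at `x`, when the
independent chains with transition matrices `P j` start from the laws `l j`. -/
noncomputable def hitValue (l : ∀ j, S j → ℝ) (m : ℕ) : ℝ :=
  ∑' u, prodMean (fun j => Matrix.vecMul (l j) (hitTransition P i x m u j)) ψ

lemma vecMul_single_one (v : S i → ℝ) :
    Matrix.vecMul v (Matrix.single x x (1 : ℝ)) = v x • Pi.single x 1 := by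
  ext y
  by_cases h : y = x
  · subst h
    simp [Matrix.vecMul, dotProduct, Matrix.single_apply]
  · simp [Matrix.vecMul, dotProduct, h, Ne.symm h]

/-- Only factor `i` carries the hitting event, so the probability of the event comes out as a
scalar. What is left is a product law: chain `i` sits at `x`, and the other chains keep their
unconditioned laws after `m + u` steps. -/
lemma prodMean_hitTransition (l : ∀ j, S j → ℝ) (m u : ℕ) :
    prodMean (fun j => Matrix.vecMul (l j) (hitTransition P i x m u j)) ψ =
      Matrix.vecMul (Matrix.vecMul (l i) (P i ^ m)) (taboo (P i) x ^ u) x *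
        prodMean (Function.update (fun j => Matrix.vecMul (l j) (P j ^ (m + u))) i
          (Pi.single x 1)) ψ := by
  rw [← prodMean_update_smul]
  congr 1
  ext1 j
  by_cases hj : j = i
  · subst hj
    rw [hitTransition, Function.update_self, Function.update_self, ← vecMul_single_one,
      Matrix.vecMul_vecMul, Matrix.vecMul_vecMul, mul_assoc]
  · rw [hitTransition, Function.update_of_ne hj, Function.update_of_ne hj]

/-- Markov property during the waiting period: a step made by all chains is one more step to wait.
-/
lemma hitValue_vecMul (l : ∀ j, S j → ℝ) (m : ℕ) :
    hitValue P i x ψ (fun j => Matrix.vecMul (l j) (P j)) m = hitValue P i x ψ l (m + 1) := by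
  unfold hitValue
  refine tsum_congr fun u => ?_
  congr 1
  ext1 j
  by_cases hj : j = i
  · subst hj
    simp [hitTransition, pow_succ', mul_assoc]
  · simp [hitTransition, hj, add_right_comm m 1 u, pow_succ']

variable {P i x ψ}

/-- The first-hitting probabilities are nonnegative with sum at most one, so a bound on the means at
all the fixed times `m + u` passes to the random time. Almost sure hitting is not needed, because
the function `ψ` to which this is applied is already centred. -/
lemma hitValue_bound (hP : ∀ j, P j ∈ Matrix.rowStochastic ℝ (S j)) {l : ∀ j, S j → ℝ}
    (hl : ∀ j, l j ∈ stdSimplex ℝ (S j)) (m : ℕ) {K : ℝ}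
    (hK : ∀ u, |prodMean (Function.update (fun j => Matrix.vecMul (l j) (P j ^ (m + u))) i
          (Pi.single x 1)) ψ| ≤ K) :
    (Summable fun u => prodMean (fun j => Matrix.vecMul (l j) (hitTransition P i x m u j)) ψ) ∧
      |hitValue P i x ψ l m| ≤ K := by
  have hK0 : 0 ≤ K := (abs_nonneg _).trans (hK 0)
  set c : ℕ → ℝ := fun u => Matrix.vecMul (Matrix.vecMul (l i) (P i ^ m)) (taboo (P i) x ^ u) x
  have hv := vecMul_mem_stdSimplex (pow_mem (hP i) m) (hl i)
  have hc0 : ∀ u, 0 ≤ c u := fun u => vecMul_taboo_pow_nonneg (hP i) x hv.1 u x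
  have hcs : ∀ N, ∑ u ∈ Finset.range N, c u ≤ 1 := fun N =>
    (sum_vecMul_taboo_pow_le (hP i) x hv.1 N).trans_eq hv.2
  have hcsum : Summable c := summable_of_sum_range_le hc0 hcs
  have hterm : ∀ u, ‖prodMean (fun j => Matrix.vecMul (l j) (hitTransition P i x m u j)) ψ‖ ≤
      c u * K := fun u => by
    rw [prodMean_hitTransition, Real.norm_eq_abs, abs_mul, abs_of_nonneg (hc0 u)]
    exact mul_le_mul_of_nonneg_left (hK u) (hc0 u)
  refine ⟨Summable.of_norm_bounded (hcsum.mul_right K) hterm, ?_⟩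
  calc |hitValue P i x ψ l m| ≤ (∑' u, c u) * K :=
        tsum_of_norm_bounded (hcsum.hasSum.mul_right K) hterm
    _ ≤ 1 * K := mul_le_mul_of_nonneg_right (hcsum.tsum_le_of_sum_range_le hcs) hK0
    _ = K := one_mul K

lemma single_mem_stdSimplex' {X : Type*} [Fintype X] [DecidableEq X] (y : X) :
    (Pi.single y 1 : X → ℝ) ∈ stdSimplex ℝ X := single_mem_stdSimplex ℝ y

lemma update_single_mem_stdSimplex {l : ∀ j, S j → ℝ} (hl : ∀ j, l j ∈ stdSimplex ℝ (S j))
    (i : ι) (x : S i) (j : ι) :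
    Function.update l i (Pi.single x 1) j ∈ stdSimplex ℝ (S j) := by
  by_cases hj : j = i
  · subst hj
    rw [Function.update_self]
    exact single_mem_stdSimplex' x
  · rw [Function.update_of_ne hj]
    exact hl j

lemma hitValue_bound_of_abs_le (hP : ∀ j, P j ∈ Matrix.rowStochastic ℝ (S j)) {l : ∀ j, S j → ℝ}
    (hl : ∀ j, l j ∈ stdSimplex ℝ (S j)) (m : ℕ) {K : ℝ} (hK : ∀ z, |ψ z| ≤ K) :
    (Summable fun u => prodMean (fun j => Matrix.vecMul (l j) (hitTransition P i x m u j)) ψ) ∧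
      |hitValue P i x ψ l m| ≤ K :=
  hitValue_bound hP hl m fun _ => abs_prodMean_le (update_single_mem_stdSimplex
    (fun j => vecMul_mem_stdSimplex (pow_mem (hP j) _) (hl j)) i x) hK

lemma sum_hitValue (hP : ∀ j, P j ∈ Matrix.rowStochastic ℝ (S j)) (l : ∀ j, S j → ℝ) (m : ℕ) :
    ∑ y : (∀ j, S j), (∏ j, l j (y j)) * hitValue P i x ψ (fun j => Pi.single (y j) 1) m =
      hitValue P i x ψ l m := by
  unfold hitValue
  simp_rw [← tsum_mul_left, ← sum_prodMean_vecMul l]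
  refine (Summable.tsum_finsetSum fun y _ => ?_).symm
  refine Summable.mul_left _ ?_
  refine (hitValue_bound_of_abs_le (K := ∑ z, |ψ z|) hP (fun j => single_mem_stdSimplex' _) m
    fun z => ?_).1
  exact Finset.single_le_sum (f := fun z => |ψ z|) (fun _ _ => abs_nonneg _) (Finset.mem_univ z)

/-- With no mass at `x` the term `u = 0` vanishes, and the killed chain makes an ordinary first
step, so the remaining series is the one for `m = 1` shifted by one. -/
lemma hitValue_of_ne (hP : ∀ j, P j ∈ Matrix.rowStochastic ℝ (S j)) {l : ∀ j, S j → ℝ}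
    (hl : ∀ j, l j ∈ stdSimplex ℝ (S j)) (hx : l i x = 0) :
    hitValue P i x ψ l 0 = hitValue P i x ψ l 1 := by
  rw [← zero_add 1, ← hitValue_vecMul]
  have hs := (hitValue_bound_of_abs_le (i := i) (x := x) (ψ := ψ) (K := ∑ z, |ψ z|) hP hl 0
    fun z => Finset.single_le_sum (f := fun z => |ψ z|) (fun _ _ => abs_nonneg _)
      (Finset.mem_univ z)).1
  unfold hitValue
  rw [hs.tsum_eq_zero_add, prodMean_eq_zero (i := i), zero_add]
  · refine tsum_congr fun u => ?_
    congr 1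
    ext1 j
    by_cases hj : j = i
    · subst hj
      simp only [hitTransition, Function.update_self, pow_zero, one_mul, pow_succ', mul_assoc]
      rw [← Matrix.vecMul_vecMul, vecMul_taboo _ hx]
    · simp [hitTransition, hj, pow_succ']
  · simp [hitTransition, vecMul_single_one, hx]

/-- The chain is at `x` at once and is killed there, so only the term `u = 0` survives. -/
lemma hitValue_of_eq {s : ∀ j, S j} (hx : s i = x) :
    hitValue P i x ψ (fun j => Pi.single (s j) 1) 0 = ψ s := by
  unfold hitValue
  rw [tsum_eq_single 0]
  · rw [← prodMean_single s ψ]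
    congr 1
    ext1 j
    by_cases hj : j = i
    · subst hj
      simp only [hitTransition, Function.update_self, pow_zero, one_mul, hx, vecMul_single_one,
        Pi.single_eq_same, one_smul]
    · simp [hitTransition, hj]
  · intro u hu
    obtain ⟨u, rfl⟩ := Nat.exists_eq_succ_of_ne_zero hu
    refine prodMean_eq_zero (i := i) ?_ ψ
    simp only [hitTransition, Function.update_self, pow_zero, one_mul, pow_succ', mul_assoc]
    rw [← Matrix.vecMul_vecMul, hx, single_vecMul_taboo, Matrix.zero_vecMul]

end Hitting

end ProductChains

end ChainGame

namespace ChainGame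

/-! ### Occupation measures, stationary marginals and mixing. -/

section Stationary

lemma prodMean_mem_Icc {ι : Type*} [Fintype ι] [DecidableEq ι] {S : ι → Type*}
    [∀ i, Fintype (S i)] [∀ i, DecidableEq (S i)] {l : ∀ j, S j → ℝ}
    (hl : ∀ j, l j ∈ stdSimplex ℝ (S j)) {ψ : (∀ j, S j) → ℝ}
    (hψ : ∀ z, ψ z ∈ Set.Icc (0 : ℝ) 1) : prodMean l ψ ∈ Set.Icc (0 : ℝ) 1 := by
  refine ⟨Finset.sum_nonneg fun z _ => mul_nonneg ((prod_mem_stdSimplex hl).1 z) (hψ z).1, ?_⟩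
  exact (le_abs_self _).trans (abs_prodMean_le hl fun z => abs_le.mpr
    ⟨by linarith [(hψ z).1], (hψ z).2⟩)

variable {n : ℕ} {S A : Fin n → Type*} [∀ i, Fintype (S i)] [∀ i, Fintype (A i)]
  [∀ i, DecidableEq (S i)] [∀ i, DecidableEq (A i)] {G : Game n S A}

lemma inducedChain_mem_rowStochastic {i : Fin n} {p : S i → A i → ℝ}
    (hp : IsStationaryPolicy p) : inducedChain G i p ∈ Matrix.rowStochastic ℝ (S i) := by
  rw [Matrix.mem_rowStochastic_iff_sum]
  refine ⟨fun s s' => Finset.sum_nonneg fun a _ =>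
    mul_nonneg ((G.P_mem i s a).1 s') ((hp s).1 a), fun s => ?_⟩
  simp only [inducedChain, Matrix.of_apply]
  rw [Finset.sum_comm]
  simp_rw [← Finset.sum_mul, (G.P_mem i s _).2, one_mul]
  exact (hp s).2

/-- The marginal of an occupation measure on the states. -/
noncomputable def stateMarginal {i : Fin n} (ρ : Occ S A i) (s : S i) : ℝ := ∑ a, ρ (s, a)

variable {i : Fin n} {δ : ℝ} {ρ : Occ S A i}

lemma stateMarginal_mem_stdSimplex (hρ : ρ ∈ occPolytope G i) :
    stateMarginal ρ ∈ stdSimplex ℝ (S i) :=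
  ⟨fun s => Finset.sum_nonneg fun a _ => hρ.1 (s, a), hρ.2.2⟩

lemma nonempty_of_mem_occPolytope (hρ : ρ ∈ occPolytope G i) : Nonempty (S i × A i) := by
  by_contra h
  rw [not_nonempty_iff] at h
  have h1 := hρ.2.2
  rw [← Fintype.sum_prod_type' (f := fun s a => ρ (s, a))] at h1
  simp at h1

lemma le_stateMarginal (hρ : ρ ∈ shrunkPolytope G i δ) (s : S i) :
    δ ≤ stateMarginal ρ s := by
  obtain ⟨-, a⟩ := nonempty_of_mem_occPolytope hρ.1
  exact (hρ.2 (s, a)).trans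
    (Finset.single_le_sum (f := fun a => ρ (s, a)) (fun a _ => hρ.1.1 _) (Finset.mem_univ a))

lemma policyOf_stationary (hδ : 0 < δ) (hρ : ρ ∈ shrunkPolytope G i δ) :
    IsStationaryPolicy (policyOf ρ) := by
  intro s
  have h := hδ.trans_le (le_stateMarginal hρ s)
  refine ⟨fun a => div_nonneg (hρ.1.1 _) h.le, ?_⟩
  simp only [policyOf]
  rw [← Finset.sum_div]
  exact div_self h.ne'

lemma stateMarginal_mul_policyOf (hδ : 0 < δ) (hρ : ρ ∈ shrunkPolytope G i δ) (s : S i) (a : A i) :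
    stateMarginal ρ s * policyOf ρ s a = ρ (s, a) := by
  have h := hδ.trans_le (le_stateMarginal hρ s)
  exact mul_div_cancel₀ _ h.ne'

/-- The state marginal is at most one, so dividing by it cannot decrease a coordinate. This bounds
the importance weights by `1 / δ`. -/
lemma le_policyOf (hδ : 0 < δ) (hρ : ρ ∈ shrunkPolytope G i δ) (s : S i) (a : A i) :
    δ ≤ policyOf ρ s a := by
  have h := hδ.trans_le (le_stateMarginal hρ s)
  have h1 : stateMarginal ρ s ≤ 1 := by
    rw [← (stateMarginal_mem_stdSimplex hρ.1).2]
    exact Finset.single_le_sum (f := stateMarginal ρ)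
      (fun s _ => (stateMarginal_mem_stdSimplex hρ.1).1 s) (Finset.mem_univ s)
  have h2 := (policyOf_stationary hδ hρ s).1 a
  have h3 := stateMarginal_mul_policyOf hδ hρ s a
  have h4 := hρ.2 (s, a)
  nlinarith

lemma sum_occ_mul_transition (hρ : ρ ∈ occPolytope G i) (s' : S i) :
    ∑ s, ∑ a, ρ (s, a) * G.P i s a s' = stateMarginal ρ s' := by
  have h := hρ.2.1 s'
  simp_rw [sub_mul, Finset.sum_sub_distrib, ite_mul, one_mul, zero_mul] at h
  have h2 : ∑ s, ∑ a, (if s = s' then ρ (s, a) else 0) = stateMarginal ρ s' := by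
    rw [Finset.sum_eq_single s']
    · simp [stateMarginal]
    · intro s _ hs
      simp [hs]
    · simp
  rw [h2] at h
  simp_rw [mul_comm (ρ _)]
  linarith

/-- The balance equations of the polytope are stationarity of the marginal, once `ρ` is factored as
marginal times policy. -/
lemma stateMarginal_vecMul (hδ : 0 < δ) (hρ : ρ ∈ shrunkPolytope G i δ) :
    Matrix.vecMul (stateMarginal ρ) (inducedChain G i (policyOf ρ)) = stateMarginal ρ := by
  ext s'
  rw [← sum_occ_mul_transition hρ.1 s']
  simp only [Matrix.vecMul, dotProduct, inducedChain, Matrix.of_apply]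
  refine Finset.sum_congr rfl fun s _ => ?_
  rw [Finset.mul_sum]
  refine Finset.sum_congr rfl fun a _ => ?_
  rw [← stateMarginal_mul_policyOf hδ hρ s a]
  ring

lemma stateMarginal_vecMul_pow (hδ : 0 < δ) (hρ : ρ ∈ shrunkPolytope G i δ) (m : ℕ) :
    Matrix.vecMul (stateMarginal ρ) (inducedChain G i (policyOf ρ) ^ m) = stateMarginal ρ := by
  induction m with
  | zero => simp
  | succ m ih => rw [pow_succ, ← Matrix.vecMul_vecMul, ih, stateMarginal_vecMul hδ hρ]

variable {τ : ℝ}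

lemma sum_abs_vecMul_pow_sub_le (hG : UniformlyErgodic G τ) {p : S i → A i → ℝ}
    (hp : IsStationaryPolicy p) {v v' : S i → ℝ} (hv : v ∈ stdSimplex ℝ (S i))
    (hv' : v' ∈ stdSimplex ℝ (S i)) (m : ℕ) :
    ∑ s, |Matrix.vecMul v (inducedChain G i p ^ m) s -
        Matrix.vecMul v' (inducedChain G i p ^ m) s| ≤
      Real.exp (-(m / τ)) * ∑ s, |v s - v' s| := by
  have hst := inducedChain_mem_rowStochastic (G := G) hp
  induction m with
  | zero => simp
  | succ m ih =>
    have h := (hG i p hp).2 _ (vecMul_mem_stdSimplex (pow_mem hst m) hv) _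
      (vecMul_mem_stdSimplex (pow_mem hst m) hv')
    rw [Matrix.sub_vecMul, Matrix.vecMul_vecMul, Matrix.vecMul_vecMul, ← pow_succ] at h
    refine h.trans ((mul_le_mul_of_nonneg_left ih (Real.exp_pos _).le).trans_eq ?_)
    rw [← mul_assoc, ← Real.exp_add]
    congr 2
    push_cast
    ring

lemma sum_abs_sub_le_two {X : Type*} [Fintype X] {v v' : X → ℝ} (hv : v ∈ stdSimplex ℝ X)
    (hv' : v' ∈ stdSimplex ℝ X) : ∑ s, |v s - v' s| ≤ 2 := by
  calc ∑ s, |v s - v' s| ≤ ∑ s, (v s + v' s) := Finset.sum_le_sum fun s _ => by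
        rw [abs_le]; constructor <;> linarith [hv.1 s, hv'.1 s]
    _ = 2 := by rw [Finset.sum_add_distrib, hv.2, hv'.2]; norm_num

/-- A policy may play `a` at `s` and `a'` at `s'`, so both transition rows belong to one induced
chain, and the contraction applies to the point masses at `s` and `s'`. -/
lemma sum_abs_transition_sub_le_of_ne (hG : UniformlyErgodic G τ) {s s' : S i} (hs : s ≠ s')
    (a a' : A i) : ∑ y, |G.P i s a y - G.P i s' a' y| ≤ 2 * Real.exp (-(1 / τ)) := by
  set p : S i → A i → ℝ := fun z => if z = s then Pi.single a 1 else Pi.single a' 1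
  have hp : IsStationaryPolicy p := by
    intro z
    simp only [p]
    split_ifs <;> exact single_mem_stdSimplex' _
  have h := (hG i p hp).2 _ (single_mem_stdSimplex' s) _ (single_mem_stdSimplex' s')
  have e1 : ∀ y, inducedChain G i p s y = G.P i s a y := fun y => by
    simp [inducedChain, p, Pi.single_apply]
  have e2 : ∀ y, inducedChain G i p s' y = G.P i s' a' y := fun y => by
    simp [inducedChain, p, Pi.single_apply, hs.symm]
  rw [Matrix.sub_vecMul, Matrix.single_one_vecMul, Matrix.single_one_vecMul] at h
  simp only [Pi.sub_apply, Matrix.row, e1, e2] at h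
  refine h.trans ?_
  rw [mul_comm]
  exact mul_le_mul_of_nonneg_right
    (sum_abs_sub_le_two (single_mem_stdSimplex' s) (single_mem_stdSimplex' s'))
    (Real.exp_pos _).le

/-- Two different actions at the same state cannot be compared through one deterministic policy. A
detour over a third row, at another state, costs 4 e^{-1/τ}, and the factor `Fintype.card (S i)`
covers this if there are at least two states. With one state all rows coincide. -/
lemma sum_abs_transition_sub_le (hG : UniformlyErgodic G τ) (s s' : S i) (a a' : A i) :
    ∑ y, |G.P i s a y - G.P i s' a' y| ≤
      2 * Fintype.card (S i) * Real.exp (-(1 / τ)) := by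
  have he := Real.exp_pos (-(1 / τ))
  rcases subsingleton_or_nontrivial (S i) with hS | hS
  · have h0 : ∀ y, G.P i s a y - G.P i s' a' y = 0 := fun y => by
      have h1 := (G.P_mem i s a).2
      have h2 := (G.P_mem i s' a').2
      rw [Finset.sum_eq_single y (fun z _ hz => absurd (Subsingleton.elim z y) hz) (by simp)]
        at h1 h2
      rw [h1, h2, sub_self]
    simp only [h0, abs_zero, Finset.sum_const_zero]
    positivity
  · have hc : (2 : ℝ) ≤ Fintype.card (S i) := by
      exact_mod_cast Fintype.one_lt_card (α := S i)
    rcases eq_or_ne s s' with rfl | hs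
    · obtain ⟨z, hz⟩ := exists_ne s
      have h1 := sum_abs_transition_sub_le_of_ne hG hz.symm a a
      have h2 := sum_abs_transition_sub_le_of_ne hG hz a a'
      calc ∑ y, |G.P i s a y - G.P i s a' y|
          ≤ ∑ y, (|G.P i s a y - G.P i z a y| + |G.P i z a y - G.P i s a' y|) :=
            Finset.sum_le_sum fun y _ => abs_sub_le _ _ _
        _ ≤ _ := by rw [Finset.sum_add_distrib]; nlinarith
    · have h1 := sum_abs_transition_sub_le_of_ne hG hs a a'
      nlinarith

/-- By the balance equations the stationary marginal is the `ρ`-average of transition rows. So any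
row is as close to it as rows are to each other, and the first step of a batch contributes a factor
e^{-1/τ} whatever action is played. -/
lemma sum_abs_transition_sub_stateMarginal_le (hG : UniformlyErgodic G τ)
    (hρ : ρ ∈ occPolytope G i) (s : S i) (a : A i) :
    ∑ y, |G.P i s a y - stateMarginal ρ y| ≤
      2 * Fintype.card (S i) * Real.exp (-(1 / τ)) := by
  have hone : ∑ q : S i × A i, ρ q = 1 := by
    rw [Fintype.sum_prod_type]; exact hρ.2.2
  calc ∑ y, |G.P i s a y - stateMarginal ρ y|
      ≤ ∑ y, ∑ q : S i × A i, ρ q * |G.P i s a y - G.P i q.1 q.2 y| := by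
        refine Finset.sum_le_sum fun y _ => ?_
        have : G.P i s a y - stateMarginal ρ y =
            ∑ q : S i × A i, ρ q * (G.P i s a y - G.P i q.1 q.2 y) := by
          simp_rw [mul_sub, Finset.sum_sub_distrib, ← Finset.sum_mul]
          rw [hone, one_mul, Fintype.sum_prod_type, sum_occ_mul_transition hρ]
        rw [this]
        refine (Finset.abs_sum_le_sum_abs _ _).trans_eq (Finset.sum_congr rfl fun q _ => ?_)
        rw [abs_mul, abs_of_nonneg (hρ.1 q)]
    _ = ∑ q : S i × A i, ρ q * ∑ y, |G.P i s a y - G.P i q.1 q.2 y| := by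
        rw [Finset.sum_comm]
        simp_rw [Finset.mul_sum]
    _ ≤ ∑ q : S i × A i, ρ q * (2 * Fintype.card (S i) * Real.exp (-(1 / τ))) :=
        Finset.sum_le_sum fun q _ =>
          mul_le_mul_of_nonneg_left (sum_abs_transition_sub_le hG _ _ _ _) (hρ.1 q)
    _ = _ := by rw [← Finset.sum_mul, hone, one_mul]

end Stationary

/-! ### The payoff gradient and the bias of its estimate. -/

section Gradient

variable {n : ℕ} {S A : Fin n → Type*} [∀ i, Fintype (S i)] [∀ i, Fintype (A i)]
  [∀ i, DecidableEq (S i)] [∀ i, DecidableEq (A i)] {G : Game n S A}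

/-- The partial derivative of the payoff of player `i` with respect to its occupation measure of
the state-action pair `q`. -/
noncomputable def payoffGrad (G : Game n S A) (i : Fin n) (ρ : Profile S A) (q : S i × A i) : ℝ :=
  payoff G i (Function.update ρ i (EuclideanSpace.single q 1))

/-- The expected reward of player `i` in the joint state `z` when it plays `b` and the others
follow the policies of `ρ`. -/
noncomputable def pureReward (G : Game n S A) (i : Fin n) (b : A i) (ρ : Profile S A)
    (z : ∀ j, S j) : ℝ :=
  prodMean (Function.update (fun j => policyOf (ρ j) (z j)) i (Pi.single b 1)) (G.r i z)

/-- The chains induced by the policies of a profile of occupation measures. -/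
noncomputable def chains (G : Game n S A) (ρ : Profile S A) (j : Fin n) : Matrix (S j) (S j) ℝ :=
  inducedChain G j (policyOf (ρ j))

/-- The payoff is multilinear, hence linear in the occupation measure of player `i` with the partial
gradient as coefficients. -/
lemma payoff_update (i : Fin n) (ρ : Profile S A) (θ : Occ S A i) :
    payoff G i (Function.update ρ i θ) = ∑ q, θ q * payoffGrad G i ρ q := by
  have h : ∀ (θ' : Occ S A i) (s : ∀ j, S j) (a : ∀ j, A j),
      ∏ j, Function.update ρ i θ' j (s j, a j) =
        θ' (s i, a i) * ∏ j ∈ Finset.univ.erase i, ρ j (s j, a j) := by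
    intro θ' s a
    rw [← Finset.mul_prod_erase _ _ (Finset.mem_univ i), Function.update_self]
    congr 1
    exact Finset.prod_congr rfl fun j hj => by
      rw [Function.update_of_ne (Finset.ne_of_mem_erase hj)]
  unfold payoffGrad payoff
  simp_rw [h, Finset.mul_sum]
  rw [Finset.sum_comm]
  simp_rw [Finset.sum_comm (s := (Finset.univ : Finset (S i × A i)))]
  rw [Finset.sum_comm]
  refine Finset.sum_congr rfl fun s _ => Finset.sum_congr rfl fun a _ => ?_
  rw [Finset.sum_eq_single (s i, a i)]
  · simp; ring
  · intro q _ hq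
    simp [Ne.symm hq]
  · simp

lemma nikaidoIsoda_eq (θ ρ : Profile S A) :
    nikaidoIsoda G θ ρ = ∑ i, ∑ q, (θ i q - ρ i q) * payoffGrad G i ρ q := by
  refine Finset.sum_congr rfl fun i _ => ?_
  have h := payoff_update (G := G) i ρ (ρ i)
  rw [Function.update_eq_self] at h
  rw [h, payoff_update, ← Finset.sum_sub_distrib]
  exact Finset.sum_congr rfl fun q _ => by ring

variable {δ : Fin n → ℝ} {ρ : Profile S A} (hδ : ∀ i, 0 < δ i) (hρ : ρ ∈ shrunkProduct G δ)

include hδ hρ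

lemma chains_mem_rowStochastic (j : Fin n) : chains G ρ j ∈ Matrix.rowStochastic ℝ (S j) :=
  inducedChain_mem_rowStochastic (policyOf_stationary (hδ j) (hρ j))

lemma pureReward_mem_Icc (i : Fin n) (b : A i) (z : ∀ j, S j) :
    pureReward G i b ρ z ∈ Set.Icc (0 : ℝ) 1 :=
  prodMean_mem_Icc (update_single_mem_stdSimplex
    (fun j => policyOf_stationary (hδ j) (hρ j) (z j)) i b) fun a => G.r_mem i z a

/-- Each `ρ j` factors as marginal times policy; summing over the actions first leaves the mean of a
state-dependent reward with player `i` pinned at `x`. This is the form to compare with the law at a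
hitting time. -/
lemma payoffGrad_eq (i : Fin n) (x : S i) (b : A i) :
    payoffGrad G i ρ (x, b) =
      prodMean (Function.update (fun j => stateMarginal (ρ j)) i (Pi.single x 1))
        (pureReward G i b ρ) := by
  unfold payoffGrad payoff pureReward prodMean
  refine Finset.sum_congr rfl fun s _ => ?_
  rw [Finset.mul_sum]
  refine Finset.sum_congr rfl fun a _ => ?_
  rw [← mul_assoc, ← Finset.prod_mul_distrib]
  congr 1
  refine Finset.prod_congr rfl fun j _ => ?_
  by_cases hj : j = i
  · subst hj
    simp only [Function.update_self, Pi.single_apply, PiLp.single_apply, Prod.mk.injEq]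
    by_cases h1 : s j = x <;> by_cases h2 : a j = b <;> simp [h1, h2]
  · simp only [Function.update_of_ne hj]
    exact (stateMarginal_mul_policyOf (hδ j) (hρ j) _ _).symm

lemma payoffGrad_mem_Icc (i : Fin n) (q : S i × A i) :
    payoffGrad G i ρ q ∈ Set.Icc (0 : ℝ) 1 := by
  rw [show q = (q.1, q.2) from rfl, payoffGrad_eq hδ hρ]
  exact prodMean_mem_Icc (update_single_mem_stdSimplex
    (fun j => stateMarginal_mem_stdSimplex (hρ j).1) i q.1) fun z => pureReward_mem_Icc hδ hρ i _ z

/-- The mean deviation of the reward estimate from the payoff gradient, at the first visit of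
player `i` to `x` after `m` steps. -/
lemma abs_hitValue_le_one (i : Fin n) (x : S i) (b : A i) {l : ∀ j, S j → ℝ}
    (hl : ∀ j, l j ∈ stdSimplex ℝ (S j)) (m : ℕ) :
    |hitValue (chains G ρ) i x (fun z => pureReward G i b ρ z - payoffGrad G i ρ (x, b)) l m| ≤ 1 :=
  (hitValue_bound_of_abs_le (chains_mem_rowStochastic hδ hρ) hl m fun z => by
    have h1 := pureReward_mem_Icc hδ hρ i b z
    have h2 := payoffGrad_mem_Icc hδ hρ i (x, b)
    rw [abs_le]
    constructor <;> linarith [h1.1, h1.2, h2.1, h2.2]).2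

/-- At the hitting time each other player has made one step given by a transition row and at least
`d - 1` steps of its induced chain. The row is within 2|S_j| e^{-1/τ} of the stationary marginal,
and the later steps contract this by e^{-(d-1)/τ}. Half of the sum of these distances bounds the
deviation from the gradient. -/
lemma abs_hitValue_le {τ : ℝ} (hτ : 0 < τ) (hG : UniformlyErgodic G τ) (i : Fin n) (x : S i)
    (b : A i) (s : ∀ j, S j) (a : ∀ j, A j) {d : ℕ} (hd : 1 ≤ d) :
    |hitValue (chains G ρ) i x (fun z => pureReward G i b ρ z - payoffGrad G i ρ (x, b))
        (fun j => G.P j (s j) (a j)) (d - 1)| ≤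
      (∑ j, (Fintype.card (S j) : ℝ)) * Real.exp (-(d / τ)) := by
  obtain ⟨d, rfl⟩ := Nat.exists_eq_add_of_le' hd
  rw [Nat.add_sub_cancel]
  refine (hitValue_bound (chains_mem_rowStochastic hδ hρ) (fun j => G.P_mem j _ _) d
    fun u => ?_).2
  have hm : ∀ j, Matrix.vecMul (G.P j (s j) (a j)) (chains G ρ j ^ (d + u)) ∈
      stdSimplex ℝ (S j) := fun j =>
    vecMul_mem_stdSimplex (pow_mem (chains_mem_rowStochastic hδ hρ j) _) (G.P_mem j _ _)
  have hν : ∀ j, stateMarginal (ρ j) ∈ stdSimplex ℝ (S j) := fun j =>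
    stateMarginal_mem_stdSimplex (hρ j).1
  have e : ∀ l : ∀ j, S j → ℝ, (∀ j, l j ∈ stdSimplex ℝ (S j)) →
      prodMean l (fun z => pureReward G i b ρ z - payoffGrad G i ρ (x, b)) =
        prodMean l (pureReward G i b ρ) - payoffGrad G i ρ (x, b) := by
    intro l hl
    unfold prodMean
    simp_rw [mul_sub, Finset.sum_sub_distrib, ← Finset.sum_mul]
    rw [(prod_mem_stdSimplex hl).2, one_mul]
  rw [e _ (update_single_mem_stdSimplex hm i x), payoffGrad_eq hδ hρ]
  refine (abs_prodMean_sub_le (update_single_mem_stdSimplex hm i x)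
    (update_single_mem_stdSimplex hν i x) (pureReward_mem_Icc hδ hρ i b)).trans ?_
  rw [div_le_iff₀ two_pos, Finset.sum_mul, Finset.sum_mul]
  refine Finset.sum_le_sum fun j _ => ?_
  -- Both laws pin player `i` at `x`, so only the other players contribute.
  by_cases hj : j = i
  · subst hj
    simp only [Function.update_self, sub_self, abs_zero, Finset.sum_const_zero]
    positivity
  · simp only [Function.update_of_ne hj]
    have h1 := sum_abs_vecMul_pow_sub_le hG (policyOf_stationary (hδ j) (hρ j))
      (G.P_mem j (s j) (a j)) (hν j) (d + u)
    rw [stateMarginal_vecMul_pow (hδ j) (hρ j)] at h1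
    refine h1.trans ?_
    have h2 := sum_abs_transition_sub_stateMarginal_le hG (hρ j).1 (s j) (a j)
    refine (mul_le_mul_of_nonneg_left h2 (Real.exp_pos _).le).trans ?_
    have h3 : Real.exp (-(((d + u : ℕ) : ℝ) / τ)) * Real.exp (-(1 / τ)) ≤
        Real.exp (-(((d + 1 : ℕ) : ℝ) / τ)) := by
      rw [← Real.exp_add]
      apply Real.exp_le_exp.mpr
      rw [← neg_add, neg_le_neg_iff, ← add_div]
      push_cast
      gcongr
      linarith [(Nat.cast_nonneg u : (0 : ℝ) ≤ u)]
    calc _ = 2 * (Fintype.card (S j) : ℝ) *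
          (Real.exp (-(((d + u : ℕ) : ℝ) / τ)) * Real.exp (-(1 / τ))) := by ring
      _ ≤ 2 * (Fintype.card (S j) : ℝ) * Real.exp (-(((d + 1 : ℕ) : ℝ) / τ)) :=
          mul_le_mul_of_nonneg_left h3 (by positivity)
      _ = _ := by ring

end Gradient

end ChainGame

namespace ChainGame

/-! ### The algorithm along a path, and averages over one step of play. -/

section AlgorithmPaths

variable {n : ℕ} {S A : Fin n → Type*} [∀ i, Fintype (S i)] [∀ i, Fintype (A i)]
  [∀ i, DecidableEq (S i)] [∀ i, DecidableEq (A i)] {G : Game n S A} {I : Input S A}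

lemma allVisited_congr {σ σ' : ℕ → ∀ i, S i} {b t : ℕ} (h : ∀ u ≤ t, σ u = σ' u) :
    AllVisited σ b t ↔ AllVisited σ' b t := by
  refine forall₂_congr fun i x => exists_congr fun u => and_congr_right fun hu => ?_
  rw [h u (Finset.mem_Icc.mp hu).2]

lemma firstVisit_congr {σ σ' : ℕ → ∀ i, S i} {i : Fin n} {b t : ℕ} (h : ∀ u ≤ t, σ u = σ' u) :
    FirstVisit σ i b t ↔ FirstVisit σ' i b t := by
  refine forall₂_congr fun u hu => ?_
  rw [h u (Finset.mem_Ico.mp hu).2.le, h t le_rfl]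

lemma estimator_congr {σ σ' : ℕ → ∀ i, S i} {α α' : ℕ → ∀ i, A i} {i : Fin n} {ρ : Occ S A i}
    {b t : ℕ} (h : ∀ u ≤ t, σ u = σ' u) (h' : ∀ u ≤ t, α u = α' u) :
    estimator G σ α i ρ b t = estimator G σ' α' i ρ b t := by
  classical
  refine Finset.sum_congr rfl fun u hu => ?_
  have hut := (Finset.mem_Icc.mp hu).2
  rw [h u hut, h' u hut]
  exact if_congr (firstVisit_congr fun v hv => h v (le_trans hv hut)) rfl rfl

/-- The state of the algorithm at time `t` depends only on the path before time `t`. -/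
lemma algState_congr {σ σ' : ℕ → ∀ i, S i} {α α' : ℕ → ∀ i, A i} {t : ℕ}
    (h : ∀ u < t, σ u = σ' u) (h' : ∀ u < t, α u = α' u) :
    algState G I σ α t = algState G I σ' α' t := by
  classical
  induction t with
  | zero => rfl
  | succ t ih =>
    simp only [algState]
    rw [ih (fun u hu => h u (by omega)) fun u hu => h' u (by omega)]
    simp only [estimator_congr (G := G) (σ := σ) (σ' := σ') (α := α) (α' := α')
        (fun u hu => h u (Nat.lt_succ_of_le hu)) fun u hu => h' u (Nat.lt_succ_of_le hu)]
    exact if_congr (allVisited_congr fun u hu => h u (Nat.lt_succ_of_le hu)) rfl rfl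

lemma algState_dependsOnHistory (t : ℕ) :
    DependsOnHistory t fun σ α => algState G I σ α t :=
  fun _ _ _ _ h1 h2 => algState_congr (fun u hu => h1 u hu.le) h2

lemma algState_succ_of_not {σ : ℕ → ∀ i, S i} {α : ℕ → ∀ i, A i} {t : ℕ}
    (h : ¬ AllVisited σ ((algState G I σ α t).start + I.d) t) :
    algState G I σ α (t + 1) = algState G I σ α t := by
  simp only [algState]
  rw [if_neg h]

lemma algState_succ_of {σ : ℕ → ∀ i, S i} {α : ℕ → ∀ i, A i} {t : ℕ}
    (h : AllVisited σ ((algState G I σ α t).start + I.d) t) :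
    (algState G I σ α (t + 1)).batch = (algState G I σ α t).batch + 1 ∧
    (algState G I σ α (t + 1)).start = t ∧
    (algState G I σ α (t + 1)).Y = (fun i => (algState G I σ α t).Y i +
      I.η (algState G I σ α t).batch • estimator G σ α i ((algState G I σ α t).ρ i)
        ((algState G I σ α t).start + I.d) t) ∧
    (algState G I σ α (t + 1)).ρ = (fun i => daOracle (shrunkPolytope G i (I.δ i)) (I.h i)
      ((algState G I σ α (t + 1)).Y i)) := by
  simp only [algState]
  rw [if_pos h]
  exact ⟨rfl, rfl, rfl, rfl⟩

lemma daOracle_spec {E : Type*} [NormedAddCommGroup E] [InnerProductSpace ℝ E] {X : Set E}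
    {h : E → ℝ} {y : E} (hmax : ∃ x, IsRegArgmax X h y x) :
    IsRegArgmax X h y (daOracle X h y) :=
  Classical.epsilon_spec hmax

lemma algState_mem (hρ₀ : I.ρ₀ ∈ shrunkProduct G I.δ)
    (hmax : ∀ i y, ∃ x, IsRegArgmax (shrunkPolytope G i (I.δ i)) (I.h i) y x)
    (σ : ℕ → ∀ i, S i) (α : ℕ → ∀ i, A i) (t : ℕ) :
    (algState G I σ α t).ρ ∈ shrunkProduct G I.δ := by
  induction t with
  | zero => exact hρ₀
  | succ t ih =>
    by_cases h : AllVisited σ ((algState G I σ α t).start + I.d) t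
    · rw [(algState_succ_of h).2.2.2]
      exact fun i => (daOracle_spec (hmax i _)).1
    · rwa [algState_succ_of_not h]

/-- The probabilities of the joint action and the next joint state, given the past. -/
noncomputable def stepWeight (G : Game n S A) (I : Input S A) (t : ℕ) (σ : ℕ → ∀ i, S i)
    (α : ℕ → ∀ i, A i) (b : ∀ i, A i) (y : ∀ i, S i) : ℝ :=
  ∏ i, (policyOf ((algState G I σ α t).ρ i) (σ t i) (b i) * G.P i (σ t i) (b i) (y i))

lemma stepWeight_dependsOnHistory (t : ℕ) : DependsOnHistory t (stepWeight G I t) := by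
  intro σ σ' α α' h1 h2
  ext b y
  unfold stepWeight
  rw [algState_congr (σ := σ) (σ' := σ') (fun u hu => h1 u hu.le) h2, h1 t le_rfl]

lemma IsRun.hasPathLaw {Ω : Type*} [MeasurableSpace Ω] {μ : MeasureTheory.Measure Ω}
    {s : ℕ → Ω → ∀ i, S i} {a : ℕ → Ω → ∀ i, A i} (h : IsRun G I μ s a) :
    HasPathLaw (stepWeight G I) μ s a :=
  ⟨h.measurable_state, h.measurable_action, stepWeight_dependsOnHistory, h.law⟩

section OneStep

/-- The deviation of the expected reward from the payoff gradient. -/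
noncomputable def deviation (G : Game n S A) (i : Fin n) (x : S i) (b : A i) (ρ : Profile S A)
    (z : ∀ j, S j) : ℝ :=
  pureReward G i b ρ z - payoffGrad G i ρ (x, b)

variable {δ : Fin n → ℝ} {ρ : Profile S A} (hδ : ∀ i, 0 < δ i) (hρ : ρ ∈ shrunkProduct G δ)
  (z : ∀ j, S j)

include hδ hρ

lemma sum_step_action (g : (∀ j, A j) → ℝ) :
    ∑ b : (∀ j, A j), ∑ y : (∀ j, S j),
        (∏ j, (policyOf (ρ j) (z j) (b j) * G.P j (z j) (b j) (y j))) * g b =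
      prodMean (fun j => policyOf (ρ j) (z j)) g := by
  unfold prodMean
  refine Finset.sum_congr rfl fun b _ => ?_
  rw [← Finset.sum_mul]
  simp_rw [Finset.prod_mul_distrib]
  rw [← Finset.mul_sum, (prod_mem_stdSimplex fun j => G.P_mem j (z j) (b j)).2, mul_one]

/-- Summing out the actions turns one step of play into independent steps of the induced chains. -/
lemma sum_step_state (g : (∀ j, S j) → ℝ) :
    ∑ b : (∀ j, A j), ∑ y : (∀ j, S j),
        (∏ j, (policyOf (ρ j) (z j) (b j) * G.P j (z j) (b j) (y j))) * g y =
      ∑ y : (∀ j, S j), (∏ j, Matrix.vecMul (Pi.single (z j) 1 : S j → ℝ) (chains G ρ j) (y j)) * g y := by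
  rw [Finset.sum_comm]
  refine Finset.sum_congr rfl fun y _ => ?_
  rw [← Finset.sum_mul, sum_prod_eq fun j b => policyOf (ρ j) (z j) b * G.P j (z j) b (y j)]
  congr 1
  refine Finset.prod_congr rfl fun j _ => ?_
  rw [Matrix.single_one_vecMul]
  simp only [Matrix.row, chains, inducedChain, Matrix.of_apply]
  exact Finset.sum_congr rfl fun b _ => mul_comm _ _

lemma sum_step_one : ∑ b : (∀ j, A j), ∑ y : (∀ j, S j),
    ∏ j, (policyOf (ρ j) (z j) (b j) * G.P j (z j) (b j) (y j)) = 1 := by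
  have h := sum_step_action hδ hρ z fun _ => 1
  simp only [mul_one] at h
  rw [h]
  simpa [prodMean] using (prod_mem_stdSimplex fun j => policyOf_stationary (hδ j) (hρ j) (z j)).2

lemma sum_step_hitValue (i : Fin n) (x : S i) (b : A i) (c : ℝ) (m : ℕ) :
    ∑ a : (∀ j, A j), ∑ y : (∀ j, S j),
        (∏ j, (policyOf (ρ j) (z j) (a j) * G.P j (z j) (a j) (y j))) *
          (c * hitValue (chains G ρ) i x (deviation G i x b ρ) (fun j => Pi.single (y j) 1) m) =
      c * hitValue (chains G ρ) i x (deviation G i x b ρ) (fun j => Pi.single (z j) 1)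
        (m + 1) := by
  rw [sum_step_state hδ hρ z fun y =>
    c * hitValue (chains G ρ) i x (deviation G i x b ρ) (fun j => Pi.single (y j) 1) m]
  simp_rw [mul_left_comm _ c]
  rw [← Finset.mul_sum, sum_hitValue (chains_mem_rowStochastic hδ hρ)
    (fun j => Matrix.vecMul (Pi.single (z j) 1) (chains G ρ j)), hitValue_vecMul]

/-- Importance weighting: dividing by the probability of `b` cancels the chance of playing it, and
the actions of the other players are averaged over their policies. -/
lemma sum_step_reward (i : Fin n) (b : A i) (c : ℝ) :
    ∑ a : (∀ j, A j), ∑ y : (∀ j, S j),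
        (∏ j, (policyOf (ρ j) (z j) (a j) * G.P j (z j) (a j) (y j))) *
          (c * ((if a i = b then G.r i z a / policyOf (ρ i) (z i) b else 0) -
            payoffGrad G i ρ (z i, b))) =
      c * deviation G i (z i) b ρ z := by
  rw [sum_step_action hδ hρ z fun a =>
    c * ((if a i = b then G.r i z a / policyOf (ρ i) (z i) b else 0) -
            payoffGrad G i ρ (z i, b))]
  have hp := prod_mem_stdSimplex fun j => policyOf_stationary (hδ j) (hρ j) (z j)
  have hb : policyOf (ρ i) (z i) b ≠ 0 := ((hδ i).trans_le (le_policyOf (hδ i) (hρ i) _ _)).ne'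
  unfold prodMean
  simp_rw [mul_left_comm _ c]
  rw [← Finset.mul_sum]
  congr 1
  simp_rw [mul_sub, Finset.sum_sub_distrib, ← Finset.sum_mul]
  rw [hp.2, one_mul]
  unfold deviation pureReward prodMean
  congr 1
  refine Finset.sum_congr rfl fun a _ => ?_
  rw [← Finset.mul_prod_erase _ _ (Finset.mem_univ i),
    ← Finset.mul_prod_erase Finset.univ (fun j => Function.update
      (fun j => policyOf (ρ j) (z j)) i (Pi.single b 1) j (a j)) (Finset.mem_univ i)]
  have e : ∏ j ∈ Finset.univ.erase i, Function.update
      (fun j => policyOf (ρ j) (z j)) i (Pi.single b 1) j (a j) =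
      ∏ j ∈ Finset.univ.erase i, policyOf (ρ j) (z j) (a j) :=
    Finset.prod_congr rfl fun j hj => by
      rw [Function.update_of_ne (Finset.ne_of_mem_erase hj)]
  rw [e, Function.update_self]
  by_cases h : a i = b
  · rw [if_pos h, h, Pi.single_eq_same]
    field_simp
  · rw [if_neg h, Pi.single_eq_of_ne h]
    ring

-- Used when a batch ends. The new occupation measures depend on the joint action just played, so
-- `c` and `ρ'` are functions of `a`, and only the next state is averaged. Given the action, that
-- state has the product of the transition rows as its law.
omit hδ hρ in
lemma sum_step_centered {δ : Fin n → ℝ} (hδ : ∀ i, 0 < δ i) (i : Fin n) (x : S i) (b : A i)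
    (c : (∀ j, A j) → ℝ) (ρ' : (∀ j, A j) → Profile S A) (hρ' : ∀ a, ρ' a ∈ shrunkProduct G δ)
    (m : ℕ) :
    ∑ a : (∀ j, A j), ∑ y : (∀ j, S j),
        (∏ j, (policyOf (ρ j) (z j) (a j) * G.P j (z j) (a j) (y j))) *
          (c a * hitValue (chains G (ρ' a)) i x (deviation G i x b (ρ' a))
              (fun j => Pi.single (y j) 1) m -
            c a * hitValue (chains G (ρ' a)) i x (deviation G i x b (ρ' a))
              (fun j => G.P j (z j) (a j)) m) = 0 := by
  refine Finset.sum_eq_zero fun a _ => ?_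
  have h1 : ∀ y : (∀ j, S j),
      (∏ j, (policyOf (ρ j) (z j) (a j) * G.P j (z j) (a j) (y j))) *
          (c a * hitValue (chains G (ρ' a)) i x (deviation G i x b (ρ' a))
              (fun j => Pi.single (y j) 1) m -
            c a * hitValue (chains G (ρ' a)) i x (deviation G i x b (ρ' a))
              (fun j => G.P j (z j) (a j)) m) =
      (∏ j, policyOf (ρ j) (z j) (a j)) * c a *
        ((∏ j, G.P j (z j) (a j) (y j)) * hitValue (chains G (ρ' a)) i x
          (deviation G i x b (ρ' a)) (fun j => Pi.single (y j) 1) m -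
        (∏ j, G.P j (z j) (a j) (y j)) * hitValue (chains G (ρ' a)) i x
          (deviation G i x b (ρ' a)) (fun j => G.P j (z j) (a j)) m) := by
    intro y
    rw [Finset.prod_mul_distrib]
    ring
  simp_rw [h1]
  rw [← Finset.mul_sum, Finset.sum_sub_distrib, ← Finset.sum_mul,
    sum_hitValue (chains_mem_rowStochastic hδ (hρ' a)) (fun j => G.P j (z j) (a j)),
    (prod_mem_stdSimplex fun j => G.P_mem j (z j) (a j)).2]
  ring

end OneStep

end AlgorithmPaths

end ChainGame

namespace ChainGame

/-! ### The pending error and its one-step drift. -/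

section Potential

variable {n : ℕ} {S A : Fin n → Type*} [∀ i, Fintype (S i)] [∀ i, Fintype (A i)]
  [∀ i, DecidableEq (S i)] [∀ i, DecidableEq (A i)]

/-- Player `i` visits `x` during `[b, t)`. -/
def VisitedBefore (σ : ℕ → ∀ i, S i) (i : Fin n) (x : S i) (b t : ℕ) : Prop :=
  ∃ u ∈ Finset.Ico b t, σ u i = x

/-- The weighted step size of the batch running at time `t`. -/
noncomputable def batchWeight (G : Game n S A) (I : Input S A) (w : Profile S A → ℝ)
    (t : ℕ) (σ : ℕ → ∀ i, S i) (α : ℕ → ∀ i, A i) : ℝ :=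
  I.η (algState G I σ α t).batch * w (algState G I σ α t).ρ

open Classical in
/-- The conditional mean, given the history up to time `t`, of the weighted error of the sample of
the coordinate `(x, b)` which is still to be taken in the current batch. -/
noncomputable def pendingError (G : Game n S A) (I : Input S A) (i : Fin n) (x : S i) (b : A i)
    (w : Profile S A → ℝ) (t : ℕ) (σ : ℕ → ∀ i, S i) (α : ℕ → ∀ i, A i) : ℝ :=
  if VisitedBefore σ i x ((algState G I σ α t).start + I.d) t then 0
  else batchWeight G I w t σ α *
    hitValue (chains G (algState G I σ α t).ρ) i x (deviation G i x b (algState G I σ α t).ρ)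
      -- The truncated subtraction is the remaining burn-in, and is 0 throughout the sampling
      -- period.
      (fun j => Pi.single (σ t j) 1) ((algState G I σ α t).start + I.d - t)

/-- Time `t` is the first visit of player `i` to `x` in the current sampling period. -/
def SamplesAt (G : Game n S A) (I : Input S A) (i : Fin n) (x : S i) (t : ℕ)
    (σ : ℕ → ∀ i, S i) (α : ℕ → ∀ i, A i) : Prop :=
  (algState G I σ α t).start + I.d ≤ t ∧
    ¬ VisitedBefore σ i x ((algState G I σ α t).start + I.d) t ∧ σ t i = x

open Classical in
/-- The weighted error of the sample of the coordinate `(x, b)`, if it is taken at time `t`. -/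
noncomputable def sampleError (G : Game n S A) (I : Input S A) (i : Fin n) (x : S i) (b : A i)
    (w : Profile S A → ℝ) (t : ℕ) (σ : ℕ → ∀ i, S i) (α : ℕ → ∀ i, A i) : ℝ :=
  if SamplesAt G I i x t σ α then
    batchWeight G I w t σ α *
      ((if α t i = b then G.r i (σ t) (α t) / policyOf ((algState G I σ α t).ρ i) x b else 0) -
        payoffGrad G i (algState G I σ α t).ρ (x, b))
  else 0

open Classical in
/-- The bias of the next batch, if the current batch ends at time `t`. -/
noncomputable def batchBias (G : Game n S A) (I : Input S A) (i : Fin n) (x : S i) (b : A i)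
    (w : Profile S A → ℝ) (t : ℕ) (σ : ℕ → ∀ i, S i) (α : ℕ → ∀ i, A i) : ℝ :=
  if AllVisited σ ((algState G I σ α t).start + I.d) t then
    batchWeight G I w (t + 1) σ α *
      hitValue (chains G (algState G I σ α (t + 1)).ρ) i x
        (deviation G i x b (algState G I σ α (t + 1)).ρ)
        -- The new batch starts at time `t`, but the step to `t + 1` uses an action of the old
        -- batch. So `d - 1` steps with the new policies precede the sampling period.
        (fun j => G.P j (σ t j) (α t j)) (I.d - 1)
  else 0

/-- The error sampled at time `t` plus the error still pending, up to the bias. -/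
noncomputable def nextError (G : Game n S A) (I : Input S A) (i : Fin n) (x : S i) (b : A i)
    (w : Profile S A → ℝ) (t : ℕ) (σ : ℕ → ∀ i, S i) (α : ℕ → ∀ i, A i) : ℝ :=
  sampleError G I i x b w t σ α + pendingError G I i x b w (t + 1) σ α -
    batchBias G I i x b w t σ α

variable {G : Game n S A} {I : Input S A} {i : Fin n} {x : S i} {b : A i} {w : Profile S A → ℝ}

lemma visitedBefore_congr {σ σ' : ℕ → ∀ i, S i} {c t : ℕ} (h : ∀ u < t, σ u = σ' u) :
    VisitedBefore σ i x c t ↔ VisitedBefore σ' i x c t := by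
  refine exists_congr fun u => and_congr_right fun hu => ?_
  rw [h u (Finset.mem_Ico.mp hu).2]

lemma batchWeight_dependsOnHistory (t : ℕ) : DependsOnHistory t (batchWeight G I w t) :=
  (algState_dependsOnHistory t).comp fun c => I.η c.batch * w c.ρ

lemma pendingError_dependsOnHistory (t : ℕ) :
    DependsOnHistory t (pendingError G I i x b w t) := by
  classical
  intro σ σ' α α' h1 h2
  unfold pendingError
  rw [batchWeight_dependsOnHistory t σ σ' α α' h1 h2,
    algState_congr (σ := σ) (σ' := σ') (fun u hu => h1 u hu.le) h2, h1 t le_rfl]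
  exact if_congr (visitedBefore_congr fun u hu => h1 u hu.le) rfl rfl

lemma samplesAt_congr {σ σ' : ℕ → ∀ i, S i} {α α' : ℕ → ∀ i, A i} {t : ℕ}
    (h1 : ∀ u ≤ t, σ u = σ' u) (h2 : ∀ u < t, α u = α' u) :
    SamplesAt G I i x t σ α ↔ SamplesAt G I i x t σ' α' := by
  unfold SamplesAt
  rw [algState_congr (σ := σ) (σ' := σ') (fun u hu => h1 u hu.le) h2, h1 t le_rfl,
    visitedBefore_congr (σ := σ) (σ' := σ') fun u hu => h1 u hu.le]

lemma sampleError_dependsOnHistory (t : ℕ) :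
    DependsOnHistory (t + 1) (sampleError G I i x b w t) := by
  classical
  intro σ σ' α α' h1 h2
  unfold sampleError
  rw [batchWeight_dependsOnHistory t σ σ' α α' (fun u hu => h1 u (by omega))
      fun u hu => h2 u (by omega),
    algState_congr (σ := σ) (σ' := σ') (fun u hu => h1 u (by omega)) fun u hu => h2 u (by omega),
    h1 t (by omega), h2 t (by omega)]
  exact if_congr (samplesAt_congr (fun u hu => h1 u (by omega)) fun u hu => h2 u (by omega)) rfl rfl

lemma batchBias_dependsOnHistory (t : ℕ) :
    DependsOnHistory (t + 1) (batchBias G I i x b w t) := by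
  classical
  intro σ σ' α α' h1 h2
  unfold batchBias
  rw [batchWeight_dependsOnHistory (t + 1) σ σ' α α' h1 h2,
    algState_congr (t := t + 1) (σ := σ) (σ' := σ') (fun u hu => h1 u (by omega)) h2,
    algState_congr (t := t) (σ := σ) (σ' := σ') (fun u hu => h1 u (by omega))
      fun u hu => h2 u (by omega),
    h1 t (by omega), h2 t (by omega)]
  exact if_congr (allVisited_congr fun u hu => h1 u (by omega)) rfl rfl

lemma nextError_dependsOnHistory (t : ℕ) :
    DependsOnHistory (t + 1) (nextError G I i x b w t) :=
  ((sampleError_dependsOnHistory t).comp₂ (pendingError_dependsOnHistory (t + 1))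
    (fun p q => p + q)).comp₂ (batchBias_dependsOnHistory t) fun p q => p - q

lemma VisitedBefore.mono {σ : ℕ → ∀ i, S i} {c t t' : ℕ} (h : VisitedBefore σ i x c t)
    (ht : t ≤ t') : VisitedBefore σ i x c t' := by
  obtain ⟨u, hu, hx⟩ := h
  rw [Finset.mem_Ico] at hu
  exact ⟨u, Finset.mem_Ico.mpr ⟨hu.1, hu.2.trans_le ht⟩, hx⟩

lemma visitedBefore_succ {σ : ℕ → ∀ i, S i} {c t : ℕ} :
    VisitedBefore σ i x c (t + 1) ↔ VisitedBefore σ i x c t ∨ (c ≤ t ∧ σ t i = x) := by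
  constructor
  · rintro ⟨u, hu, hx⟩
    rw [Finset.mem_Ico] at hu
    rcases Nat.lt_succ_iff_lt_or_eq.mp hu.2 with h | rfl
    · exact Or.inl ⟨u, Finset.mem_Ico.mpr ⟨hu.1, h⟩, hx⟩
    · exact Or.inr ⟨hu.1, hx⟩
  · rintro (h | ⟨h, hx⟩)
    · exact h.mono t.le_succ
    · exact ⟨t, Finset.mem_Ico.mpr ⟨h, t.lt_succ_self⟩, hx⟩

lemma not_visitedBefore_of_le {σ : ℕ → ∀ i, S i} {c t : ℕ} (h : t ≤ c) :
    ¬ VisitedBefore σ i x c t := by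
  rintro ⟨u, hu, -⟩
  rw [Finset.mem_Ico] at hu
  omega

lemma AllVisited.visitedBefore {σ : ℕ → ∀ i, S i} {c t : ℕ} (h : AllVisited σ c t) :
    VisitedBefore σ i x c (t + 1) := by
  obtain ⟨u, hu, hx⟩ := h i x
  rw [Finset.mem_Icc] at hu
  exact ⟨u, Finset.mem_Ico.mpr ⟨hu.1, Nat.lt_succ_of_le hu.2⟩, hx⟩

lemma stepMean_add (t : ℕ) (F F' : (ℕ → ∀ i, S i) → (ℕ → ∀ i, A i) → ℝ) (σ : ℕ → ∀ i, S i)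
    (α : ℕ → ∀ i, A i) :
    stepMean (stepWeight G I) t (fun σ α => F σ α + F' σ α) σ α =
      stepMean (stepWeight G I) t F σ α + stepMean (stepWeight G I) t F' σ α := by
  unfold stepMean stepTo
  simp_rw [mul_add, Finset.sum_add_distrib]

lemma stepMean_congr {t : ℕ} {F F' : (ℕ → ∀ i, S i) → (ℕ → ∀ i, A i) → ℝ}
    {σ : ℕ → ∀ i, S i} {α : ℕ → ∀ i, A i}
    (h : ∀ a y, stepTo F t σ α a y = stepTo F' t σ α a y) :
    stepMean (stepWeight G I) t F σ α = stepMean (stepWeight G I) t F' σ α := by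
  unfold stepMean
  simp_rw [h]

variable (hδ : ∀ i, 0 < I.δ i) (hρ₀ : I.ρ₀ ∈ shrunkProduct G I.δ)
  (hmax : ∀ i y, ∃ x, IsRegArgmax (shrunkPolytope G i (I.δ i)) (I.h i) y x)

include hδ hρ₀ hmax

lemma stepMean_of_dependsOnHistory {t : ℕ} {c : (ℕ → ∀ i, S i) → (ℕ → ∀ i, A i) → ℝ}
    (hc : DependsOnHistory t c) (σ : ℕ → ∀ i, S i) (α : ℕ → ∀ i, A i) :
    stepMean (stepWeight G I) t c σ α = c σ α := by
  have h := HasPathLaw.stepMean_mul_left (W := stepWeight G I) hc (fun _ _ => 1) σ α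
  simp only [mul_one] at h
  rw [h]
  unfold stepMean stepTo stepWeight
  simp only [mul_one]
  rw [sum_step_one hδ (algState_mem hρ₀ hmax σ α t), mul_one]

/-- The mean of the error sampled at time `t`. -/
lemma stepMean_sampleError (t : ℕ) (σ : ℕ → ∀ i, S i) (α : ℕ → ∀ i, A i)
    (hs : SamplesAt G I i x t σ α) :
    stepMean (stepWeight G I) t (sampleError G I i x b w t) σ α =
      batchWeight G I w t σ α * deviation G i x b (algState G I σ α t).ρ (σ t) := by
  classical
  have hρ := algState_mem hρ₀ hmax σ α t
  have hx := hs.2.2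
  subst hx
  rw [← sum_step_reward hδ hρ]
  unfold stepMean stepTo stepWeight
  refine Finset.sum_congr rfl fun a _ => Finset.sum_congr rfl fun y _ => ?_
  congr 1
  have e1 : ∀ u ≤ t, Function.update σ (t + 1) y u = σ u := fun u hu =>
    Function.update_of_ne (by omega) _ _
  have e2 : ∀ u < t, Function.update α t a u = α u := fun u hu =>
    Function.update_of_ne (by omega) _ _
  unfold sampleError
  rw [if_pos ((samplesAt_congr e1 e2).mpr hs),
    batchWeight_dependsOnHistory t _ σ _ α e1 e2,
    algState_congr (fun u hu => e1 u hu.le) e2, e1 t le_rfl, Function.update_self]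

/-- Within a batch, the pending error is a martingale until the sample is taken. -/
lemma stepMean_pendingError (t : ℕ) (σ : ℕ → ∀ i, S i) (α : ℕ → ∀ i, A i)
    (hv : ¬ AllVisited σ ((algState G I σ α t).start + I.d) t)
    (hs : ¬ SamplesAt G I i x t σ α) :
    stepMean (stepWeight G I) t (pendingError G I i x b w (t + 1)) σ α =
      pendingError G I i x b w t σ α := by
  classical
  have hρ := algState_mem hρ₀ hmax σ α t
  have e1 : ∀ y, ∀ u ≤ t, Function.update σ (t + 1) y u = σ u := fun y u hu =>
    Function.update_of_ne (by omega) _ _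
  have e2 : ∀ a, ∀ u < t, Function.update α t a u = α u := fun a u hu =>
    Function.update_of_ne (by omega) _ _
  have e3 : ∀ a y, algState G I (Function.update σ (t + 1) y) (Function.update α t a) (t + 1) =
      algState G I σ α t := by
    intro a y
    have h0 : algState G I (Function.update σ (t + 1) y) (Function.update α t a) t =
      algState G I σ α t := algState_congr (fun u hu => e1 y u hu.le) (e2 a)
    rw [← h0]
    apply algState_succ_of_not
    rw [h0, allVisited_congr (e1 y)]
    exact hv
  have e4 : ∀ a y, batchWeight G I w (t + 1) (Function.update σ (t + 1) y)
      (Function.update α t a) = batchWeight G I w t σ α := by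
    intro a y
    unfold batchWeight
    rw [e3]
  have e5 : ∀ y, VisitedBefore (Function.update σ (t + 1) y) i x
      ((algState G I σ α t).start + I.d) (t + 1) ↔
      VisitedBefore σ i x ((algState G I σ α t).start + I.d) t := by
    intro y
    rw [visitedBefore_congr (σ' := σ) fun u hu => e1 y u (Nat.lt_succ_iff.mp hu),
      visitedBefore_succ]
    constructor
    · rintro (h | h)
      · exact h
      · by_contra h'
        exact hs ⟨h.1, h', h.2⟩
    · exact Or.inl
  by_cases hb : VisitedBefore σ i x ((algState G I σ α t).start + I.d) t
  · have : ∀ a y, stepTo (pendingError G I i x b w (t + 1)) t σ α a y = 0 := by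
      intro a y
      unfold stepTo pendingError
      rw [if_pos]
      rw [e3, e5]
      exact hb
    have h0 : pendingError G I i x b w t σ α = 0 := if_pos hb
    rw [h0]
    unfold stepMean
    simp_rw [this, mul_zero, Finset.sum_const_zero]
  · have : ∀ a y, stepTo (pendingError G I i x b w (t + 1)) t σ α a y =
        batchWeight G I w t σ α * hitValue (chains G (algState G I σ α t).ρ) i x
          (deviation G i x b (algState G I σ α t).ρ) (fun j => Pi.single (y j) 1)
          ((algState G I σ α t).start + I.d - (t + 1)) := by
      intro a y
      unfold stepTo pendingError
      rw [if_neg, e3, e4, Function.update_self]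
      rw [e3, e5]
      exact hb
    unfold stepMean stepWeight
    simp_rw [this]
    rw [sum_step_hitValue hδ hρ]
    unfold pendingError
    rw [if_neg hb]
    congr 1
    -- During the burn-in the waiting time drops by one. During the sampling period it stays 0, and
    -- since player `i` is not at `x`, waiting no step or one step gives the same first hit.
    rcases Nat.lt_or_ge t ((algState G I σ α t).start + I.d) with h | h
    · congr 1
      omega
    · have h1 : (algState G I σ α t).start + I.d - (t + 1) + 1 = 1 := by omega
      have h2 : (algState G I σ α t).start + I.d - t = 0 := by omega
      rw [h1, h2, hitValue_of_ne (chains_mem_rowStochastic hδ hρ)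
        (fun j => single_mem_stdSimplex' _)]
      refine Pi.single_eq_of_ne ?_ _
      intro hx
      exact hs ⟨h, hb, hx.symm⟩

/-- The pending error of the new batch is a function of the next state, and the bias is its mean
given the history and the actions of time `t`. -/
lemma stepMean_batchBias (hd : 1 ≤ I.d) (t : ℕ) (σ : ℕ → ∀ i, S i) (α : ℕ → ∀ i, A i)
    (hv : AllVisited σ ((algState G I σ α t).start + I.d) t) :
    stepMean (stepWeight G I) t
      (fun σ α => pendingError G I i x b w (t + 1) σ α - batchBias G I i x b w t σ α) σ α = 0 := by
  classical
  have e1 : ∀ y, ∀ u ≤ t, Function.update σ (t + 1) y u = σ u := fun y u hu =>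
    Function.update_of_ne (by omega) _ _
  have e2 : ∀ a, ∀ u < t, Function.update α t a u = α u := fun a u hu =>
    Function.update_of_ne (by omega) _ _
  have e0 : ∀ a y, algState G I (Function.update σ (t + 1) y) (Function.update α t a) t =
      algState G I σ α t := fun a y => algState_congr (fun u hu => e1 y u hu.le) (e2 a)
  have e3 : ∀ a y, algState G I (Function.update σ (t + 1) y) (Function.update α t a) (t + 1) =
      algState G I σ (Function.update α t a) (t + 1) := fun a y =>
    algState_congr (fun u hu => e1 y u (Nat.lt_succ_iff.mp hu)) fun u _ => rfl
  have hv' : ∀ a y, AllVisited (Function.update σ (t + 1) y)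
      ((algState G I (Function.update σ (t + 1) y) (Function.update α t a) t).start + I.d) t := by
    intro a y
    rw [e0, allVisited_congr (e1 y)]
    exact hv
  have e4 : ∀ a y, batchWeight G I w (t + 1) (Function.update σ (t + 1) y)
      (Function.update α t a) = batchWeight G I w (t + 1) σ (Function.update α t a) := by
    intro a y
    unfold batchWeight
    rw [e3]
  have e6 : ∀ a, (algState G I σ (Function.update α t a) (t + 1)).start = t := by
    intro a
    rw [← e3 a (σ t)]
    exact (algState_succ_of (hv' a (σ t))).2.1
  have hm : t + I.d - (t + 1) = I.d - 1 := by omega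
  rw [← sum_step_centered (G := G) (ρ := (algState G I σ α t).ρ) (σ t) hδ i x b
    (fun a => batchWeight G I w (t + 1) σ (Function.update α t a))
    (fun a => (algState G I σ (Function.update α t a) (t + 1)).ρ)
    (fun a => algState_mem hρ₀ hmax _ _ _) (I.d - 1)]
  unfold stepMean stepWeight
  refine Finset.sum_congr rfl fun a _ => Finset.sum_congr rfl fun y _ => ?_
  congr 1
  unfold stepTo pendingError batchBias
  beta_reduce
  rw [if_pos (hv' a y), if_neg, e3, e4, Function.update_self, Function.update_self, e1 y t le_rfl,
    e6, hm]
  rw [e3, e6]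
  exact not_visitedBefore_of_le (by omega)

/-- This is the drift identity behind the error martingale: the pending error is passed on, becomes
the sampled error when `x` is reached, or is reset at the end of a batch, where subtracting the bias
makes the new pending error centred. -/
lemma stepMean_nextError (hd : 1 ≤ I.d) (t : ℕ) (σ : ℕ → ∀ i, S i) (α : ℕ → ∀ i, A i) :
    stepMean (stepWeight G I) t (nextError G I i x b w t) σ α =
      pendingError G I i x b w t σ α := by
  classical
  have hρ := algState_mem hρ₀ hmax σ α t
  have e1 : ∀ y, ∀ u ≤ t, Function.update σ (t + 1) y u = σ u := fun y u hu =>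
    Function.update_of_ne (by omega) _ _
  have e2 : ∀ a, ∀ u < t, Function.update α t a u = α u := fun a u hu =>
    Function.update_of_ne (by omega) _ _
  have e0 : ∀ a y, algState G I (Function.update σ (t + 1) y) (Function.update α t a) t =
      algState G I σ α t := fun a y => algState_congr (fun u hu => e1 y u hu.le) (e2 a)
  have hzero : stepMean (stepWeight G I) t (fun _ _ => (0 : ℝ)) σ α = 0 := by
    simp [stepMean, stepTo]
  have hsplit : stepMean (stepWeight G I) t (nextError G I i x b w t) σ α =
      stepMean (stepWeight G I) t (sampleError G I i x b w t) σ α +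
      stepMean (stepWeight G I) t
        (fun σ α => pendingError G I i x b w (t + 1) σ α - batchBias G I i x b w t σ α) σ α := by
    rw [← stepMean_add]
    refine stepMean_congr fun a y => ?_
    unfold stepTo nextError
    ring
  have hsample0 : ¬ SamplesAt G I i x t σ α →
      stepMean (stepWeight G I) t (sampleError G I i x b w t) σ α = 0 := by
    intro hs
    rw [← hzero]
    refine stepMean_congr fun a y => ?_
    unfold stepTo sampleError
    rw [if_neg]
    rw [samplesAt_congr (e1 y) (e2 a)]
    exact hs
  have hpend : SamplesAt G I i x t σ α → pendingError G I i x b w t σ α =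
      batchWeight G I w t σ α * deviation G i x b (algState G I σ α t).ρ (σ t) := by
    intro hs
    unfold pendingError
    rw [if_neg hs.2.1, Nat.sub_eq_zero_of_le hs.1, hitValue_of_eq hs.2.2]
  rw [hsplit]
  by_cases hv : AllVisited σ ((algState G I σ α t).start + I.d) t
  · rw [stepMean_batchBias hδ hρ₀ hmax hd t σ α hv, add_zero]
    by_cases hs : SamplesAt G I i x t σ α
    · rw [stepMean_sampleError hδ hρ₀ hmax t σ α hs, hpend hs]
    · rw [hsample0 hs]
      unfold pendingError
      rw [if_pos]
      -- The batch ends now without a sample of `x` at time `t`, so `x` was visited earlier and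
      -- nothing is pending.
      rcases visitedBefore_succ.mp (hv.visitedBefore (i := i) (x := x)) with h | h
      · exact h
      · by_contra h'
        exact hs ⟨h.1, h', h.2⟩
  · have hb0 : ∀ a y, stepTo (batchBias G I i x b w t) t σ α a y = 0 := by
      intro a y
      unfold stepTo batchBias
      rw [if_neg]
      rw [e0, allVisited_congr (e1 y)]
      exact hv
    have hdrop : stepMean (stepWeight G I) t
        (fun σ α => pendingError G I i x b w (t + 1) σ α - batchBias G I i x b w t σ α) σ α =
        stepMean (stepWeight G I) t (pendingError G I i x b w (t + 1)) σ α := by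
      refine stepMean_congr fun a y => ?_
      have := hb0 a y
      unfold stepTo at this ⊢
      beta_reduce
      rw [this, sub_zero]
    rw [hdrop]
    by_cases hs : SamplesAt G I i x t σ α
    · rw [stepMean_sampleError hδ hρ₀ hmax t σ α hs, hpend hs]
      -- Once sampled, `x` counts as visited at time `t + 1`, so the next pending error vanishes.
      convert add_zero _
      rw [← hzero]
      refine stepMean_congr fun a y => ?_
      unfold stepTo pendingError
      rw [if_pos]
      have : algState G I (Function.update σ (t + 1) y) (Function.update α t a) (t + 1) =
          algState G I σ α t := by
        rw [← e0 a y]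
        apply algState_succ_of_not
        rw [e0, allVisited_congr (e1 y)]
        exact hv
      rw [this, visitedBefore_congr (σ' := σ) fun u hu => e1 y u (Nat.lt_succ_iff.mp hu),
        visitedBefore_succ]
      exact Or.inr ⟨hs.1, hs.2.2⟩
    · rw [hsample0 hs, zero_add, stepMean_pendingError hδ hρ₀ hmax t σ α hv hs]

end Potential

end ChainGame

namespace ChainGame

/-! ### Second-moment control of the accumulated errors. -/

section ErrorMartingale

variable {n : ℕ} {S A : Fin n → Type*} [∀ i, Fintype (S i)] [∀ i, Fintype (A i)]
  [∀ i, DecidableEq (S i)] [∀ i, DecidableEq (A i)]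
  {G : Game n S A} {I : Input S A} {i : Fin n} {x : S i} {b : A i} {w : Profile S A → ℝ}

section Bounds

variable (hδ : ∀ i, 0 < I.δ i) (hρ₀ : I.ρ₀ ∈ shrunkProduct G I.δ)
  (hmax : ∀ i y, ∃ x, IsRegArgmax (shrunkPolytope G i (I.δ i)) (I.h i) y x)
  (hη : ∀ l, 0 ≤ I.η l) (hw : ∀ ρ ∈ shrunkProduct G I.δ, |w ρ| ≤ 1)
  (t : ℕ) (σ : ℕ → ∀ i, S i) (α : ℕ → ∀ i, A i)

include hδ hρ₀ hmax hη hw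

lemma abs_batchWeight_le : |batchWeight G I w t σ α| ≤ I.η (algState G I σ α t).batch := by
  unfold batchWeight
  rw [abs_mul, abs_of_nonneg (hη _)]
  exact mul_le_of_le_one_right (hη _) (hw _ (algState_mem hρ₀ hmax σ α t))

lemma abs_pendingError_le :
    |pendingError G I i x b w t σ α| ≤ I.η (algState G I σ α t).batch := by
  unfold pendingError
  split_ifs
  · simpa using hη _
  · rw [abs_mul]
    refine (mul_le_of_le_one_right (abs_nonneg _) ?_).trans
      (abs_batchWeight_le hδ hρ₀ hmax hη hw t σ α)
    exact abs_hitValue_le_one hδ (algState_mem hρ₀ hmax σ α t) i x b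
      (fun j => single_mem_stdSimplex' _) _

lemma abs_sampleError_le :
    |sampleError G I i x b w t σ α| ≤ I.η (algState G I σ α t).batch * (1 / I.δ i + 1) := by
  have hρ := algState_mem hρ₀ hmax σ α t
  have hδi := hδ i
  unfold sampleError
  split_ifs with h1 h2
  · rw [abs_mul]
    refine mul_le_mul (abs_batchWeight_le hδ hρ₀ hmax hη hw t σ α) ?_ (abs_nonneg _) (hη _)
    refine (abs_sub _ _).trans (add_le_add ?_ ?_)
    · have hp := le_policyOf hδi (hρ i) x b
      have hr := G.r_mem i (σ t) (α t)
      rw [abs_of_nonneg (div_nonneg hr.1 (hδi.le.trans hp))]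
      exact div_le_div₀ zero_le_one hr.2 hδi hp
    · have hg := payoffGrad_mem_Icc hδ hρ i (x, b)
      rw [abs_of_nonneg hg.1]
      exact hg.2
  · rw [abs_mul]
    refine mul_le_mul (abs_batchWeight_le hδ hρ₀ hmax hη hw t σ α) ?_ (abs_nonneg _) (hη _)
    have hg := payoffGrad_mem_Icc hδ hρ i (x, b)
    rw [zero_sub, abs_neg, abs_of_nonneg hg.1]
    have : 0 < 1 / I.δ i := by positivity
    linarith [hg.2]
  · rw [abs_zero]
    have := hη (algState G I σ α t).batch
    positivity

lemma abs_batchBias_le :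
    |batchBias G I i x b w t σ α| ≤ I.η (algState G I σ α (t + 1)).batch := by
  unfold batchBias
  split_ifs
  · rw [abs_mul]
    refine (mul_le_of_le_one_right (abs_nonneg _) ?_).trans
      (abs_batchWeight_le hδ hρ₀ hmax hη hw (t + 1) σ α)
    exact abs_hitValue_le_one hδ (algState_mem hρ₀ hmax σ α (t + 1)) i x b
      (fun j => G.P_mem j _ _) _
  · simpa using hη _

/-- The accumulated changes of the squared errors which occur when samples are taken and when
batches end. -/
noncomputable def squareJumps (G : Game n S A) (I : Input S A) (i : Fin n) (x : S i) (b : A i)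
    (w : Profile S A → ℝ) (t : ℕ) (σ : ℕ → ∀ i, S i) (α : ℕ → ∀ i, A i) : ℝ :=
  ∑ u ∈ Finset.range t, (nextError G I i x b w u σ α ^ 2 - pendingError G I i x b w (u + 1) σ α ^ 2)

/-- If a sample is taken and the batch goes on, nothing is pending afterwards and no bias enters, so
only the step size of the running batch appears. -/
lemma nextError_sq_le_of_sampled (hv : ¬ AllVisited σ ((algState G I σ α t).start + I.d) t)
    (hs : SamplesAt G I i x t σ α) :
    nextError G I i x b w t σ α ^ 2 ≤
      (2 * (1 / I.δ i + 1) ^ 2 + 8) * I.η (algState G I σ α t).batch ^ 2 := by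
  have h1 : nextError G I i x b w t σ α = sampleError G I i x b w t σ α := by
    have h2 : pendingError G I i x b w (t + 1) σ α = 0 := by
      unfold pendingError
      rw [if_pos]
      rw [algState_succ_of_not hv, visitedBefore_succ]
      exact Or.inr ⟨hs.1, hs.2.2⟩
    have h3 : batchBias G I i x b w t σ α = 0 := if_neg hv
    unfold nextError
    rw [h2, h3]
    ring
  rw [h1]
  have hle := abs_sampleError_le (x := x) (b := b) (i := i) hδ hρ₀ hmax hη hw t σ α
  have h := pow_le_pow_left₀ (abs_nonneg _) hle 2
  rw [sq_abs] at h
  nlinarith [mul_nonneg (sq_nonneg (1 / I.δ i + 1)) (sq_nonneg (I.η (algState G I σ α t).batch)),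
    sq_nonneg (I.η (algState G I σ α t).batch)]

lemma nextError_sq_le :
    nextError G I i x b w t σ α ^ 2 ≤ (2 * (1 / I.δ i + 1) ^ 2 + 8) *
      (I.η (algState G I σ α t).batch ^ 2 + I.η (algState G I σ α (t + 1)).batch ^ 2) := by
  have h1 := abs_sampleError_le (x := x) (b := b) (i := i) hδ hρ₀ hmax hη hw t σ α
  have h2 := abs_pendingError_le (x := x) (b := b) (i := i) hδ hρ₀ hmax hη hw (t + 1) σ α
  have h3 := abs_batchBias_le (x := x) (b := b) (i := i) hδ hρ₀ hmax hη hw t σ α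
  set p := I.η (algState G I σ α t).batch
  set q := I.η (algState G I σ α (t + 1)).batch
  set c := 1 / I.δ i + 1
  -- The next batch enters twice, through its pending error and its bias. The constant 2c² + 8 comes
  -- from (pc + 2q)² ≤ 2p²c² + 8q².
  have h4 : |nextError G I i x b w t σ α| ≤ p * c + 2 * q := by
    unfold nextError
    refine (abs_sub _ _).trans ?_
    refine (add_le_add (abs_add_le _ _) le_rfl).trans ?_
    linarith
  rw [← sq_abs]
  refine (pow_le_pow_left₀ (abs_nonneg _) h4 2).trans ?_
  nlinarith [sq_nonneg (p * c - 2 * q), sq_nonneg p, sq_nonneg q, sq_nonneg c,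
    mul_nonneg (sq_nonneg c) (sq_nonneg q)]

/-- At such times the summand of `squareJumps` is zero, so the length of a batch does not matter. -/
lemma nextError_of_not (hv : ¬ AllVisited σ ((algState G I σ α t).start + I.d) t)
    (hs : ¬ SamplesAt G I i x t σ α) :
    nextError G I i x b w t σ α = pendingError G I i x b w (t + 1) σ α := by
  have h2 : sampleError G I i x b w t σ α = 0 := if_neg hs
  have h3 : batchBias G I i x b w t σ α = 0 := if_neg hv
  unfold nextError
  rw [h2, h3]
  ring

-- Amortized count. A batch is charged at most three times: when it starts, when its sample is taken
-- and when it ends. The running batch is charged once for its start and once more if `x` has been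
-- visited.
open Classical in
lemma squareJumps_le : squareJumps G I i x b w t σ α ≤ (2 * (1 / I.δ i + 1) ^ 2 + 8) *
    (∑ l ∈ Finset.range (algState G I σ α t).batch, 3 * I.η l ^ 2 +
      I.η (algState G I σ α t).batch ^ 2 *
        (1 + if VisitedBefore σ i x ((algState G I σ α t).start + I.d) t then 1 else 0)) := by
  have hC : 0 ≤ 2 * (1 / I.δ i + 1) ^ 2 + 8 := by positivity
  induction t with
  | zero =>
    simp only [squareJumps, Finset.range_zero, Finset.sum_empty]
    refine mul_nonneg hC (add_nonneg (Finset.sum_nonneg fun l _ => by positivity) ?_)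
    refine mul_nonneg (sq_nonneg _) ?_
    split_ifs <;> norm_num
  | succ t ih =>
    have hstep : squareJumps G I i x b w (t + 1) σ α = squareJumps G I i x b w t σ α +
        (nextError G I i x b w t σ α ^ 2 - pendingError G I i x b w (t + 1) σ α ^ 2) :=
      Finset.sum_range_succ _ _
    rw [hstep]
    set C := 2 * (1 / I.δ i + 1) ^ 2 + 8
    have hp := sq_nonneg (pendingError G I i x b w (t + 1) σ α)
    by_cases hv : AllVisited σ ((algState G I σ α t).start + I.d) t
    · have h1 := nextError_sq_le (x := x) (b := b) (i := i) hδ hρ₀ hmax hη hw t σ α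
      have h2 := (algState_succ_of (G := G) (α := α) hv).1
      rw [h2] at h1 ⊢
      rw [Finset.sum_range_succ]
      refine (add_le_add ih ((sub_le_self _ hp).trans h1)).trans ?_
      rw [← mul_add]
      refine mul_le_mul_of_nonneg_left ?_ hC
      have hk := sq_nonneg (I.η (algState G I σ α t).batch)
      have hk' := sq_nonneg (I.η ((algState G I σ α t).batch + 1))
      split_ifs <;> nlinarith
    · rw [algState_succ_of_not hv]
      by_cases hs : SamplesAt G I i x t σ α
      · have h1 := nextError_sq_le_of_sampled (x := x) (b := b) hδ hρ₀ hmax hη hw t σ α hv hs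
        have h2 : VisitedBefore σ i x ((algState G I σ α t).start + I.d) (t + 1) :=
          visitedBefore_succ.mpr (Or.inr ⟨hs.1, hs.2.2⟩)
        rw [if_neg hs.2.1] at ih
        rw [if_pos h2]
        linarith
      · rw [nextError_of_not hδ hρ₀ hmax hη hw t σ α hv hs, sub_self, add_zero]
        refine ih.trans (mul_le_mul_of_nonneg_left ?_ hC)
        refine add_le_add_right (mul_le_mul_of_nonneg_left ?_ (sq_nonneg _)) _
        refine add_le_add_right ?_ _
        by_cases h : VisitedBefore σ i x ((algState G I σ α t).start + I.d) t
        · rw [if_pos h, if_pos (h.mono t.le_succ)]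
        · rw [if_neg h]
          split_ifs <;> norm_num

/-- The factor 5 is 3 for the finished batches plus 2 for the running one. -/
lemma squareJumps_le_tsum (hη_sq : Summable fun l => I.η l ^ 2) :
    squareJumps G I i x b w t σ α ≤ (2 * (1 / I.δ i + 1) ^ 2 + 8) * (5 * ∑' l, I.η l ^ 2) := by
  classical
  refine (squareJumps_le hδ hρ₀ hmax hη hw t σ α).trans
    (mul_le_mul_of_nonneg_left ?_ (by positivity))
  rw [← Finset.mul_sum]
  have h1 := hη_sq.sum_le_tsum (Finset.range (algState G I σ α t).batch) fun _ _ => sq_nonneg _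
  have h2 := hη_sq.le_tsum (algState G I σ α t).batch fun _ _ => sq_nonneg _
  have h3 := sq_nonneg (I.η (algState G I σ α t).batch)
  split_ifs <;> nlinarith

end Bounds

/-- The sum of the sampling errors, compensated by the biases, is almost surely bounded. -/
theorem ae_bounded_sum_sampleError (hδ : ∀ i, 0 < I.δ i) (hρ₀ : I.ρ₀ ∈ shrunkProduct G I.δ)
    (hmax : ∀ i y, ∃ x, IsRegArgmax (shrunkPolytope G i (I.δ i)) (I.h i) y x)
    (hη : ∀ l, 0 ≤ I.η l) (hw : ∀ ρ ∈ shrunkProduct G I.δ, |w ρ| ≤ 1)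
    (hη_sq : Summable fun l => I.η l ^ 2) (hd : 1 ≤ I.d) {Ω : Type*} [MeasurableSpace Ω]
    {μ : MeasureTheory.Measure Ω} [MeasureTheory.IsProbabilityMeasure μ]
    {s : ℕ → Ω → ∀ i, S i} {a : ℕ → Ω → ∀ i, A i} (hrun : IsRun G I μ s a) (x : S i) (b : A i) :
    ∀ᵐ ω ∂μ, ∃ D, ∀ t,
      |∑ u ∈ Finset.range t, (sampleError G I i x b w u (fun u => s u ω) (fun u => a u ω) -
        batchBias G I i x b w u (fun u => s u ω) (fun u => a u ω))| ≤ D := by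
  set M : ℕ → (ℕ → ∀ i, S i) → (ℕ → ∀ i, A i) → ℝ := fun t σ α => ∑ u ∈ Finset.range t,
    (nextError G I i x b w u σ α - pendingError G I i x b w u σ α) with hM
  set E := ∑' l, I.η l ^ 2
  -- With H the pending error and N the next error, M_{t+1} = (M_t - H_t) + N_t. In L_{t+1} the
  -- terms N_t² and H_{t+1}² cancel, leaving an expression affine in N_t. As N_t has mean H_t, `L`
  -- is again a martingale.
  set L : ℕ → (ℕ → ∀ i, S i) → (ℕ → ∀ i, A i) → ℝ := fun t σ α => M t σ α ^ 2 -
    pendingError G I i x b w t σ α ^ 2 - squareJumps G I i x b w t σ α with hL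
  have hMd : ∀ t, DependsOnHistory t (M t) := fun t =>
    dependsOnHistory_sum _ fun u hu =>
      (((nextError_dependsOnHistory u).mono (Finset.mem_range.mp hu)).comp₂
        ((pendingError_dependsOnHistory u).mono (Finset.mem_range.mp hu).le) fun p q => p - q)
  have hJd : ∀ t, DependsOnHistory t (squareJumps G I i x b w t) := fun t =>
    dependsOnHistory_sum _ fun u hu =>
      (((nextError_dependsOnHistory u).mono (Finset.mem_range.mp hu)).comp₂
        ((pendingError_dependsOnHistory (u + 1)).mono (Finset.mem_range.mp hu))
        fun p q => p ^ 2 - q ^ 2)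
  have hLd : ∀ t, DependsOnHistory t (L t) := fun t =>
    ((hMd t).comp₂ (pendingError_dependsOnHistory t) fun p q => p ^ 2 - q ^ 2).comp₂ (hJd t)
      fun p q => p - q
  have hMstep : ∀ t σ α, stepMean (stepWeight G I) t (M (t + 1)) σ α = M t σ α := by
    intro t σ α
    have hc : DependsOnHistory t fun σ α => M t σ α - pendingError G I i x b w t σ α :=
      (hMd t).comp₂ (pendingError_dependsOnHistory t) fun p q => p - q
    have : M (t + 1) = fun σ α => (M t σ α - pendingError G I i x b w t σ α) +
        nextError G I i x b w t σ α := by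
      ext σ α
      simp only [hM, Finset.sum_range_succ]
      ring
    rw [this, stepMean_add, stepMean_of_dependsOnHistory hδ hρ₀ hmax hc,
      stepMean_nextError hδ hρ₀ hmax hd]
    ring
  have hLstep : ∀ t σ α, stepMean (stepWeight G I) t (L (t + 1)) σ α = L t σ α := by
    intro t σ α
    have hc : DependsOnHistory t fun σ α => M t σ α - pendingError G I i x b w t σ α :=
      (hMd t).comp₂ (pendingError_dependsOnHistory t) fun p q => p - q
    have hc' : DependsOnHistory t fun σ α => (M t σ α - pendingError G I i x b w t σ α) ^ 2 -
        squareJumps G I i x b w t σ α := hc.comp₂ (hJd t) fun p q => p ^ 2 - q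
    have : L (t + 1) = fun σ α => ((M t σ α - pendingError G I i x b w t σ α) ^ 2 -
        squareJumps G I i x b w t σ α) + (2 * (M t σ α - pendingError G I i x b w t σ α)) *
          nextError G I i x b w t σ α := by
      ext σ α
      simp only [hL, hM, squareJumps, Finset.sum_range_succ]
      ring
    rw [this, stepMean_add, stepMean_of_dependsOnHistory hδ hρ₀ hmax hc',
      HasPathLaw.stepMean_mul_left (hc.comp fun p => 2 * p), stepMean_nextError hδ hρ₀ hmax hd]
    simp only [hL]
    ring
  have hpend : ∀ t σ α, pendingError G I i x b w t σ α ^ 2 ≤ E := fun t σ α => by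
    rw [← sq_abs]
    exact (pow_le_pow_left₀ (abs_nonneg _)
      (abs_pendingError_le hδ hρ₀ hmax hη hw t σ α) 2).trans
        (hη_sq.le_tsum _ fun _ _ => sq_nonneg _)
  have hML : ∀ t σ α, M t σ α ^ 2 ≤ L t σ α +
      (E + (2 * (1 / I.δ i + 1) ^ 2 + 8) * (5 * E)) := by
    intro t σ α
    have h1 := hpend t σ α
    have h2 := squareJumps_le_tsum (x := x) (b := b) (i := i) hδ hρ₀ hmax hη hw t σ α hη_sq
    simp only [hL]
    linarith
  filter_upwards [hrun.hasPathLaw.ae_bounded hMd hMstep hLd hLstep hML] with ω ⟨D, hD⟩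
  -- The sum of sampled errors differs from `M` by the pending errors at times 0 and `t`, each at
  -- most `E + 1`. The initial one accounts for the mean error of batch 0, which has no bias term.
  refine ⟨D + 2 * (E + 1), fun t => ?_⟩
  set σ : ℕ → ∀ i, S i := fun u => s u ω
  set α : ℕ → ∀ i, A i := fun u => a u ω
  have h1 : ∑ u ∈ Finset.range t,
      (sampleError G I i x b w u σ α - batchBias G I i x b w u σ α) =
      M t σ α + (pendingError G I i x b w 0 σ α - pendingError G I i x b w t σ α) := by
    rw [← Finset.sum_range_sub' (fun u => pendingError G I i x b w u σ α) t]
    simp only [hM]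
    rw [← Finset.sum_add_distrib]
    refine Finset.sum_congr rfl fun u _ => ?_
    unfold nextError
    ring
  have h2 : ∀ t, |pendingError G I i x b w t σ α| ≤ E + 1 := fun t => by
    have := hpend t σ α
    rw [← sq_abs] at this
    nlinarith [sq_nonneg (|pendingError G I i x b w t σ α| - 1),
      abs_nonneg (pendingError G I i x b w t σ α)]
  rw [h1]
  have h3 := abs_add_le (M t σ α)
    (pendingError G I i x b w 0 σ α - pendingError G I i x b w t σ α)
  have h4 := abs_sub (pendingError G I i x b w 0 σ α) (pendingError G I i x b w t σ α)
  linarith [hD t, h2 0, h2 t]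

end ErrorMartingale

end ChainGame

namespace ChainGame

/-! ### Every batch ends almost surely. -/

section BatchesEnd

open MeasureTheory

variable {n : ℕ} {S A : Fin n → Type*} [∀ i, Fintype (S i)] [∀ i, Fintype (A i)]
  [∀ i, DecidableEq (S i)] [∀ i, DecidableEq (A i)] {G : Game n S A} {I : Input S A}

lemma sum_prod_mul_apply {ι : Type*} [Fintype ι] [DecidableEq ι] {S : ι → Type*}
    [∀ i, Fintype (S i)] [∀ i, DecidableEq (S i)] {l : ∀ j, S j → ℝ} (hl : ∀ j, l j ∈ stdSimplex ℝ (S j)) (i : ι)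
    (g : S i → ℝ) : ∑ y : (∀ j, S j), (∏ j, l j (y j)) * g (y i) = ∑ x, l i x * g x := by
  have h : ∀ y : (∀ j, S j), (∏ j, l j (y j)) * g (y i) =
      ∏ j, Function.update l i (fun x => l i x * g x) j (y j) := by
    intro y
    rw [← Finset.mul_prod_erase _ _ (Finset.mem_univ i),
      ← Finset.mul_prod_erase Finset.univ
        (fun j => Function.update l i (fun x => l i x * g x) j (y j)) (Finset.mem_univ i),
      Function.update_self]
    have : ∏ j ∈ Finset.univ.erase i, Function.update l i (fun x => l i x * g x) j (y j) =
        ∏ j ∈ Finset.univ.erase i, l j (y j) :=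
      Finset.prod_congr rfl fun j hj => by
        rw [Function.update_of_ne (Finset.ne_of_mem_erase hj)]
    rw [this]
    ring
  simp_rw [h]
  rw [sum_prod_eq, Finset.prod_eq_single i]
  · rw [Function.update_self]
  · intro j _ hj
    rw [Function.update_of_ne hj, (hl j).2]
  · simp

open Classical in
/-- The indicator that the batch that starts at `t₀` runs at time `t` and that player `i` has not
visited `x` in its sampling period. -/
noncomputable def unvisited (G : Game n S A) (I : Input S A) (t₀ : ℕ) (i : Fin n) (x : S i) (t : ℕ)
    (σ : ℕ → ∀ i, S i) (α : ℕ → ∀ i, A i) : ℝ :=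
  if (algState G I σ α t).start = t₀ ∧ ¬ VisitedBefore σ i x (t₀ + I.d) t then 1 else 0

/-- The probability that player `i` is at `x` after `m` further steps of its current policy. -/
noncomputable def visitProb (G : Game n S A) (ρ : Profile S A) (i : Fin n) (x : S i) (m : ℕ)
    (y : S i) : ℝ :=
  Matrix.vecMul (Pi.single y 1) (chains G ρ i ^ m) x

variable {t₀ : ℕ} {i : Fin n} {x : S i}

lemma unvisited_mem_Icc (t : ℕ) (σ : ℕ → ∀ i, S i) (α : ℕ → ∀ i, A i) :
    unvisited G I t₀ i x t σ α ∈ Set.Icc (0 : ℝ) 1 := by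
  unfold unvisited
  split_ifs <;> norm_num

lemma unvisited_dependsOnHistory (t : ℕ) : DependsOnHistory t (unvisited G I t₀ i x t) := by
  classical
  intro σ σ' α α' h1 h2
  unfold unvisited
  rw [algState_congr (σ := σ) (σ' := σ') (fun u hu => h1 u hu.le) h2]
  exact if_congr (and_congr_right fun _ => not_congr
    (visitedBefore_congr fun u hu => h1 u hu.le)) rfl rfl

/-- If a batch ended at `t`, the next one would have starting time `t`, which is larger than `t₀`.
-/
lemma algState_succ_eq_of_start {σ : ℕ → ∀ i, S i} {α : ℕ → ∀ i, A i} {t : ℕ} (ht : t₀ < t)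
    (h : (algState G I σ α (t + 1)).start = t₀) :
    algState G I σ α (t + 1) = algState G I σ α t := by
  by_cases hv : AllVisited σ ((algState G I σ α t).start + I.d) t
  · have := (algState_succ_of (G := G) (α := α) hv).2.1
    omega
  · exact algState_succ_of_not hv

lemma unvisited_succ_le {t : ℕ} (ht : t₀ < t) (σ : ℕ → ∀ i, S i) (α : ℕ → ∀ i, A i) :
    unvisited G I t₀ i x (t + 1) σ α ≤ unvisited G I t₀ i x t σ α := by
  by_cases h : (algState G I σ α (t + 1)).start = t₀ ∧ ¬ VisitedBefore σ i x (t₀ + I.d) (t + 1)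
  · have h2 : (algState G I σ α t).start = t₀ ∧ ¬ VisitedBefore σ i x (t₀ + I.d) t := by
      rw [← algState_succ_eq_of_start ht h.1]
      exact ⟨h.1, fun hc => h.2 (hc.mono t.le_succ)⟩
    unfold unvisited
    rw [if_pos h, if_pos h2]
  · have : unvisited G I t₀ i x (t + 1) σ α = 0 := if_neg h
    rw [this]
    exact (unvisited_mem_Icc t σ α).1

variable (hδ : ∀ i, 0 < I.δ i) (hρ₀ : I.ρ₀ ∈ shrunkProduct G I.δ)
  (hmax : ∀ i y, ∃ x, IsRegArgmax (shrunkPolytope G i (I.δ i)) (I.h i) y x)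

include hδ in
lemma visitProb_mem_Icc {ρ : Profile S A} (hρ : ρ ∈ shrunkProduct G I.δ) (m : ℕ) (y : S i) :
    visitProb G ρ i x m y ∈ Set.Icc (0 : ℝ) 1 := by
  have h := vecMul_mem_stdSimplex (pow_mem (chains_mem_rowStochastic hδ hρ i) m)
    (single_mem_stdSimplex' y)
  refine ⟨h.1 x, ?_⟩
  rw [← h.2]
  exact Finset.single_le_sum (fun z _ => h.1 z) (Finset.mem_univ x)

include hδ in
-- The stationary marginal is at least `I.δ i` at every state, and after `m` steps the law is within
-- 2 e^{-m/τ} of it in ℓ¹.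
lemma le_visitProb {τ : ℝ} (hG : UniformlyErgodic G τ) {ρ : Profile S A}
    (hρ : ρ ∈ shrunkProduct G I.δ) (m : ℕ) (y : S i) :
    I.δ i - 2 * Real.exp (-(m / τ)) ≤ visitProb G ρ i x m y := by
  have hν := stateMarginal_mem_stdSimplex (hρ i).1
  have h1 := sum_abs_vecMul_pow_sub_le hG (policyOf_stationary (hδ i) (hρ i))
    (single_mem_stdSimplex' y) hν m
  rw [stateMarginal_vecMul_pow (hδ i) (hρ i)] at h1
  have h2 := (Finset.single_le_sum (f := fun s => |Matrix.vecMul (Pi.single y 1)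
    (inducedChain G i (policyOf (ρ i)) ^ m) s - stateMarginal (ρ i) s|)
    (fun _ _ => abs_nonneg _) (Finset.mem_univ x)).trans h1
  have h3 := mul_le_mul_of_nonneg_left (sum_abs_sub_le_two (single_mem_stdSimplex' y) hν)
    (Real.exp_pos (-(m / τ))).le
  have h4 := le_stateMarginal (hρ i) x
  have h5 := neg_abs_le (Matrix.vecMul (Pi.single y 1)
    (inducedChain G i (policyOf (ρ i)) ^ m) x - stateMarginal (ρ i) x)
  unfold visitProb chains
  linarith

variable {Ω : Type*} [MeasurableSpace Ω] {μ : Measure Ω} [IsProbabilityMeasure μ]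
  {s : ℕ → Ω → ∀ i, S i} {a : ℕ → Ω → ∀ i, A i} (hrun : IsRun G I μ s a)

include hδ hρ₀ hmax hrun

/-- If the batch is running with `x` unvisited and the current policy would lead to `x` in `m`
steps, then within `m + 1` steps `x` is visited or the batch ends. Either way the indicator drops,
so the drop of its mean dominates the probability of the visit. The induction on `m` follows the
chain by one step. -/
lemma integral_unvisited_mul_visitProb_le (m : ℕ) {t : ℕ} (ht : t₀ + I.d < t) :
    ∫ ω, unvisited G I t₀ i x t (fun u => s u ω) (fun u => a u ω) *
        visitProb G (algState G I (fun u => s u ω) (fun u => a u ω) t).ρ i x m (s t ω i) ∂μ ≤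
      ∫ ω, unvisited G I t₀ i x t (fun u => s u ω) (fun u => a u ω) ∂μ -
        ∫ ω, unvisited G I t₀ i x (t + m + 1) (fun u => s u ω) (fun u => a u ω) ∂μ := by
  have hlaw := hrun.hasPathLaw
  have hUd : ∀ t, DependsOnHistory t (unvisited G I t₀ i x t) := unvisited_dependsOnHistory
  have hUi : ∀ t, Integrable
      (fun ω => unvisited G I t₀ i x t (fun u => s u ω) (fun u => a u ω)) μ :=
    fun t => hlaw.integrable (hUd t)
  have hstate : ∀ t, DependsOnHistory (Y := ∀ i, A i) t fun (σ : ℕ → ∀ i, S i) _ => σ t :=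
    fun t σ σ' α α' h1 h2 => h1 t le_rfl
  have hVd : ∀ m t, DependsOnHistory t fun σ α => unvisited G I t₀ i x t σ α *
      visitProb G (algState G I σ α t).ρ i x m (σ t i) := fun m t =>
    (hUd t).comp₂ ((algState_dependsOnHistory t).comp₂ (hstate t) fun c z =>
      visitProb G c.ρ i x m (z i)) fun p q => p * q
  induction m generalizing t with
  | zero =>
    rw [← integral_sub (hUi t) (hUi (t + 0 + 1))]
    refine integral_mono (hlaw.integrable (hVd 0 t)) ((hUi t).sub (hUi (t + 0 + 1))) fun ω => ?_
    set σ : ℕ → ∀ i, S i := fun u => s u ω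
    set α : ℕ → ∀ i, A i := fun u => a u ω
    change unvisited G I t₀ i x t σ α * visitProb G (algState G I σ α t).ρ i x 0 (σ t i) ≤
      unvisited G I t₀ i x t σ α - unvisited G I t₀ i x (t + 1) σ α
    have hle := unvisited_succ_le (G := G) (I := I) (i := i) (x := x) (t₀ := t₀) (t := t)
      (by omega) σ α
    unfold visitProb
    rw [pow_zero, Matrix.vecMul_one]
    by_cases hx : σ t i = x
    · have h0 : unvisited G I t₀ i x (t + 1) σ α = 0 :=
        if_neg fun hc => hc.2 (visitedBefore_succ.mpr (Or.inr ⟨ht.le, hx⟩))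
      rw [h0, hx, Pi.single_eq_same]
      linarith
    · rw [Pi.single_eq_of_ne (Ne.symm hx)]
      linarith
  | succ m ih =>
    have hFd : DependsOnHistory (t + 1) fun σ α => unvisited G I t₀ i x t σ α *
        visitProb G (algState G I σ α t).ρ i x m (σ (t + 1) i) :=
      ((hUd t).mono t.le_succ).comp₂ (((algState_dependsOnHistory t).mono t.le_succ).comp₂
        (hstate (t + 1)) fun c z => visitProb G c.ρ i x m (z i)) fun p q => p * q
    have hstep : ∀ σ α, stepMean (stepWeight G I) t (fun σ α => unvisited G I t₀ i x t σ α *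
        visitProb G (algState G I σ α t).ρ i x m (σ (t + 1) i)) σ α =
        unvisited G I t₀ i x t σ α *
          visitProb G (algState G I σ α t).ρ i x (m + 1) (σ t i) := by
      intro σ α
      have hρ := algState_mem hρ₀ hmax σ α t
      rw [HasPathLaw.stepMean_mul_left (hUd t)]
      congr 1
      have h1 : ∀ b y, stepTo (fun (σ : ℕ → ∀ i, S i) (α : ℕ → ∀ i, A i) =>
          visitProb G (algState G I σ α t).ρ i x m (σ (t + 1) i)) t σ α b y =
          visitProb G (algState G I σ α t).ρ i x m (y i) := by
        intro b y
        unfold stepTo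
        beta_reduce
        rw [Function.update_self, algState_congr (σ := Function.update σ (t + 1) y) (σ' := σ)
          (α := Function.update α t b) (α' := α) (fun u hu => Function.update_of_ne (by omega) _ _)
          fun u hu => Function.update_of_ne (by omega) _ _]
      unfold stepMean stepWeight
      simp_rw [h1]
      rw [sum_step_state hδ hρ (σ t) fun y => visitProb G (algState G I σ α t).ρ i x m (y i)]
      rw [sum_prod_mul_apply (fun j => vecMul_mem_stdSimplex (chains_mem_rowStochastic hδ hρ j)
        (single_mem_stdSimplex' _)) i fun y => visitProb G (algState G I σ α t).ρ i x m y]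
      unfold visitProb
      rw [pow_succ', ← Matrix.vecMul_vecMul]
      simp only [Matrix.single_one_vecMul]
      rfl
    have h2 : ∫ ω, unvisited G I t₀ i x t (fun u => s u ω) (fun u => a u ω) *
        visitProb G (algState G I (fun u => s u ω) (fun u => a u ω) t).ρ i x (m + 1)
          (s t ω i) ∂μ =
        ∫ ω, unvisited G I t₀ i x t (fun u => s u ω) (fun u => a u ω) *
          visitProb G (algState G I (fun u => s u ω) (fun u => a u ω) t).ρ i x m
            (s (t + 1) ω i) ∂μ := by
      rw [← hlaw.integral_stepMean hFd]
      simp_rw [hstep]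
    rw [h2]
    -- If the indicator survives, the policies are unchanged. Otherwise its drop equals its old
    -- value and pays for the visit probability, which is at most one.
    have h3 : ∫ ω, unvisited G I t₀ i x t (fun u => s u ω) (fun u => a u ω) *
          visitProb G (algState G I (fun u => s u ω) (fun u => a u ω) t).ρ i x m
            (s (t + 1) ω i) ∂μ ≤
        ∫ ω, (unvisited G I t₀ i x (t + 1) (fun u => s u ω) (fun u => a u ω) *
          visitProb G (algState G I (fun u => s u ω) (fun u => a u ω) (t + 1)).ρ i x m
            (s (t + 1) ω i) +
          (unvisited G I t₀ i x t (fun u => s u ω) (fun u => a u ω) -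
            unvisited G I t₀ i x (t + 1) (fun u => s u ω) (fun u => a u ω))) ∂μ := by
      refine integral_mono (hlaw.integrable hFd)
        ((hlaw.integrable (hVd m (t + 1))).add ((hUi t).sub (hUi (t + 1)))) fun ω => ?_
      set σ : ℕ → ∀ i, S i := fun u => s u ω
      set α : ℕ → ∀ i, A i := fun u => a u ω
      change unvisited G I t₀ i x t σ α *
          visitProb G (algState G I σ α t).ρ i x m (σ (t + 1) i) ≤
        unvisited G I t₀ i x (t + 1) σ α *
          visitProb G (algState G I σ α (t + 1)).ρ i x m (σ (t + 1) i) +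
          (unvisited G I t₀ i x t σ α - unvisited G I t₀ i x (t + 1) σ α)
      have hle := unvisited_succ_le (G := G) (I := I) (i := i) (x := x) (t₀ := t₀) (t := t)
        (by omega) σ α
      have hU := unvisited_mem_Icc (G := G) (I := I) (i := i) (x := x) (t₀ := t₀) t σ α
      by_cases hc : (algState G I σ α (t + 1)).start = t₀ ∧
          ¬ VisitedBefore σ i x (t₀ + I.d) (t + 1)
      · have h1 : unvisited G I t₀ i x (t + 1) σ α = 1 := if_pos hc
        have h2 : unvisited G I t₀ i x t σ α = 1 := le_antisymm hU.2 (h1 ▸ hle)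
        rw [h1, h2, algState_succ_eq_of_start (by omega) hc.1]
        linarith
      · have h1 : unvisited G I t₀ i x (t + 1) σ α = 0 := if_neg hc
        rw [h1]
        have := mul_le_of_le_one_right hU.1 (visitProb_mem_Icc (i := i) (x := x) hδ
          (algState_mem hρ₀ hmax σ α t) m (σ (t + 1) i)).2
        linarith
    refine h3.trans ?_
    have h5 := integral_add (hlaw.integrable (hVd m (t + 1))) ((hUi t).sub (hUi (t + 1)))
    simp only [Pi.sub_apply] at h5
    rw [h5, integral_sub (hUi t) (hUi (t + 1))]
    have h4 := ih (t := t + 1) (by omega)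
    rw [show t + (m + 1) + 1 = t + 1 + m + 1 by ring]
    linarith

/-- Almost surely, a batch does not run forever without a visit of player `i` to `x`. -/
lemma ae_exists_visit {τ : ℝ} (hτ : 0 < τ) (hG : UniformlyErgodic G τ) (t₀ : ℕ) (i : Fin n)
    (x : S i) (T : ℕ) (hT : t₀ + I.d < T) :
    ∀ᵐ ω ∂μ, ∃ t ≥ T, ¬ ((algState G I (fun u => s u ω) (fun u => a u ω) t).start = t₀ ∧
      ¬ VisitedBefore (fun u => s u ω) i x (t₀ + I.d) t) := by
  have hlaw := hrun.hasPathLaw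
  set E : ℕ → ℝ := fun t => ∫ ω, unvisited G I t₀ i x t (fun u => s u ω) (fun u => a u ω) ∂μ with hE
  have hUi : ∀ t, Integrable
      (fun ω => unvisited G I t₀ i x t (fun u => s u ω) (fun u => a u ω)) μ :=
    fun t => hlaw.integrable (unvisited_dependsOnHistory t)
  have hE1 : ∀ t, E t ≤ 1 := fun t => by
    have := integral_mono (hUi t) (integrable_const (1 : ℝ)) fun ω => (unvisited_mem_Icc t _ _).2
    simpa using this
  -- After `m` steps every state is visited with probability at least `I.δ i / 2`, whatever the
  -- policy and the starting state. Hence the mean of the indicator decays geometrically along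
  -- blocks of length `m + 1`.
  obtain ⟨m, hm⟩ : ∃ m : ℕ, 2 * Real.exp (-(m / τ)) ≤ I.δ i / 2 := by
    have : Filter.Tendsto (fun m : ℕ => 2 * Real.exp (-(m / τ))) Filter.atTop (nhds (2 * 0)) := by
      refine Filter.Tendsto.const_mul _ (Real.tendsto_exp_neg_atTop_nhds_zero.comp ?_)
      exact tendsto_natCast_atTop_atTop.atTop_div_const hτ
    rw [mul_zero] at this
    exact ((this.eventually (ge_mem_nhds (half_pos (hδ i)))).exists)
  set β := I.δ i / 2 with hβ
  have hβ0 : 0 < β := half_pos (hδ i)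
  have hdec : ∀ t, t₀ + I.d < t → E (t + m + 1) ≤ (1 - β) * E t := by
    intro t ht
    have h1 := integral_unvisited_mul_visitProb_le (i := i) (x := x) hδ hρ₀ hmax hrun m ht
    have h2 : ∫ ω, unvisited G I t₀ i x t (fun u => s u ω) (fun u => a u ω) * β ∂μ ≤
        ∫ ω, unvisited G I t₀ i x t (fun u => s u ω) (fun u => a u ω) *
          visitProb G (algState G I (fun u => s u ω) (fun u => a u ω) t).ρ i x m (s t ω i) ∂μ := by
      refine integral_mono ((hUi t).mul_const β) (hlaw.integrable (F := fun σ α =>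
        unvisited G I t₀ i x t σ α * visitProb G (algState G I σ α t).ρ i x m (σ t i)) (t := t) ?_)
        fun ω => ?_
      · intro σ σ' α α' p q
        beta_reduce
        rw [unvisited_dependsOnHistory t σ σ' α α' p q,
          algState_congr (σ := σ) (σ' := σ') (fun u hu => p u hu.le) q, p t le_rfl]
      · refine mul_le_mul_of_nonneg_left ?_ (unvisited_mem_Icc t _ _).1
        have := le_visitProb (i := i) (x := x) hδ hG (algState_mem hρ₀ hmax
          (fun u => s u ω) (fun u => a u ω) t) m (s t ω i)
        linarith
    rw [integral_mul_const] at h2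
    simp only [hE]
    linarith
  by_cases hβ1 : β ≤ 1
  · have hgeo : ∀ k : ℕ, E (T + k * (m + 1)) ≤ (1 - β) ^ k := by
      intro k
      induction k with
      | zero => simpa using hE1 T
      | succ k ih =>
        have h := hdec (T + k * (m + 1)) (by omega)
        rw [show T + (k + 1) * (m + 1) = T + k * (m + 1) + m + 1 by ring, pow_succ']
        exact h.trans (mul_le_mul_of_nonneg_left ih (by linarith))
    rw [ae_iff]
    set B := {ω | ¬ ∃ t ≥ T, ¬ ((algState G I (fun u => s u ω) (fun u => a u ω) t).start = t₀ ∧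
      ¬ VisitedBefore (fun u => s u ω) i x (t₀ + I.d) t)} with hB
    have hBle : ∀ k : ℕ, μ.real B ≤ (1 - β) ^ k := by
      intro k
      refine le_trans ?_ (hgeo k)
      have h1 := mul_meas_ge_le_integral_of_nonneg (μ := μ)
        (Filter.Eventually.of_forall fun ω =>
          (unvisited_mem_Icc (G := G) (I := I) (t₀ := t₀) (i := i) (x := x) (T + k * (m + 1))
            (fun u => s u ω) (fun u => a u ω)).1) (hUi (T + k * (m + 1))) 1
      rw [one_mul] at h1
      refine le_trans (measureReal_mono ?_) h1
      intro ω hω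
      have hω' : ¬ ∃ t ≥ T, ¬ ((algState G I (fun u => s u ω) (fun u => a u ω) t).start = t₀ ∧
        ¬ VisitedBefore (fun u => s u ω) i x (t₀ + I.d) t) := hω
      push Not at hω'
      have h2 := hω' (T + k * (m + 1)) (by omega)
      exact (show unvisited G I t₀ i x (T + k * (m + 1)) (fun u => s u ω) (fun u => a u ω) = 1
        from if_pos h2).ge
    have hlim := tendsto_pow_atTop_nhds_zero_of_lt_one (r := 1 - β) (by linarith) (by linarith)
    have h0 : μ.real B ≤ 0 := ge_of_tendsto' hlim hBle
    exact (measureReal_eq_zero_iff).mp (le_antisymm h0 measureReal_nonneg)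
  -- This case cannot occur: a coordinate of the initial occupation measure is at least `I.δ i` and
  -- at most 1.
  · exfalso
    obtain ⟨s₀, a₀⟩ := (nonempty_of_mem_occPolytope (hρ₀ i).1)
    have h1 := (hρ₀ i).2 (s₀, a₀)
    have h2 : I.ρ₀ i (s₀, a₀) ≤ 1 := by
      have h3 := (hρ₀ i).1.2.2
      rw [← Fintype.sum_prod_type' (f := fun s a => I.ρ₀ i (s, a))] at h3
      rw [← h3]
      exact Finset.single_le_sum (f := fun q : S i × A i => I.ρ₀ i (q.1, q.2))
        (fun q _ => (hρ₀ i).1.1 _) (Finset.mem_univ (s₀, a₀))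
    linarith [hδ i]

/-- If some batch never ended, the algorithm state would be constant from then on, with a fixed
starting time. Off a countable union of null sets, each player then visits each of its states in the
sampling period; there are finitely many of them, so the batch ends after all. -/
theorem ae_forall_exists_batch {τ : ℝ} (hτ : 0 < τ) (hG : UniformlyErgodic G τ) :
    ∀ᵐ ω ∂μ, ∀ k, ∃ t, (algState G I (fun u => s u ω) (fun u => a u ω) t).batch = k := by
  have h : ∀ᵐ ω ∂μ, ∀ (t₀ : ℕ) (i : Fin n) (x : S i) (T : ℕ), t₀ + I.d < T →
      ∃ t ≥ T, ¬ ((algState G I (fun u => s u ω) (fun u => a u ω) t).start = t₀ ∧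
        ¬ VisitedBefore (fun u => s u ω) i x (t₀ + I.d) t) := by
    rw [ae_all_iff]; intro t₀
    rw [ae_all_iff]; intro i
    rw [ae_all_iff]; intro x
    rw [ae_all_iff]; intro T
    by_cases hT : t₀ + I.d < T
    · filter_upwards [ae_exists_visit hδ hρ₀ hmax hrun hτ hG t₀ i x T hT] with ω hω _ using hω
    · exact Filter.Eventually.of_forall fun ω hc => absurd hc hT
  filter_upwards [h] with ω hω
  set σ : ℕ → ∀ i, S i := fun u => s u ω
  set α : ℕ → ∀ i, A i := fun u => a u ω
  intro k
  induction k with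
  | zero => exact ⟨0, rfl⟩
  | succ k ih =>
    obtain ⟨t, ht⟩ := ih
    by_contra hcon
    push Not at hcon
    have hconst : ∀ r, algState G I σ α (t + r) = algState G I σ α t := by
      intro r
      induction r with
      | zero => rfl
      | succ r ihr =>
        rw [← ihr]
        refine algState_succ_of_not fun hv => hcon (t + r + 1) ?_
        exact (algState_succ_of hv).1.trans (by rw [← ht, ← ihr]; rfl)
    set t₀ := (algState G I σ α t).start
    have hall : ∀ q : Σ i, S i, ∃ v ≥ t + t₀ + I.d + 1, VisitedBefore σ q.1 q.2 (t₀ + I.d) v := by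
      rintro ⟨i, x⟩
      obtain ⟨v, hv, hnot⟩ := hω t₀ i x (t + t₀ + I.d + 1) (by omega)
      refine ⟨v, hv, ?_⟩
      obtain ⟨r, rfl⟩ := Nat.exists_eq_add_of_le (show t ≤ v by omega)
      by_contra hc
      exact hnot ⟨by rw [hconst r], hc⟩
    choose v hv hvis using hall
    -- A common time by which all the required visits have occurred.
    set V := t + Finset.univ.sup v
    have hAll : AllVisited σ ((algState G I σ α V).start + I.d) V := by
      intro i x
      rw [hconst]
      obtain ⟨u, hu, hx⟩ := hvis ⟨i, x⟩
      rw [Finset.mem_Ico] at hu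
      have := Finset.le_sup (f := v) (Finset.mem_univ ⟨i, x⟩)
      exact ⟨u, Finset.mem_Icc.mpr ⟨hu.1, by omega⟩, hx⟩
    refine hcon (V + 1) ?_
    rw [(algState_succ_of hAll).1, hconst, ht]

end BatchesEnd

end ChainGame

namespace ChainGame

/-! ### Regret of dual averaging with a strongly convex regularizer. -/

section DualAveraging

variable {E : Type*} [NormedAddCommGroup E] [InnerProductSpace ℝ E] {X : Set E} {h : E → ℝ} {K : ℝ}

/-- The maximizer `x` is compared with c z + (1 - c) x. Strong convexity gives the quadratic term;
divide by `c` and let `c` tend to 0. -/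
lemma IsRegArgmax.add_sq_le (hh : StrongConvexOn X K h) {y x z : E} (hx : IsRegArgmax X h y x)
    (hz : z ∈ X) :
    inner ℝ z y - h z + K / 2 * ‖z - x‖ ^ 2 ≤ inner ℝ x y - h x := by
  have key : ∀ c : ℝ, 0 < c → c < 1 →
      inner ℝ z y - h z + (1 - c) * (K / 2 * ‖z - x‖ ^ 2) ≤ inner ℝ x y - h x := by
    intro c hc0 hc1
    have h1 := hh.2 hz hx.1 hc0.le (by linarith : 0 ≤ 1 - c) (by ring)
    have h2 := hx.2 _ (hh.1 hz hx.1 hc0.le (by linarith : 0 ≤ 1 - c) (by ring))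
    rw [inner_add_left, real_inner_smul_left, real_inner_smul_left] at h2
    simp only [smul_eq_mul] at h1
    have h3 : c * (inner ℝ z y - h z + (1 - c) * (K / 2 * ‖z - x‖ ^ 2)) ≤
        c * (inner ℝ x y - h x) := by
      nlinarith
    exact le_of_mul_le_mul_left h3 hc0
  have hlim : Filter.Tendsto
      (fun c : ℝ => inner ℝ z y - h z + (1 - c) * (K / 2 * ‖z - x‖ ^ 2))
      (nhdsWithin 0 (Set.Ioi 0))
      (nhds (inner ℝ z y - h z + (1 - 0) * (K / 2 * ‖z - x‖ ^ 2))) := by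
    refine Filter.Tendsto.mono_left ?_ nhdsWithin_le_nhds
    exact (Continuous.tendsto (by fun_prop) 0)
  rw [sub_zero, one_mul] at hlim
  refine le_of_tendsto hlim ?_
  filter_upwards [Ioo_mem_nhdsGT (show (0 : ℝ) < 1 by norm_num)] with c hc
  exact key c hc.1 hc.2

/-- Smoothness of the convex conjugate: the quadratic loss from moving away from `x` absorbs the
linear gain ⟨x' - x, g⟩ by completing the square. -/
lemma IsRegArgmax.value_add_le (hh : StrongConvexOn X K h) (hK : 0 < K) {y g x x' : E}
    (hx : IsRegArgmax X h y x) (hx' : IsRegArgmax X h (y + g) x') :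
    inner ℝ x' (y + g) - h x' ≤ inner ℝ x y - h x + inner ℝ x g + ‖g‖ ^ 2 / (2 * K) := by
  have h1 := hx.add_sq_le hh hx'.1
  have h2 : inner ℝ (x' - x) g ≤ ‖x' - x‖ * ‖g‖ := real_inner_le_norm _ _
  have h3 : ‖x' - x‖ * ‖g‖ ≤ K / 2 * ‖x' - x‖ ^ 2 + ‖g‖ ^ 2 / (2 * K) := by
    have h4 : K / 2 * ‖x' - x‖ ^ 2 + ‖g‖ ^ 2 / (2 * K) - ‖x' - x‖ * ‖g‖ =
        (K * ‖x' - x‖ - ‖g‖) ^ 2 / (2 * K) := by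
      field_simp
      ring
    have h5 : 0 ≤ (K * ‖x' - x‖ - ‖g‖) ^ 2 / (2 * K) := by positivity
    linarith
  rw [inner_add_right]
  rw [inner_sub_left] at h2
  linarith

/-- The regret of dual averaging. -/
lemma dualAveraging_regret (hh : StrongConvexOn X K h) (hK : 0 < K) {y x g : ℕ → E} {η : ℕ → ℝ}
    (hx : ∀ k, 1 ≤ k → IsRegArgmax X h (y k) (x k)) (hy : ∀ k, y (k + 1) = y k + η k • g k)
    {c : ℝ} (hg : ∀ k, ‖g k‖ ^ 2 ≤ c) (hη : Summable fun l => η l ^ 2) {θ : E} (hθ : θ ∈ X) :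
    ∃ C, ∀ k, ∑ l ∈ Finset.Icc 1 k, η l * inner ℝ (θ - x l) (g l) ≤ C := by
  have hc : 0 ≤ c := (sq_nonneg _).trans (hg 0)
  -- The conjugate value minus ⟨θ, y⟩ serves as potential. It starts at index 1, because the initial
  -- point need not be an argmax.
  have key : ∀ k, inner ℝ (x (k + 1)) (y (k + 1)) - h (x (k + 1)) +
      ∑ l ∈ Finset.Icc 1 k, η l * inner ℝ (θ - x l) (g l) - inner ℝ θ (y (k + 1)) ≤
      inner ℝ (x 1) (y 1) - h (x 1) - inner ℝ θ (y 1) +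
        c / (2 * K) * ∑ l ∈ Finset.Icc 1 k, η l ^ 2 := by
    intro k
    induction k with
    | zero => simp
    | succ k ih =>
      have h2 := hx (k + 1 + 1) (by omega)
      rw [hy (k + 1)] at h2
      have h1 := (hx (k + 1) (by omega)).value_add_le hh hK h2
      rw [Finset.sum_Icc_succ_top (by omega), Finset.sum_Icc_succ_top (by omega), hy (k + 1)]
      rw [norm_smul, mul_pow, real_inner_smul_right, Real.norm_eq_abs, sq_abs] at h1
      have h3 : η (k + 1) ^ 2 * ‖g (k + 1)‖ ^ 2 / (2 * K) ≤ c / (2 * K) * η (k + 1) ^ 2 := by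
        rw [div_mul_eq_mul_div, mul_comm c]
        have := hg (k + 1)
        gcongr
      have h4 : inner ℝ θ (y (k + 1) + η (k + 1) • g (k + 1)) =
          inner ℝ θ (y (k + 1)) + η (k + 1) * inner ℝ θ (g (k + 1)) := by
        rw [inner_add_right, real_inner_smul_right]
      rw [h4, inner_sub_left]
      linarith
  refine ⟨inner ℝ (x 1) (y 1) - h (x 1) - inner ℝ θ (y 1) + h θ +
    c / (2 * K) * ∑' l, η l ^ 2, fun k => ?_⟩
  have h1 := (hx (k + 1) (by omega)).2 θ hθ
  have h2 : c / (2 * K) * ∑ l ∈ Finset.Icc 1 k, η l ^ 2 ≤ c / (2 * K) * ∑' l, η l ^ 2 :=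
    mul_le_mul_of_nonneg_left (hη.sum_le_tsum _ fun _ _ => sq_nonneg _) (by positivity)
  linarith [key k]

end DualAveraging

/-! ### From times to batches. -/

section Batches

variable {n : ℕ} {S A : Fin n → Type*} [∀ i, Fintype (S i)] [∀ i, Fintype (A i)]
  [∀ i, DecidableEq (S i)] [∀ i, DecidableEq (A i)] {G : Game n S A} {I : Input S A}
  {σ : ℕ → ∀ i, S i} {α : ℕ → ∀ i, A i}

/-- The time at which batch `k` takes over. -/
noncomputable def batchTime (G : Game n S A) (I : Input S A) (σ : ℕ → ∀ i, S i) (α : ℕ → ∀ i, A i)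
    (k : ℕ) : ℕ :=
  sInf {t | (algState G I σ α t).batch = k}

lemma batch_monotone : Monotone fun t => (algState G I σ α t).batch := by
  refine monotone_nat_of_le_succ fun t => ?_
  by_cases hv : AllVisited σ ((algState G I σ α t).start + I.d) t
  · rw [(algState_succ_of hv).1]
    omega
  · rw [algState_succ_of_not hv]

lemma algState_eq_of_batch_eq {t t' : ℕ} (h : t ≤ t')
    (hb : (algState G I σ α t').batch = (algState G I σ α t).batch) :
    algState G I σ α t' = algState G I σ α t := by
  induction t', h using Nat.le_induction with
  | base => rfl
  | succ t' h ih =>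
    have h1 : (algState G I σ α t).batch ≤ (algState G I σ α t').batch := batch_monotone h
    by_cases hv : AllVisited σ ((algState G I σ α t').start + I.d) t'
    · rw [(algState_succ_of hv).1] at hb
      omega
    · rw [algState_succ_of_not hv] at hb ⊢
      exact ih hb

/-- The first visit to `x` determines the coordinates of the estimator at `x`. -/
lemma estimator_apply {i : Fin n} {c e : ℕ} (hv : AllVisited σ c e) (ρ : Occ S A i) (x : S i) :
    ∃ u ∈ Finset.Icc c e, σ u i = x ∧ ¬ VisitedBefore σ i x c u ∧
      ∀ b, estimator G σ α i ρ c e (x, b) =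
        if α u i = b then G.r i (σ u) (α u) / policyOf ρ x b else 0 := by
  classical
  have hex : ∃ u, u ∈ Finset.Icc c e ∧ σ u i = x := hv i x
  obtain ⟨hu, hux⟩ := Nat.find_spec hex
  have hmin := fun m => Nat.find_min hex (m := m)
  set u := Nat.find hex
  rw [Finset.mem_Icc] at hu
  have hnot : ∀ v, c ≤ v → v < u → σ v i ≠ x := fun v h1 h2 h3 =>
    hmin v h2 ⟨Finset.mem_Icc.mpr ⟨h1, by omega⟩, h3⟩
  refine ⟨u, Finset.mem_Icc.mpr hu, hux, ?_, fun b => ?_⟩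
  · rintro ⟨v, hv, hvx⟩
    rw [Finset.mem_Ico] at hv
    exact hnot v hv.1 hv.2 hvx
  · have hfirst : FirstVisit σ i c u := by
      intro v hv
      rw [Finset.mem_Ico] at hv
      rw [hux]
      exact hnot v hv.1 hv.2
    unfold estimator
    rw [WithLp.ofLp_sum, Finset.sum_apply, Finset.sum_eq_single u]
    · rw [if_pos hfirst, hux]
      by_cases hb : α u i = b
      · subst hb
        simp
      · simp [hb, Ne.symm hb]
    · intro v hv hvu
      rw [Finset.mem_Icc] at hv
      by_cases hf : FirstVisit σ i c v
      · rw [if_pos hf]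
        have hvx : σ v i ≠ x := by
          intro hvx
          rcases lt_or_gt_of_ne hvu with h | h
          · exact hnot v hv.1 h hvx
          · exact hf u (Finset.mem_Ico.mpr ⟨hu.1, h⟩) (hux.trans hvx.symm)
        simp [hvx.symm]
      · rw [if_neg hf]
        rfl
    · intro h
      exact absurd (Finset.mem_Icc.mpr hu) h

lemma norm_estimator_sq_le {i : Fin n} {δ : ℝ} (hδ : 0 < δ) {ρ : Occ S A i}
    (hρ : ρ ∈ shrunkPolytope G i δ) {c e : ℕ} (hv : AllVisited σ c e) :
    ‖estimator G σ α i ρ c e‖ ^ 2 ≤ Fintype.card (S i × A i) * (1 / δ) ^ 2 := by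
  rw [EuclideanSpace.norm_sq_eq]
  have h : ∀ q : S i × A i, ‖estimator G σ α i ρ c e q‖ ^ 2 ≤ (1 / δ) ^ 2 := by
    rintro ⟨x, b⟩
    obtain ⟨u, -, -, -, hR⟩ := estimator_apply (G := G) (α := α) hv ρ x
    rw [hR b]
    refine pow_le_pow_left₀ (norm_nonneg _) ?_ 2
    split_ifs
    · have hp := le_policyOf hδ hρ x b
      have hr := G.r_mem i (σ u) (α u)
      rw [Real.norm_eq_abs, abs_of_nonneg (div_nonneg hr.1 (hδ.le.trans hp))]
      exact div_le_div₀ zero_le_one hr.2 hδ hp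
    · rw [norm_zero]
      positivity
  refine (Finset.sum_le_sum fun q _ => h q).trans_eq ?_
  rw [Finset.sum_const, nsmul_eq_mul, Finset.card_univ]

variable (hend : ∀ k, ∃ t, (algState G I σ α t).batch = k)

include hend

lemma batch_batchTime (k : ℕ) : (algState G I σ α (batchTime G I σ α k)).batch = k :=
  Nat.sInf_mem (s := {t | (algState G I σ α t).batch = k}) (hend k)

lemma batchTime_lt_succ (k : ℕ) : batchTime G I σ α k < batchTime G I σ α (k + 1) := by
  by_contra h
  have h1 : (algState G I σ α (batchTime G I σ α (k + 1))).batch ≤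
      (algState G I σ α (batchTime G I σ α k)).batch := batch_monotone (not_lt.mp h)
  rw [batch_batchTime hend, batch_batchTime hend] at h1
  omega

lemma batch_eq {k t : ℕ} (h1 : batchTime G I σ α k ≤ t) (h2 : t < batchTime G I σ α (k + 1)) :
    (algState G I σ α t).batch = k := by
  have h3 : (algState G I σ α (batchTime G I σ α k)).batch ≤ (algState G I σ α t).batch :=
    batch_monotone h1
  have h4 : (algState G I σ α t).batch ≤ (algState G I σ α (batchTime G I σ α (k + 1))).batch :=
    batch_monotone h2.le
  have h5 : (algState G I σ α t).batch ≠ k + 1 := 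
    Nat.notMem_of_lt_sInf (s := {t | (algState G I σ α t).batch = k + 1}) h2
  rw [batch_batchTime hend] at h3 h4
  omega

lemma algState_eq {k t : ℕ} (h1 : batchTime G I σ α k ≤ t)
    (h2 : t < batchTime G I σ α (k + 1)) :
    algState G I σ α t = algState G I σ α (batchTime G I σ α k) :=
  algState_eq_of_batch_eq h1 (by rw [batch_eq hend h1 h2, batch_batchTime hend])

lemma not_allVisited_of_lt {k t : ℕ} (h1 : batchTime G I σ α k ≤ t)
    (h2 : t + 1 < batchTime G I σ α (k + 1)) :
    ¬ AllVisited σ ((algState G I σ α t).start + I.d) t := by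
  intro hv
  have h3 := (algState_succ_of (G := G) (α := α) hv).1
  rw [batch_eq hend h1 (by omega), batch_eq hend (by omega) h2] at h3
  omega

/-- Batch `k` ends at the last time before batch `k + 1` takes over. -/
lemma exists_batchEnd (k : ℕ) : ∃ e, batchTime G I σ α (k + 1) = e + 1 ∧
    batchTime G I σ α k ≤ e ∧
    algState G I σ α e = algState G I σ α (batchTime G I σ α k) ∧
    AllVisited σ ((algState G I σ α (batchTime G I σ α k)).start + I.d) e := by
  have h1 := batchTime_lt_succ hend k
  obtain ⟨e, he⟩ := Nat.exists_eq_add_of_le' (show 1 ≤ batchTime G I σ α (k + 1) by omega)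
  have h2 : batchTime G I σ α k ≤ e := by omega
  have h3 := algState_eq hend h2 (by omega)
  refine ⟨e, he, h2, h3, ?_⟩
  rw [← h3]
  by_contra hv
  have h4 := algState_succ_of_not hv
  have h5 := batch_batchTime hend (k + 1)
  rw [he, h4, h3, batch_batchTime hend] at h5
  omega

lemma batchTime_zero : batchTime G I σ α 0 = 0 :=
  Nat.sInf_eq_zero.mpr (Or.inl rfl)

/-- From its second batch on, the algorithm changes policies one step after the starting time of the
batch. Burn-in at least 1 thus ensures that every sampled action follows the policy of the batch
that uses it. -/
lemma batchTime_le_start_add (hd : 1 ≤ I.d) (k : ℕ) :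
    batchTime G I σ α k ≤ (algState G I σ α (batchTime G I σ α k)).start + I.d := by
  cases k with
  | zero =>
    rw [batchTime_zero hend]
    omega
  | succ k =>
    obtain ⟨e, he, -, h1, h2⟩ := exists_batchEnd hend k
    rw [← h1] at h2
    rw [he, (algState_succ_of h2).2.1]
    omega

/-- The gradient estimate of player `i` in batch `k`. -/
noncomputable def batchEstimate (G : Game n S A) (I : Input S A) (σ : ℕ → ∀ i, S i)
    (α : ℕ → ∀ i, A i) (i : Fin n) (k : ℕ) : Occ S A i :=
  estimator G σ α i (iterate G I σ α k i)
    ((algState G I σ α (batchTime G I σ α k)).start + I.d) (batchTime G I σ α (k + 1) - 1)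

lemma Y_succ (i : Fin n) (k : ℕ) :
    (algState G I σ α (batchTime G I σ α (k + 1))).Y i =
      (algState G I σ α (batchTime G I σ α k)).Y i + I.η k • batchEstimate G I σ α i k := by
  obtain ⟨e, he, -, h1, h2⟩ := exists_batchEnd hend k
  rw [← h1] at h2
  have h3 := congrFun (algState_succ_of h2).2.2.1 i
  have h4 := batch_batchTime hend k
  rw [he, h3, h1, h4]
  unfold batchEstimate iterate
  rw [he]
  rfl

lemma iterate_succ (i : Fin n) (k : ℕ) :
    iterate G I σ α (k + 1) i = daOracle (shrunkPolytope G i (I.δ i)) (I.h i)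
      ((algState G I σ α (batchTime G I σ α (k + 1))).Y i) := by
  obtain ⟨e, he, -, h1, h2⟩ := exists_batchEnd hend k
  rw [← h1] at h2
  have h3 := congrFun (algState_succ_of h2).2.2.2 i
  rw [← he] at h3
  exact h3

lemma norm_batchEstimate_sq_le (hδ : ∀ i, 0 < I.δ i)
    (hρ : ∀ k, iterate G I σ α k ∈ shrunkProduct G I.δ) (i : Fin n) (k : ℕ) :
    ‖batchEstimate G I σ α i k‖ ^ 2 ≤ Fintype.card (S i × A i) * (1 / I.δ i) ^ 2 := by
  obtain ⟨e, he, -, -, h2⟩ := exists_batchEnd hend k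
  refine norm_estimator_sq_le (hδ i) (hρ k i) ?_
  rw [he]
  exact h2

variable {i : Fin n} {x : S i} {b : A i} {w : Profile S A → ℝ}

/-- A finished batch samples `x` exactly once, at the first visit in its sampling period, and the
estimator has that sample in the coordinate `(x, b)`. -/
lemma sum_sampleError_batch (hd : 1 ≤ I.d) (k : ℕ) :
    ∑ u ∈ Finset.Ico (batchTime G I σ α k) (batchTime G I σ α (k + 1)),
        sampleError G I i x b w u σ α =
      I.η k * w (iterate G I σ α k) * (batchEstimate G I σ α i k (x, b) -
        payoffGrad G i (iterate G I σ α k) (x, b)) := by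
  obtain ⟨e, he, hle, h1, hv⟩ := exists_batchEnd hend k
  have hstart := batchTime_le_start_add hend hd k
  have hbatch := batch_batchTime hend k
  obtain ⟨u, hu, hux, hunot, hR⟩ := estimator_apply (G := G) (α := α) hv (iterate G I σ α k i) x
  rw [Finset.mem_Icc] at hu
  have hc : ∀ v ∈ Finset.Ico (batchTime G I σ α k) (batchTime G I σ α (k + 1)),
      algState G I σ α v = algState G I σ α (batchTime G I σ α k) := fun v hv => by
    rw [Finset.mem_Ico] at hv
    exact algState_eq hend hv.1 hv.2
  have hmem : u ∈ Finset.Ico (batchTime G I σ α k) (batchTime G I σ α (k + 1)) :=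
    Finset.mem_Ico.mpr ⟨by omega, by omega⟩
  have hb : batchEstimate G I σ α i k (x, b) =
      if α u i = b then G.r i (σ u) (α u) / policyOf (iterate G I σ α k i) x b else 0 := by
    rw [← hR b]
    unfold batchEstimate
    rw [he]
    rfl
  rw [Finset.sum_eq_single u]
  · unfold sampleError batchWeight
    have hs : SamplesAt G I i x u σ α := by
      unfold SamplesAt
      rw [hc u hmem]
      exact ⟨hu.1, hunot, hux⟩
    rw [if_pos hs, hc u hmem, hbatch, hb]
    rfl
  · intro v hv hvu
    unfold sampleError
    rw [if_neg]
    intro hs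
    unfold SamplesAt at hs
    rw [hc v hv] at hs
    rcases lt_or_gt_of_ne hvu with h | h
    · exact hunot ⟨v, Finset.mem_Ico.mpr ⟨hs.1, h⟩, hs.2.2⟩
    · exact hs.2.1 ⟨u, Finset.mem_Ico.mpr ⟨hu.1, h⟩, hux⟩
  · exact fun h => absurd hmem h

lemma sum_sampleError (hd : 1 ≤ I.d) (k : ℕ) :
    ∑ u ∈ Finset.range (batchTime G I σ α k), sampleError G I i x b w u σ α =
      ∑ l ∈ Finset.range k, I.η l * w (iterate G I σ α l) *
        (batchEstimate G I σ α i l (x, b) - payoffGrad G i (iterate G I σ α l) (x, b)) := by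
  induction k with
  | zero => simp [batchTime_zero hend]
  | succ k ih =>
    rw [Finset.sum_range_succ, ← ih, ← sum_sampleError_batch hend hd k,
      Finset.sum_range_add_sum_Ico _ (batchTime_lt_succ hend k).le]

/-- A bias arises only at the last time of a batch and is charged to the following batch. Hence the
sum starts with batch 1. -/
lemma abs_sum_batchBias_le {B : ℝ}
    (hB : ∀ t σ α, |batchBias G I i x b w t σ α| ≤ |batchWeight G I w (t + 1) σ α| * B)
    (hη : ∀ l, 0 ≤ I.η l) (k : ℕ) :
    |∑ u ∈ Finset.range (batchTime G I σ α k), batchBias G I i x b w u σ α| ≤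
      ∑ l ∈ Finset.Icc 1 k, I.η l * |w (iterate G I σ α l)| * B := by
  induction k with
  | zero => simp [batchTime_zero hend]
  | succ k ih =>
    obtain ⟨e, he, hle, h1, hv⟩ := exists_batchEnd hend k
    rw [Finset.sum_Icc_succ_top (by omega),
      ← Finset.sum_range_add_sum_Ico _ (batchTime_lt_succ hend k).le]
    refine (abs_add_le _ _).trans (add_le_add ih ?_)
    rw [Finset.sum_eq_single e]
    · refine (hB e σ α).trans_eq ?_
      unfold batchWeight
      rw [← he, batch_batchTime hend, abs_mul, abs_of_nonneg (hη _)]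
      rfl
    · intro v hv hne
      rw [Finset.mem_Ico] at hv
      exact if_neg (not_allVisited_of_lt hend hv.1 (by omega))
    · intro h
      exact absurd (Finset.mem_Ico.mpr ⟨hle, by omega⟩) h

end Batches

end ChainGame

namespace ChainGame

/-! ### The gap against a fixed comparator. -/

section Regret

open MeasureTheory

variable {n : ℕ} {S A : Fin n → Type*} [∀ i, Fintype (S i)] [∀ i, Fintype (A i)]
  [∀ i, DecidableEq (S i)] [∀ i, DecidableEq (A i)] {G : Game n S A} {I : Input S A}

lemma sum_range_succ_eq_add_sum_Icc (f : ℕ → ℝ) (k : ℕ) :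
    ∑ l ∈ Finset.range (k + 1), f l = f 0 + ∑ l ∈ Finset.Icc 1 k, f l := by
  induction k with
  | zero => simp
  | succ k ih => rw [Finset.sum_range_succ, ih, Finset.sum_Icc_succ_top (by omega), add_assoc]

lemma occ_le_one {i : Fin n} {ρ : Occ S A i} (hρ : ρ ∈ occPolytope G i) (q : S i × A i) :
    ρ q ≤ 1 := by
  have h : ∑ q, ρ q = 1 := by
    rw [Fintype.sum_prod_type]
    exact hρ.2.2
  rw [← h]
  exact Finset.single_le_sum (fun q _ => hρ.1 q) (Finset.mem_univ q)

lemma occ_mem_stdSimplex {i : Fin n} {ρ : Occ S A i} (hρ : ρ ∈ occPolytope G i) :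
    (fun q => ρ q) ∈ stdSimplex ℝ (S i × A i) :=
  ⟨hρ.1, by rw [Fintype.sum_prod_type]; exact hρ.2.2⟩

lemma abs_batchBias_le_mul (hδ : ∀ i, 0 < I.δ i) (hρ₀ : I.ρ₀ ∈ shrunkProduct G I.δ)
    (hmax : ∀ i y, ∃ x, IsRegArgmax (shrunkPolytope G i (I.δ i)) (I.h i) y x)
    {τ : ℝ} (hτ : 0 < τ) (hG : UniformlyErgodic G τ) (hd : 1 ≤ I.d) (i : Fin n) (x : S i) (b : A i)
    (w : Profile S A → ℝ) (t : ℕ) (σ : ℕ → ∀ i, S i) (α : ℕ → ∀ i, A i) :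
    |batchBias G I i x b w t σ α| ≤ |batchWeight G I w (t + 1) σ α| *
      ((∑ j, (Fintype.card (S j) : ℝ)) * Real.exp (-(I.d / τ))) := by
  unfold batchBias
  split_ifs
  · rw [abs_mul]
    exact mul_le_mul_of_nonneg_left (abs_hitValue_le hδ (algState_mem hρ₀ hmax σ α (t + 1)) hτ hG
      i x b _ _ hd) (abs_nonneg _)
  · rw [abs_zero]
    positivity

/-- For a fixed comparator, the weighted gaps are almost surely at most a constant plus the bias. -/
theorem ae_sum_nikaidoIsoda_le (hδ : ∀ i, 0 < I.δ i) (hρ₀ : I.ρ₀ ∈ shrunkProduct G I.δ)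
    {K : ℝ} (hK : 0 < K) (hh : ∀ i, StrongConvexOn (shrunkPolytope G i (I.δ i)) K (I.h i))
    (hmax : ∀ i y, ∃ x, IsRegArgmax (shrunkPolytope G i (I.δ i)) (I.h i) y x)
    (hη : ∀ l, 0 ≤ I.η l) (hη_sq : Summable fun l => I.η l ^ 2) (hd : 1 ≤ I.d)
    {τ : ℝ} (hτ : 0 < τ) (hG : UniformlyErgodic G τ) {Ω : Type*} [MeasurableSpace Ω]
    {μ : Measure Ω} [IsProbabilityMeasure μ] {s : ℕ → Ω → ∀ i, S i} {a : ℕ → Ω → ∀ i, A i}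
    (hrun : IsRun G I μ s a) {θ : Profile S A} (hθ : θ ∈ shrunkProduct G I.δ) :
    ∀ᵐ ω ∂μ, ∃ C, ∀ k,
      ∑ l ∈ Finset.Icc 1 k, I.η l *
          nikaidoIsoda G θ (iterate G I (fun u => s u ω) (fun u => a u ω) l) ≤
        C + 2 * n * ((∑ j, (Fintype.card (S j) : ℝ)) * Real.exp (-(I.d / τ))) *
          ∑ l ∈ Finset.Icc 1 k, I.η l := by
  set B := (∑ j, (Fintype.card (S j) : ℝ)) * Real.exp (-(I.d / τ)) with hBdef
  have hB0 : 0 ≤ B := by positivity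
  -- The coefficient of the estimation error is a coordinate of ρ_i - θ_i: it depends only on the
  -- iterate, so it is known when the batch starts.
  set w : ∀ i, S i × A i → Profile S A → ℝ := fun i q ρ => ρ i q - θ i q with hw
  have hw1 : ∀ i q, ∀ ρ ∈ shrunkProduct G I.δ, |w i q ρ| ≤ 1 := by
    intro i q ρ hρ
    have h1 := (hρ i).1.1 q
    have h2 := occ_le_one (hρ i).1 q
    have h3 := (hθ i).1.1 q
    have h4 := occ_le_one (hθ i).1 q
    rw [abs_le]
    constructor <;> simp only [hw] <;> linarith
  have hall : ∀ᵐ ω ∂μ, ∀ (i : Fin n) (q : S i × A i), ∃ D, ∀ t,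
      |∑ u ∈ Finset.range t,
        (sampleError G I i q.1 q.2 (w i q) u (fun u => s u ω) (fun u => a u ω) -
        batchBias G I i q.1 q.2 (w i q) u (fun u => s u ω) (fun u => a u ω))| ≤ D := by
    rw [ae_all_iff]; intro i
    rw [ae_all_iff]; intro q
    exact ae_bounded_sum_sampleError hδ hρ₀ hmax hη (hw1 i q) hη_sq hd hrun q.1 q.2
  filter_upwards [hall, ae_forall_exists_batch hδ hρ₀ hmax hrun hτ hG] with ω hD hend
  set σ : ℕ → ∀ i, S i := fun u => s u ω
  set α : ℕ → ∀ i, A i := fun u => a u ω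
  set ρ : ℕ → Profile S A := iterate G I σ α with hρdef
  have hρ : ∀ k, ρ k ∈ shrunkProduct G I.δ := fun k => algState_mem hρ₀ hmax _ _ _
  set R : ∀ i, ℕ → Occ S A i := fun i k => batchEstimate G I σ α i k with hR
  set E := ∑' l, I.η l ^ 2
  have hηE : ∀ l, I.η l ≤ 1 + E := fun l => by
    have := hη_sq.le_tsum l fun _ _ => sq_nonneg _
    nlinarith [sq_nonneg (I.η l - 1), sq_nonneg (I.η l)]
  have hnoise : ∀ i (q : S i × A i), ∃ C, ∀ k, ∑ l ∈ Finset.Icc 1 k,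
      I.η l * w i q (ρ l) * (R i l q - payoffGrad G i (ρ l) q) ≤
        C + ∑ l ∈ Finset.Icc 1 k, I.η l * |w i q (ρ l)| * B := by
    intro i q
    obtain ⟨D, hD⟩ := hD i q
    -- The constant contains the error of batch 0, which the sums over `Finset.Icc 1 k` omit, and a
    -- bound for the bias of batch `k + 1`, already charged when batch `k` ends.
    refine ⟨D - I.η 0 * w i q (ρ 0) * (R i 0 q - payoffGrad G i (ρ 0) q) + (1 + E) * B,
      fun k => ?_⟩
    have h1 := hD (batchTime G I σ α (k + 1))
    have h2 := abs_sum_batchBias_le (i := i) (x := q.1) (b := q.2) (w := w i q) hend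
      (abs_batchBias_le_mul hδ hρ₀ hmax hτ hG hd i q.1 q.2 (w i q)) hη (k + 1)
    rw [Finset.sum_sub_distrib, sum_sampleError hend hd, sum_range_succ_eq_add_sum_Icc] at h1
    rw [Finset.sum_Icc_succ_top (by omega)] at h2
    have h3 : I.η (k + 1) * |w i q (ρ (k + 1))| * B ≤ (1 + E) * B := by
      refine mul_le_mul_of_nonneg_right ?_ hB0
      exact (mul_le_of_le_one_right (hη _) (hw1 i q _ (hρ _))).trans (hηE _)
    have h4 := (le_abs_self _).trans h1
    have h5 := (le_abs_self _).trans h2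
    linarith
  choose C hC using hnoise
  have hreg : ∀ i, ∃ C, ∀ k, ∑ l ∈ Finset.Icc 1 k, I.η l * inner ℝ (θ i - ρ l i) (R i l) ≤ C := by
    intro i
    refine dualAveraging_regret (hh i) hK (y := fun k =>
      (algState G I σ α (batchTime G I σ α k)).Y i) ?_ (Y_succ hend i)
      (norm_batchEstimate_sq_le hend hδ hρ i) hη_sq (hθ i)
    intro k hk
    obtain ⟨k, rfl⟩ := Nat.exists_eq_add_of_le' hk
    rw [hρdef, iterate_succ hend]
    exact daOracle_spec (hmax i _)
  choose C' hC' using hreg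
  refine ⟨∑ i, (C' i + ∑ q, C i q), fun k => ?_⟩
  have hsplit : ∑ l ∈ Finset.Icc 1 k, I.η l * nikaidoIsoda G θ (ρ l) =
      ∑ i, (∑ l ∈ Finset.Icc 1 k, I.η l * inner ℝ (θ i - ρ l i) (R i l) +
        ∑ q, ∑ l ∈ Finset.Icc 1 k,
          I.η l * w i q (ρ l) * (R i l q - payoffGrad G i (ρ l) q)) := by
    simp_rw [nikaidoIsoda_eq, Finset.mul_sum]
    rw [Finset.sum_comm]
    refine Finset.sum_congr rfl fun i _ => ?_
    rw [Finset.sum_comm (s := (Finset.univ : Finset (S i × A i))), ← Finset.sum_add_distrib]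
    refine Finset.sum_congr rfl fun l _ => ?_
    have hin : inner ℝ (θ i - ρ l i) (R i l) = ∑ q, (θ i q - ρ l i q) * R i l q := by
      rw [PiLp.inner_apply]
      refine Finset.sum_congr rfl fun q _ => ?_
      simp [mul_comm]
    rw [hin, Finset.mul_sum, ← Finset.sum_add_distrib]
    refine Finset.sum_congr rfl fun q _ => ?_
    simp only [hw]
    ring
  have hbias : ∀ i, ∑ q, ∑ l ∈ Finset.Icc 1 k, I.η l * |w i q (ρ l)| * B ≤
      2 * B * ∑ l ∈ Finset.Icc 1 k, I.η l := by
    intro i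
    rw [Finset.sum_comm, Finset.mul_sum]
    refine Finset.sum_le_sum fun l _ => ?_
    rw [← Finset.sum_mul, ← Finset.mul_sum]
    -- The coefficients of one player add up to an ℓ¹-distance of probability vectors. So the bias
    -- costs 2 per player, independently of the number of coordinates.
    have h := sum_abs_sub_le_two (occ_mem_stdSimplex (hρ l i).1) (occ_mem_stdSimplex (hθ i).1)
    calc I.η l * (∑ q, |w i q (ρ l)|) * B ≤ I.η l * 2 * B :=
          mul_le_mul_of_nonneg_right (mul_le_mul_of_nonneg_left h (hη l)) hB0
      _ = 2 * B * I.η l := by ring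
  rw [hsplit]
  calc _ ≤ ∑ i : Fin n, ((C' i + ∑ q, C i q) + 2 * B * ∑ l ∈ Finset.Icc 1 k, I.η l) := by
        refine Finset.sum_le_sum fun i _ => ?_
        have h1 := hC' i k
        have h2 : ∑ q, ∑ l ∈ Finset.Icc 1 k,
            I.η l * w i q (ρ l) * (R i l q - payoffGrad G i (ρ l) q) ≤
            ∑ q, (C i q + ∑ l ∈ Finset.Icc 1 k, I.η l * |w i q (ρ l)| * B) :=
          Finset.sum_le_sum fun q _ => hC i q k
        rw [Finset.sum_add_distrib] at h2
        linarith [hbias i]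
    _ = _ := by
        rw [Finset.sum_add_distrib, Finset.sum_const, Finset.card_univ, Fintype.card_fin,
          nsmul_eq_mul]
        ring

end Regret

end ChainGame

namespace ChainGame

/-! ### Compactness, Lipschitz dependence on the comparator, and the burn-in length. -/

section Uniform

open MeasureTheory

variable {n : ℕ} {S A : Fin n → Type*} [∀ i, Fintype (S i)] [∀ i, Fintype (A i)]
  [∀ i, DecidableEq (S i)] [∀ i, DecidableEq (A i)] {G : Game n S A} {I : Input S A}

lemma isCompact_shrunkPolytope (i : Fin n) (δ : ℝ) : IsCompact (shrunkPolytope G i δ) := by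
  refine Metric.isCompact_of_isClosed_isBounded ?_ ?_
  · have h : shrunkPolytope G i δ = (⋂ x, {ρ : Occ S A i | 0 ≤ ρ x}) ∩
        (⋂ s', {ρ : Occ S A i |
          ∑ s, ∑ a, (G.P i s a s' - if s = s' then 1 else 0) * ρ (s, a) = 0}) ∩
        {ρ : Occ S A i | ∑ s, ∑ a, ρ (s, a) = 1} ∩ ⋂ x, {ρ : Occ S A i | δ ≤ ρ x} := by
      ext ρ
      simp [shrunkPolytope, occPolytope, and_assoc]
    rw [h]
    refine IsClosed.inter (IsClosed.inter (IsClosed.inter ?_ ?_) ?_) ?_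
    · exact isClosed_iInter fun x => isClosed_le (by fun_prop) (by fun_prop)
    · exact isClosed_iInter fun x => isClosed_eq (by fun_prop) (by fun_prop)
    · exact isClosed_eq (by fun_prop) (by fun_prop)
    · exact isClosed_iInter fun x => isClosed_le (by fun_prop) (by fun_prop)
  · refine (isBounded_iff_forall_norm_le).mpr ⟨1, fun ρ hρ => ?_⟩
    have h1 : ‖ρ‖ ^ 2 ≤ 1 := by
      rw [EuclideanSpace.norm_sq_eq, ← (occ_mem_stdSimplex hρ.1).2]
      refine Finset.sum_le_sum fun q _ => ?_
      have h2 := hρ.1.1 q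
      have h3 := occ_le_one hρ.1 q
      rw [Real.norm_eq_abs, sq_abs]
      nlinarith
    nlinarith [norm_nonneg ρ]

lemma isCompact_shrunkProduct (δ : Fin n → ℝ) : IsCompact (shrunkProduct G δ) := by
  have h : shrunkProduct G δ = Set.pi Set.univ fun i => shrunkPolytope G i (δ i) := by
    ext θ
    simp [shrunkProduct]
  rw [h]
  exact isCompact_univ_pi fun i => isCompact_shrunkPolytope i (δ i)

/-- Payoff gradients lie in [0, 1], so each player gains at most 1. This trivial bound settles the
case of burn-in 0. -/
lemma nikaidoIsoda_le {δ : Fin n → ℝ} (hδ : ∀ i, 0 < δ i) {θ ρ : Profile S A}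
    (hθ : θ ∈ shrunkProduct G δ) (hρ : ρ ∈ shrunkProduct G δ) : nikaidoIsoda G θ ρ ≤ n := by
  rw [nikaidoIsoda_eq]
  calc ∑ i, ∑ q, (θ i q - ρ i q) * payoffGrad G i ρ q ≤ ∑ i : Fin n, (1 : ℝ) := by
        refine Finset.sum_le_sum fun i _ => ?_
        rw [← (occ_mem_stdSimplex (hθ i).1).2]
        refine Finset.sum_le_sum fun q _ => ?_
        have h1 := payoffGrad_mem_Icc hδ hρ i q
        have h2 := (hθ i).1.1 q
        have h3 := (hρ i).1.1 q
        nlinarith [h1.1, h1.2, mul_nonneg h3 h1.1, mul_nonneg h2 (sub_nonneg.mpr h1.2)]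
    _ = n := by simp

/-- Ψ is affine in the comparator with coefficients in [0, 1], which gives a Lipschitz constant that
does not depend on `ρ`. -/
lemma nikaidoIsoda_sub_le {δ : Fin n → ℝ} (hδ : ∀ i, 0 < δ i) (θ θ' : Profile S A)
    {ρ : Profile S A} (hρ : ρ ∈ shrunkProduct G δ) :
    nikaidoIsoda G θ ρ - nikaidoIsoda G θ' ρ ≤
      (∑ i, (Fintype.card (S i × A i) : ℝ)) * dist θ θ' := by
  rw [nikaidoIsoda_eq, nikaidoIsoda_eq, ← Finset.sum_sub_distrib, Finset.sum_mul]
  refine Finset.sum_le_sum fun i _ => ?_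
  rw [← Finset.sum_sub_distrib]
  calc ∑ q, ((θ i q - ρ i q) * payoffGrad G i ρ q - (θ' i q - ρ i q) * payoffGrad G i ρ q)
      ≤ ∑ q : S i × A i, dist θ θ' := by
        refine Finset.sum_le_sum fun q _ => ?_
        have h1 := payoffGrad_mem_Icc hδ hρ i q
        have h2 : |θ i q - θ' i q| ≤ dist θ θ' := by
          have h3 := PiLp.norm_apply_le (θ i - θ' i) q
          rw [← dist_eq_norm (θ i)] at h3
          exact h3.trans (dist_le_pi_dist θ θ' i)
        have h4 : (θ i q - ρ i q) * payoffGrad G i ρ q - (θ' i q - ρ i q) * payoffGrad G i ρ q =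
            (θ i q - θ' i q) * payoffGrad G i ρ q := by ring
        rw [h4]
        refine (le_abs_self _).trans ?_
        rw [abs_mul, abs_of_nonneg h1.1]
        exact (mul_le_of_le_one_right (abs_nonneg _) h1.2).trans h2
    _ = _ := by rw [Finset.sum_const, Finset.card_univ, nsmul_eq_mul]

lemma averagedGap_eq (η : ℕ → ℝ) (ρ : ℕ → Profile S A) (k : ℕ) (θ : Profile S A) :
    averagedGap G η ρ k θ =
      (∑ l ∈ Finset.Icc 1 k, η l * nikaidoIsoda G θ (ρ l)) / ∑ l ∈ Finset.Icc 1 k, η l := by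
  unfold averagedGap
  rw [Finset.sum_div]
  exact Finset.sum_congr rfl fun l _ => by ring

lemma continuous_averagedGap (η : ℕ → ℝ) (ρ : ℕ → Profile S A) (k : ℕ) :
    Continuous (averagedGap G η ρ k) := by
  unfold averagedGap
  simp_rw [nikaidoIsoda_eq]
  fun_prop

/-- The bias that is left after the burn-in. -/
lemma bias_le {τ : ℝ} (hτ : 0 < τ) {ε : ℝ} (hε : 0 < ε) {d : ℕ}
    (hSA : ∀ i, Nonempty (S i × A i))
    (hd : τ * Real.log (6 * n / ε * ∑ i, (Fintype.card (A i) : ℝ) * Fintype.card (S i)) ≤ d) :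
    2 * n * ((∑ j, (Fintype.card (S j) : ℝ)) * Real.exp (-(d / τ))) ≤ ε / 3 := by
  rcases Nat.eq_zero_or_pos n with rfl | hn
  · simp only [Nat.cast_zero, mul_zero, zero_mul]
    positivity
  have hn' : (0 : ℝ) < n := by exact_mod_cast hn
  set Z := ∑ i, (Fintype.card (A i) : ℝ) * Fintype.card (S i) with hZ
  -- Action sets are nonempty, so the number of state-action pairs in the condition on `d` dominates
  -- the number of states in the bias.
  have hSZ : ∑ j, (Fintype.card (S j) : ℝ) ≤ Z := by
    refine Finset.sum_le_sum fun i _ => ?_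
    have : Nonempty (A i) := (hSA i).map Prod.snd
    have h1 : (1 : ℝ) ≤ Fintype.card (A i) := by exact_mod_cast Fintype.card_pos (α := A i)
    exact le_mul_of_one_le_left (by positivity) h1
  have hS : 0 < ∑ j, (Fintype.card (S j) : ℝ) := by
    have : Nonempty (Fin n) := ⟨⟨0, hn⟩⟩
    refine Finset.sum_pos (fun i _ => ?_) Finset.univ_nonempty
    have : Nonempty (S i) := (hSA i).map Prod.fst
    exact_mod_cast Fintype.card_pos (α := S i)
  have hZ0 : 0 < Z := hS.trans_le hSZ
  have hX : 0 < 6 * n / ε * Z := by positivity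
  have h1 : 6 * n / ε * Z ≤ Real.exp (d / τ) := by
    rw [← Real.log_le_iff_le_exp hX, le_div_iff₀ hτ]
    linarith
  have h2 : Real.exp (-(d / τ)) ≤ ε / (6 * n * Z) := by
    rw [Real.exp_neg, inv_le_comm₀ (Real.exp_pos _) (by positivity), inv_div]
    refine le_trans (le_of_eq ?_) h1
    ring
  calc 2 * n * ((∑ j, (Fintype.card (S j) : ℝ)) * Real.exp (-(d / τ)))
      ≤ 2 * n * (Z * (ε / (6 * n * Z))) := by gcongr
    _ = ε / 3 := by
        field_simp
        norm_num

/-- For a fixed comparator, the weighted gaps are almost surely at most `ε / 3` on average, up to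
a constant. -/
theorem ae_sum_nikaidoIsoda_le_third (hδ : ∀ i, 0 < I.δ i) (hρ₀ : I.ρ₀ ∈ shrunkProduct G I.δ)
    {K : ℝ} (hK : 0 < K) (hh : ∀ i, StrongConvexOn (shrunkPolytope G i (I.δ i)) K (I.h i))
    (hmax : ∀ i y, ∃ x, IsRegArgmax (shrunkPolytope G i (I.δ i)) (I.h i) y x)
    (hη : ∀ l, 0 ≤ I.η l) (hη_sq : Summable fun l => I.η l ^ 2)
    {τ : ℝ} (hτ : 0 < τ) (hG : UniformlyErgodic G τ) {ε : ℝ} (hε : 0 < ε)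
    (hd : τ * Real.log (6 * n / ε * ∑ i, (Fintype.card (A i) : ℝ) * Fintype.card (S i)) ≤ I.d)
    {Ω : Type*} [MeasurableSpace Ω]
    {μ : Measure Ω} [IsProbabilityMeasure μ] {s : ℕ → Ω → ∀ i, S i} {a : ℕ → Ω → ∀ i, A i}
    (hrun : IsRun G I μ s a) {θ : Profile S A} (hθ : θ ∈ shrunkProduct G I.δ) :
    ∀ᵐ ω ∂μ, ∃ C, ∀ k,
      ∑ l ∈ Finset.Icc 1 k, I.η l *
          nikaidoIsoda G θ (iterate G I (fun u => s u ω) (fun u => a u ω) l) ≤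
        C + ε / 3 * ∑ l ∈ Finset.Icc 1 k, I.η l := by
  have hSA : ∀ i, Nonempty (S i × A i) := fun i => nonempty_of_mem_occPolytope (hρ₀ i).1
  have hbias := bias_le hτ hε hSA hd
  rcases Nat.eq_zero_or_pos I.d with h0 | hpos
  -- With burn-in 0 the martingale argument is not available, but then the bias bound reads 2n ∑_j
  -- |S_j| ≤ ε/3, and the trivial bound Ψ ≤ n is enough.
  · refine Filter.Eventually.of_forall fun ω => ⟨0, fun k => ?_⟩
    rw [zero_add, Finset.mul_sum]
    refine Finset.sum_le_sum fun l _ => ?_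
    rw [mul_comm]
    refine mul_le_mul_of_nonneg_right ?_ (hη l)
    refine (nikaidoIsoda_le hδ hθ (algState_mem hρ₀ hmax _ _ _)).trans (le_trans ?_ hbias)
    rw [h0, Nat.cast_zero, zero_div, neg_zero, Real.exp_zero, mul_one]
    rcases Nat.eq_zero_or_pos n with rfl | hn
    · simp
    have hS : (1 : ℝ) ≤ ∑ j, (Fintype.card (S j) : ℝ) := by
      have : Nonempty (S ⟨0, hn⟩) := (hSA ⟨0, hn⟩).map Prod.fst
      have h1 : (1 : ℝ) ≤ Fintype.card (S ⟨0, hn⟩) := by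
        exact_mod_cast Fintype.card_pos (α := S ⟨0, hn⟩)
      exact h1.trans (Finset.single_le_sum (f := fun j => (Fintype.card (S j) : ℝ))
        (fun _ _ => by positivity) (Finset.mem_univ _))
    nlinarith [(Nat.cast_nonneg n : (0 : ℝ) ≤ n)]
  · filter_upwards [ae_sum_nikaidoIsoda_le hδ hρ₀ hK hh hmax hη hη_sq hpos hτ hG hrun hθ]
      with ω ⟨C, hC⟩
    refine ⟨C, fun k => (hC k).trans ?_⟩
    have := mul_le_mul_of_nonneg_right hbias
      (Finset.sum_nonneg fun l (_ : l ∈ Finset.Icc 1 k) => hη l)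
    linarith

end Uniform

end ChainGame

/-! ### Uniformity over all comparators. -/

theorem mainTheorem1 {n : ℕ} {S A : Fin n → Type*}
    [∀ i, Fintype (S i)] [∀ i, Fintype (A i)] [∀ i, DecidableEq (S i)] [∀ i, DecidableEq (A i)]
    (G : ChainGame.Game n S A) (τ : ℝ) (hτ : 0 < τ) (hG : ChainGame.UniformlyErgodic G τ)
    (I : ChainGame.Input S A)
    (hδ : ∀ i, 0 < I.δ i)
    (hρ₀ : I.ρ₀ ∈ ChainGame.shrunkProduct G I.δ)
    (K : ℝ) (hK : 0 < K)
    (hh : ∀ i, StrongConvexOn (ChainGame.shrunkPolytope G i (I.δ i)) K (I.h i))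
    (hmax : ∀ i y, ∃ x, ChainGame.IsRegArgmax (ChainGame.shrunkPolytope G i (I.δ i)) (I.h i) y x)
    (hη : ∀ l, 0 ≤ I.η l)
    (hη_sum : Filter.Tendsto (fun k => ∑ l ∈ Finset.Icc 1 k, I.η l) Filter.atTop Filter.atTop)
    (hη_sq : Summable fun l => I.η l ^ 2)
    (ε : ℝ) (hε : 0 < ε)
    (hd : τ * Real.log (6 * n / ε * ∑ i, (Fintype.card (A i) : ℝ) * Fintype.card (S i)) ≤ I.d)
    {Ω : Type*} [MeasurableSpace Ω] (μ : MeasureTheory.Measure Ω)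
    [MeasureTheory.IsProbabilityMeasure μ]
    (s : ℕ → Ω → ∀ i, S i) (a : ℕ → Ω → ∀ i, A i) (hrun : ChainGame.IsRun G I μ s a) :
    ∀ᵐ ω ∂μ,
      (∀ k, ∃ t, (ChainGame.algState G I (fun u => s u ω) (fun u => a u ω) t).batch = k) ∧
      ∃ c < ε / 2, ∀ᶠ k in Filter.atTop, ∃ M ≤ c,
        IsGreatest
          (ChainGame.averagedGap G I.η
            (ChainGame.iterate G I (fun u => s u ω) (fun u => a u ω)) k ''
              ChainGame.shrunkProduct G I.δ) M := by
  set L : ℝ := ∑ i, (Fintype.card (S i × A i) : ℝ)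
  have hL : 0 ≤ L := by positivity
  have hcompact := ChainGame.isCompact_shrunkProduct (G := G) I.δ
  -- The exceptional null set depends on the comparator, so only finitely many comparators are used.
  -- The radius makes the Lipschitz error at most ε/24.
  obtain ⟨net, hnet, hfin, hcover⟩ :=
    hcompact.finite_cover_balls (e := ε / (24 * (L + 1))) (by positivity)
  have hall : ∀ᵐ ω ∂μ, ∀ θ ∈ net, ∃ C, ∀ k,
      ∑ l ∈ Finset.Icc 1 k, I.η l * ChainGame.nikaidoIsoda G θ
          (ChainGame.iterate G I (fun u => s u ω) (fun u => a u ω) l) ≤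
        C + ε / 3 * ∑ l ∈ Finset.Icc 1 k, I.η l :=
    (MeasureTheory.ae_ball_iff hfin.countable).mpr fun θ hθ =>
      ChainGame.ae_sum_nikaidoIsoda_le_third hδ hρ₀ hK hh hmax hη hη_sq hτ hG hε hd hrun (hnet hθ)
  filter_upwards [hall, ChainGame.ae_forall_exists_batch hδ hρ₀ hmax hrun hτ hG] with ω hω hend
  -- 5/12 = 1/3 + 1/24 + 1/24: the bias, the net error, and the constants of the net points divided
  -- by the total weight.
  refine ⟨hend, 5 * ε / 12, by linarith, ?_⟩
  choose! C hC using hω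
  set D := ∑ θ ∈ hfin.toFinset, |C θ|
  -- From this weight on, the constants `C θ` of all net points cost at most ε/24 on average; the
  -- summand 1 makes the weight positive.
  filter_upwards [hη_sum.eventually_ge_atTop (24 * D / ε + 1)] with k hk
  set w := ∑ l ∈ Finset.Icc 1 k, I.η l
  have hD : 0 ≤ D := Finset.sum_nonneg fun _ _ => abs_nonneg _
  have hw : 0 < w := lt_of_lt_of_le (by positivity) hk
  have hDw : D ≤ ε / 24 * w := by
    have h1 : 24 * D / ε ≤ w := by linarith
    rw [div_le_iff₀ hε] at h1
    linarith
  obtain ⟨θ, hθ, hθmax⟩ := hcompact.exists_isMaxOn ⟨_, hρ₀⟩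
    (ChainGame.continuous_averagedGap (G := G) I.η
      (ChainGame.iterate G I (fun u => s u ω) (fun u => a u ω)) k).continuousOn
  refine ⟨_, ?_, ⟨⟨θ, hθ, rfl⟩, ?_⟩⟩
  · rw [ChainGame.averagedGap_eq, div_le_iff₀ hw]
    obtain ⟨θ', hθ', hdist⟩ := Set.mem_iUnion₂.mp (hcover hθ)
    rw [Metric.mem_ball] at hdist
    have h1 : L * dist θ θ' ≤ ε / 24 := by
      rw [lt_div_iff₀ (by positivity)] at hdist
      nlinarith [dist_nonneg (x := θ) (y := θ')]
    have h2 : ∑ l ∈ Finset.Icc 1 k, I.η l * ChainGame.nikaidoIsoda G θ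
          (ChainGame.iterate G I (fun u => s u ω) (fun u => a u ω) l) ≤
        ∑ l ∈ Finset.Icc 1 k, (I.η l * ChainGame.nikaidoIsoda G θ'
          (ChainGame.iterate G I (fun u => s u ω) (fun u => a u ω) l) + ε / 24 * I.η l) := by
      refine Finset.sum_le_sum fun l _ => ?_
      have h3 := ChainGame.nikaidoIsoda_sub_le hδ θ θ' (ChainGame.algState_mem hρ₀ hmax
        (fun u => s u ω) (fun u => a u ω)
        (ChainGame.batchTime G I (fun u => s u ω) (fun u => a u ω) l))
      have h4 := mul_le_mul_of_nonneg_left (h3.trans h1) (hη l)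
      change _ ≤ I.η l * ChainGame.nikaidoIsoda G θ' (ChainGame.algState G I _ _
        (ChainGame.batchTime G I (fun u => s u ω) (fun u => a u ω) l)).ρ + _
      change I.η l * ChainGame.nikaidoIsoda G θ (ChainGame.algState G I _ _
        (ChainGame.batchTime G I (fun u => s u ω) (fun u => a u ω) l)).ρ ≤ _
      linarith
    rw [Finset.sum_add_distrib, ← Finset.mul_sum] at h2
    have h5 := hC θ' hθ' k
    have h6 : C θ' ≤ D := (le_abs_self _).trans
      (Finset.single_le_sum (f := fun θ => |C θ|) (fun _ _ => abs_nonneg _)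
        (hfin.mem_toFinset.mpr hθ'))
    linarith
  · rintro _ ⟨θ', hθ', rfl⟩
    exact hθmax hθ'
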